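/- Let $q\in L_1(0,1)$ be real-valued, $Q=\|q\|_{0,1}=\int_0^1|q(x)|\,dx$, let $N(u)=\sum_{i\ge 1}a_iu^i$ with real coefficients $a_i$, the series converging for every $u\in\mathbb R$, and let $\overline N\in C^\infty(\mathbb R)$ be a function with $|N^{(k)}(u)|\le \overline N^{(k)}(|u|)$ for all $u\in\mathbb R$, $k=0,1,2,\dots$. Consider the nonlinear eigenvalue transmission problem $$u_1''+[\lambda-q]u_1-N(u_1)=0 \text{ on } (0,\tfrac12),\qquad u_2''+[\lambda-q]u_2-N(u_2)=0 \text{ on } (\tfrac12,1),$$ $$u_1(0)=u_2(1)=0,\quad u_1'(0)=1,\quad u_2(\tfrac12)-u_1(\tfrac12)=0,\quad u_2'(\tfrac12)-u_1'(\tfrac12)=1, \qquad (*)$$ (equations understood almost everywhere, with $u_i\in C^1$ and $u_i'$ absolutely continuous). For a sequence $v$ and a function $g$ let $$A_j(g;v_0,\dots,v_j)=\sum_{\substack{\alpha_1+\dots+\alpha_j=j\\ \alpha_1\ge\dots\ge\alpha_j\ge0}} g^{(\alpha_1)}(v_0)\frac{v_1^{\alpha_1-\alpha_2}}{(\alpha_1-\alpha_2)!}\cdots\frac{v_{j-1}^{\alpha_{j-1}-\alpha_j}}{(\alpha_{j-1}-\alpha_j)!}\frac{v_j^{\alpha_j}}{\alpha_j!}\quad(j\ge1),\qquad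 A_0=g(v_0)$$ be the Adomian polynomials. The FD-algorithm starts from a trial eigenpair $(\lambda_n^{(0)},u_{n1}^{(0)},u_{n2}^{(0)})$, computes for $j=0,1,2,\dots$ the corrections $(\lambda_n^{(j+1)},u^{(j+1)}_{n1},u^{(j+1)}_{n2})$ as the solutions of $$u_{ni}^{(j+1)\prime\prime}+\lambda_n^{(0)}u_{ni}^{(j+1)}=-\sum_{p=0}^j\lambda_n^{(j+1-p)}u_{ni}^{(p)}+q\,u_{ni}^{(j)}+A_j(N;u_{ni}^{(0)},\dots,u_{ni}^{(j)}),\quad i=1,2,$$ with $u^{(j+1)}_{n1}(0)=u^{(j+1)}_{n2}(1)=u^{(j+1)\prime}_{n1}(0)=0$ and zero jumps of $u^{(j+1)}_n$ and of $u^{(j+1)\prime}_n$ at $x=\frac12$, and takes as approximations of rank $m$ the sums $\overset{m}{\lambda}_n=\sum_{j=0}^m\lambda_n^{(j)}$, $\overset{m}{u}_{ni}=\sum_{j=0}^mu_{ni}^{(j)}$. Put $\|f\|_\infty=\max\{\sup_{[0,1/2]}|f_1|,\sup_{[1/2,1]}|f_2|\}$. Let $\overline v_0=\frac83$, $\overline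 v_1=(1+\overline v_0)(Q\overline v_0+\overline N'(\overline v_0)\overline v_0)$ and, for $j\ge1$, $\overline v_{j+1}=\sum_{p=1}^j\overline v_{j+1-p}\overline v_p+(1+\overline v_0)\big(Q\overline v_j+A_j(\overline N;\overline v_0,\dots,\overline v_j)\big)$, and let $R\in[0,\infty]$ be the radius of convergence of $f(z)=\sum_{j\ge0}\overline v_jz^j$. Then $R>0$; for $0\le z<R$ $$f(z)-\overline v_0=[f(z)-\overline v_0]^2+(1+\overline v_0)z\big[Qf(z)+\overline N(f(z))+\overline N'(\overline v_0)\overline v_0-\overline N(\overline v_0)\big];$$ there are constants $c,\varepsilon>0$ with $$R^j\,\overline v_j\le \frac{c}{j^{1+\varepsilon}}\quad\text{for all } j\ge1;\qquad(**)$$ and for all $c,\varepsilon>0$ satisfying $(**)$ the following holds. (a) Let $\lambda_n^{(0)}=4\pi^2(\pm\frac23+2n)^2$, $n=0,1,\dots$, $u_{n1}^{(0)}(x)=\sin(\sqrt{\lambda_n^{(0)}}x)/\sqrt{\lambda_n^{(0)}}$, $u_{n2}^{(0)}(x)=\sin(\sqrt{\lambda_n^{(0)}}(1-x))/\sqrt{\lambda_n^{(0)}}$.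 Then the corrections exist, and $$\lambda_n^{(j+1)}=\gamma_n\sum_{i=1}^2\int_{I_i}\Big[-\sum_{p=1}^j\lambda_n^{(j+1-p)}u_{ni}^{(p)}+q\,u_{ni}^{(j)}+A_j(N;u_{ni}^{(0)},\dots,u_{ni}^{(j)})\Big]\psi_n\,dx,\quad I_1=(0,\tfrac12),\ I_2=(\tfrac12,1),\qquad(***)$$ with $\gamma_n=\frac83\sqrt{\lambda_n^{(0)}}$, $\psi_n(x)=\sin(\sqrt{\lambda_n^{(0)}}(1-x))$. If $r_n=\dfrac{2+\sqrt3}{\sqrt3\sqrt{\lambda_n^{(0)}}\,R}<1$, then the series $\sum_j\lambda_n^{(j)}$, $\sum_ju_{ni}^{(j)}$ converge to an eigensolution $(\lambda_n,u_n)$ of $(*)$, super-exponentially in the sense that, with $C=c/(1-r_n)$ and $\beta_n=\frac{3}{8\sqrt{\lambda_n^{(0)}}}$, for all $m\ge0$ $$\|u_n-\overset{m}{u}_n\|_\infty\le\sum_{j=m+1}^\infty\|u_n^{(j)}\|_\infty\le\frac{\beta_nC}{(m+1)^{1+\varepsilon}}r_n^{m+1},\qquad |\lambda_n-\overset{m}{\lambda}_n|\le\sum_{j=m+1}^\infty|\lambda_n^{(j)}|\le\frac{C}{(m+1)^{1+\varepsilon}R}r_n^{m}.\qquad(****)$$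 (b) Let $\lambda_n^{(0)}=4\pi^2n^2$, $n=1,2,\dots$, $u_{n1}^{(0)}(x)=\frac{\sin(2\pi nx)}{2\pi n}$, $u_{n2}^{(0)}(x)=\frac{(-1)^n+1}{2\pi n}\sin(2\pi nx)$. Then the corrections exist, and $(***)$ holds with $\psi_n(x)=\sin(2\pi nx)$ and $\gamma_n=\frac{8\pi n}3$ for even $n$, $\gamma_n=8\pi n$ for odd $n$. If $r_n=\dfrac1{\pi nR}<1$, then the series converge to an eigensolution $(\lambda_n,u_n)$ of $(*)$ with the estimates $(****)$, where $C=c/(1-r_n)$ and $\beta_n=\frac{3}{8\pi n}$ for even $n$, $\beta_n=\frac1{8\pi n}$ for odd $n$. (If $R=\infty$, then $1/R=0$ and $r_n=0$.) -/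

import Mathlib

open MeasureTheory Set
open scoped ENNReal Nat ContDiff

noncomputable section

/-- The `k`-th entry (counted from `0`) of a finite tuple, continued by zero. -/
def tupleEntry {j : ℕ} (α : Fin j → ℕ) (k : ℕ) : ℕ :=
  if h : k < j then α ⟨k, h⟩ else 0

open Classical in
/-- The Adomian polynomial `A_j(g; v_0, …, v_j)`: the sum over all integers
`α_1 ≥ … ≥ α_j ≥ 0` with `α_1 + … + α_j = j` of
`g^{(α_1)}(v_0) · ∏_{k=1}^{j} v_k^{α_k - α_{k+1}} / (α_k - α_{k+1})!` (with `α_{j+1} = 0`).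
In the code the entries are numbered from `0`. For `j = 0` the sum has the single
term `g (v_0)`. -/
def adomian (g : ℝ → ℝ) (v : ℕ → ℝ) (j : ℕ) : ℝ :=
  ∑ α ∈ (Finset.Nat.antidiagonalTuple j j).filter (fun α => Antitone α),
    iteratedDeriv (tupleEntry α 0) g (v 0) *
      ∏ k ∈ Finset.range j,
        v (k + 1) ^ (tupleEntry α k - tupleEntry α (k + 1)) /
          ((tupleEntry α k - tupleEntry α (k + 1))! : ℝ)

/-- `A_j` depends only on `v_0, …, v_j`. -/
theorem adomian_congr (g : ℝ → ℝ) {v w : ℕ → ℝ} {j : ℕ} (h : ∀ k ≤ j, v k = w k) :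
    adomian g v j = adomian g w j := by
  classical
  unfold adomian
  refine Finset.sum_congr rfl fun α _ => ?_
  rw [h 0 (Nat.zero_le j)]
  congr 1
  refine Finset.prod_congr rfl fun k hk => ?_
  rw [h (k + 1) (Finset.mem_range.mp hk)]

/-- The majorant sequence `v̄_j` for `Q = ‖q‖_{L¹(0,1)}` and the majorant `G` of the nonlinearity:
`v̄_0 = 8/3`, `v̄_1 = (1 + v̄_0) (Q v̄_0 + G'(v̄_0) v̄_0)` and, for `j ≥ 1`,
`v̄_{j+1} = ∑_{p=1}^{j} v̄_{j+1-p} v̄_p + (1 + v̄_0) (Q v̄_j + A_j(G; v̄_0, …, v̄_j))`. -/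
def majorantSeq (Q : ℝ) (G : ℝ → ℝ) : ℕ → ℝ
  | 0 => 8 / 3
  | 1 => (1 + 8 / 3) * (Q * (8 / 3) + deriv G (8 / 3) * (8 / 3))
  | j + 2 =>
      ∑ p : Fin (j + 1), majorantSeq Q G (j + 1 - (p : ℕ)) * majorantSeq Q G ((p : ℕ) + 1) +
        (1 + 8 / 3) * (Q * majorantSeq Q G (j + 1) +
          adomian G (fun k => if _h : k < j + 2 then majorantSeq Q G k else 0) (j + 1))

theorem majorantSeq_zero (Q : ℝ) (G : ℝ → ℝ) : majorantSeq Q G 0 = 8 / 3 := by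
  rw [majorantSeq]

theorem majorantSeq_one (Q : ℝ) (G : ℝ → ℝ) :
    majorantSeq Q G 1 = (1 + majorantSeq Q G 0) *
      (Q * majorantSeq Q G 0 + deriv G (majorantSeq Q G 0) * majorantSeq Q G 0) := by
  rw [majorantSeq_zero, majorantSeq]

/-- The recurrence in the form with `∑_{p=1}^{j}`, for `j ≥ 1`. -/
theorem majorantSeq_succ (Q : ℝ) (G : ℝ → ℝ) {j : ℕ} (hj : 1 ≤ j) :
    majorantSeq Q G (j + 1) =
      ∑ p ∈ Finset.Icc 1 j, majorantSeq Q G (j + 1 - p) * majorantSeq Q G p +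
        (1 + majorantSeq Q G 0) * (Q * majorantSeq Q G j + adomian G (majorantSeq Q G) j) := by
  obtain ⟨i, rfl⟩ : ∃ i, j = i + 1 := ⟨j - 1, by omega⟩
  rw [majorantSeq_zero, majorantSeq]
  congr 1
  · have hI : Finset.Icc 1 (i + 1) = Finset.Ico (0 + 1) (i + 1 + 1) := by
      ext k
      simp only [Finset.mem_Icc, Finset.mem_Ico]
      omega
    rw [hI, ← Finset.sum_Ico_add', ← Finset.range_eq_Ico, Finset.sum_range]
    refine Finset.sum_congr rfl fun p _ => ?_
    rw [show i + 1 + 1 - ((p : ℕ) + 1) = i + 1 - p by omega]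
  · rw [adomian_congr G (w := majorantSeq Q G)]
    intro k hk
    simp [show k < i + 2 by omega]

/-- The radius of convergence `R ∈ [0, ∞]` of the generating function
`f(z) = ∑_{j ≥ 0} v̄_j z^j` of the majorant sequence. -/
def majorantRadius (Q : ℝ) (G : ℝ → ℝ) : ℝ≥0∞ :=
  (FormalMultilinearSeries.ofScalars ℝ (majorantSeq Q G)).radius

/-- `w'' = g` on `(a, b)` in the sense of Carathéodory, with first derivative `d`: `w` is
differentiable on `[a, b]` (one-sidedly at the end points) with derivative `d`, the function `d`
is absolutely continuous on `[a, b]`, and `d' = g` almost everywhere on `(a, b)`. -/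
def SecondDerivEq (a b : ℝ) (w d g : ℝ → ℝ) : Prop :=
  (∀ x ∈ Icc a b, HasDerivWithinAt w (d x) (Icc a b) x) ∧
    AbsolutelyContinuousOnInterval d a b ∧
    ∀ᵐ x ∂(volume.restrict (Ioo a b)), HasDerivAt d (g x) x

/-- The pair `w_1` on `[0, 1/2]`, `w_2` on `[1/2, 1]` satisfies `w_1'' = g_1` on `(0, 1/2)`,
`w_2'' = g_2` on `(1/2, 1)`, `w_1(0) = w_2(1) = 0`, `w_1'(0) = s`, and the matching conditions
`[w(1/2)] = 0`, `[w'(1/2)] = J`. -/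
def SolvesTransmission (g₁ g₂ : ℝ → ℝ) (s J : ℝ) (w₁ w₂ : ℝ → ℝ) : Prop :=
  ∃ d₁ d₂ : ℝ → ℝ,
    SecondDerivEq 0 (1 / 2) w₁ d₁ g₁ ∧ SecondDerivEq (1 / 2) 1 w₂ d₂ g₂ ∧
    w₁ 0 = 0 ∧ w₂ 1 = 0 ∧ d₁ 0 = s ∧
    w₂ (1 / 2) - w₁ (1 / 2) = 0 ∧ d₂ (1 / 2) - d₁ (1 / 2) = J

/-- `(lam, u_1, u_2)` is an eigensolution of the nonlinear transmission problem
`u_i'' + (lam - q) u_i - N(u_i) = 0`, `u_1(0) = u_2(1) = 0`, `u_1'(0) = 1`,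
`[u(1/2)] = 0`, `[u'(1/2)] = 1`. -/
def IsEigensolution (q N : ℝ → ℝ) (lam : ℝ) (u₁ u₂ : ℝ → ℝ) : Prop :=
  SolvesTransmission
    (fun x => N (u₁ x) - (lam - q x) * u₁ x)
    (fun x => N (u₂ x) - (lam - q x) * u₂ x) 1 1 u₁ u₂

/-- The function
`-∑_{p=1}^{j} lam^{(j+1-p)} u^{(p)}(x) + q(x) u^{(j)}(x) + A_j(N; u^{(0)}(x), …, u^{(j)}(x))`. -/
def fdSource (q N : ℝ → ℝ) (lam : ℕ → ℝ) (u : ℕ → ℝ → ℝ) (j : ℕ) (x : ℝ) : ℝ :=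
  -∑ p ∈ Finset.Icc 1 j, lam (j + 1 - p) * u p x + q x * u j x + adomian N (fun k => u k x) j

/-- The right-hand side `F^{(j+1)}`, in which the sum starts with `p = 0`. -/
def fdRhs (q N : ℝ → ℝ) (lam : ℕ → ℝ) (u : ℕ → ℝ → ℝ) (j : ℕ) (x : ℝ) : ℝ :=
  -∑ p ∈ Finset.range (j + 1), lam (j + 1 - p) * u p x + q x * u j x +
    adomian N (fun k => u k x) j

/-- The FD-method started from the trial eigenpair `(lam₀, φ_1, φ_2)`: it is the zeroth
approximation, and for every `j ≥ 0` the correction `(lam^{(j+1)}, u_1^{(j+1)}, u_2^{(j+1)})` solves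
`u_i^{(j+1)}'' + lam₀ u_i^{(j+1)} = F_i^{(j+1)}` with homogeneous boundary, initial and
matching conditions. -/
def IsFDSequence (q N : ℝ → ℝ) (lam₀ : ℝ) (φ₁ φ₂ : ℝ → ℝ)
    (lam : ℕ → ℝ) (u₁ u₂ : ℕ → ℝ → ℝ) : Prop :=
  lam 0 = lam₀ ∧ (∀ x ∈ Icc (0 : ℝ) (1 / 2), u₁ 0 x = φ₁ x) ∧
  (∀ x ∈ Icc (1 / 2 : ℝ) 1, u₂ 0 x = φ₂ x) ∧
  ∀ j : ℕ, SolvesTransmission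
    (fun x => fdRhs q N lam u₁ j x - lam₀ * u₁ (j + 1) x)
    (fun x => fdRhs q N lam u₂ j x - lam₀ * u₂ (j + 1) x) 0 0 (u₁ (j + 1)) (u₂ (j + 1))

/-- The norm `max (sup_{[0,1/2]} |f_1|) (sup_{[1/2,1]} |f_2|)`, as an element of `[0, ∞]`. -/
def pairNorm (f₁ f₂ : ℝ → ℝ) : ℝ≥0∞ :=
  max (⨆ x ∈ Icc (0 : ℝ) (1 / 2), ‖f₁ x‖ₑ) (⨆ x ∈ Icc (1 / 2 : ℝ) 1, ‖f₂ x‖ₑ)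

/-- The series `∑ lam^{(j)}`, `∑ u_i^{(j)}` converge to `(lam_*, U_1, U_2)` and, for every
rank `m`, the errors of the partial sums satisfy
`‖U - ∑_{j ≤ m} u^{(j)}‖ ≤ ∑_{j > m} ‖u^{(j)}‖ ≤ β C / (m+1)^{1+ε} · r^{m+1}` and
`|lam_* - ∑_{j ≤ m} lam^{(j)}| ≤ ∑_{j > m} |lam^{(j)}| ≤ C S / (m+1)^{1+ε} · r^m`.
(`S` stands for `1 / R`.) -/
def FDErrorEstimate (C ε β r S : ℝ) (lam : ℕ → ℝ) (u₁ u₂ : ℕ → ℝ → ℝ)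
    (lamLim : ℝ) (U₁ U₂ : ℝ → ℝ) : Prop :=
  HasSum lam lamLim ∧
  (∀ x ∈ Icc (0 : ℝ) (1 / 2), HasSum (fun j => u₁ j x) (U₁ x)) ∧
  (∀ x ∈ Icc (1 / 2 : ℝ) 1, HasSum (fun j => u₂ j x) (U₂ x)) ∧
  ∀ m : ℕ,
    pairNorm (fun x => U₁ x - ∑ j ∈ Finset.range (m + 1), u₁ j x)
        (fun x => U₂ x - ∑ j ∈ Finset.range (m + 1), u₂ j x) ≤
      ∑' j : ℕ, pairNorm (u₁ (m + 1 + j)) (u₂ (m + 1 + j)) ∧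
    ∑' j : ℕ, pairNorm (u₁ (m + 1 + j)) (u₂ (m + 1 + j)) ≤
      ENNReal.ofReal (β * C / ((m : ℝ) + 1) ^ (1 + ε) * r ^ (m + 1)) ∧
    ‖lamLim - ∑ j ∈ Finset.range (m + 1), lam j‖ₑ ≤ ∑' j : ℕ, ‖lam (m + 1 + j)‖ₑ ∧
    ∑' j : ℕ, ‖lam (m + 1 + j)‖ₑ ≤
      ENNReal.ofReal (C * S / ((m : ℝ) + 1) ^ (1 + ε) * r ^ m)

/-- The convergence ratio `r = κ / R ∈ [0, ∞]`. -/
def fdRatio (Q : ℝ) (G : ℝ → ℝ) (κ : ℝ) : ℝ≥0∞ :=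
  ENNReal.ofReal κ / majorantRadius Q G

/-- The statement that the FD-algorithm started from `(lam₀, φ_1, φ_2)` is well defined, that its
eigenvalue corrections are given by
`lam^{(j+1)} = γ (∫_0^{1/2} [⋯]_1 ψ + ∫_{1/2}^1 [⋯]_2 ψ)` with `[⋯]_i` the function `fdSource`, and
that, provided `r = κ / R < 1`, it converges to an eigensolution of the nonlinear problem
with the error estimates of `FDErrorEstimate` for `C = c / (1 - r)`. -/
def FDConverges (q N G : ℝ → ℝ) (lam₀ : ℝ) (φ₁ φ₂ : ℝ → ℝ) (γ : ℝ) (ψ : ℝ → ℝ)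
    (κ β c ε : ℝ) : Prop :=
  let Q : ℝ := ∫ x in Ioo (0 : ℝ) 1, |q x|
  let r : ℝ≥0∞ := fdRatio Q G κ
  (∃ (lam : ℕ → ℝ) (u₁ u₂ : ℕ → ℝ → ℝ), IsFDSequence q N lam₀ φ₁ φ₂ lam u₁ u₂) ∧
  ∀ (lam : ℕ → ℝ) (u₁ u₂ : ℕ → ℝ → ℝ), IsFDSequence q N lam₀ φ₁ φ₂ lam u₁ u₂ →
    (∀ j : ℕ, lam (j + 1) =
      γ * ((∫ x in (0 : ℝ)..(1 / 2), fdSource q N lam u₁ j x * ψ x) +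
        ∫ x in (1 / 2 : ℝ)..1, fdSource q N lam u₂ j x * ψ x)) ∧
    (r < 1 →
      ∃ (lamLim : ℝ) (U₁ U₂ : ℝ → ℝ), IsEigensolution q N lamLim U₁ U₂ ∧
        FDErrorEstimate (c / (1 - r.toReal)) ε β r.toReal (majorantRadius Q G)⁻¹.toReal
          lam u₁ u₂ lamLim U₁ U₂)

end

/-! Adomian polynomials are Taylor coefficients. With m_l = α_l - α_{l+1}, the sum defining A_j(g;
v) becomes the coefficient of X^j in g(v_0 + ∑_{i≥1} v_i X^i), expanded at v_0
(`adomian_eq_sum_coeff_pow`). Hence they add up to g(∑ v_j) under absolute convergence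
(`hasSum_adomian`), and passing to majorants can only enlarge them (`abs_adomian_le`).

For the majorant sequence put S = f - v̄_0. Its recurrence says S = S² + z H(S), where H is
`majorantRhs` and has nonnegative Taylor coefficients at 0. For small z the partial sums stay below
1/2, so R > 0. Since S ≥ S², S ≤ 1 on [0, R), so the series still converges at a finite R. Formally
S = X Φ(S) with Φ = H/(1 - X), and Lagrange inversion gives n v̄_n = [X^{n-1}] Φ^n. If τ = S(R) > 0,
then (R/τ) Φ(τX) is a probability generating function that charges 0 and 1, so Fourier inversion
bounds the coefficients of its n-th power by C/√n. This yields R^n v̄_n = O(n^{-3/2}), that is (**)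
with ε = 1/2 (`exists_majorantSeq_bound`).

For the FD-method put s = √λ^{(0)}. Glued across 1/2, a correction is the Volterra integral of its
right-hand side with kernel sin(s(x - t))/s. The condition at x = 1 is then a scalar linear equation
for λ^{(j+1)}, solvable because the Volterra integral of the trial function at 1 is ±β/s. Induction
gives |λ^{(j+1)}| ≤ κ^j v̄_{j+1} and |u^{(j+1)}| ≤ β κ^{j+1} v̄_{j+1}
(`IsVolterraFD.corrections_le`), with r = κ/R. Dominated convergence sums the recurrences to an
integral equation whose solutions solve (*), and (**) with a geometric series gives the error
bounds. The size of the trial pairs (a) and (b) enters only through the constants of `TrialBounds`.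
-/

/-! ### Adomian polynomials as coefficients of a composition -/

theorem sum_Ico_sub_succ_of_antitone {a : ℕ → ℕ} (ha : Antitone a) {i j : ℕ} (hij : i ≤ j) :
    ∑ l ∈ Finset.Ico i j, (a l - a (l + 1)) = a i - a j := by
  induction j, hij using Nat.le_induction with
  | base => simp
  | succ j hij ih =>
    rw [Finset.sum_Ico_succ_top hij, ih]
    have h1 := ha hij
    have h2 := ha (Nat.le_succ j)
    simp only [Nat.succ_eq_add_one] at h2
    omega

/-- Abel summation. It turns the condition ∑ α_l = j on a partition into ∑ (l + 1) m_l = j for the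
differences m_l. -/
theorem sum_range_succ_mul_sub_succ_of_antitone {a : ℕ → ℕ} (ha : Antitone a) (j : ℕ) :
    ∑ l ∈ Finset.range j, (l + 1) * (a l - a (l + 1)) + j * a j = ∑ l ∈ Finset.range j, a l := by
  induction j with
  | zero => simp
  | succ j ih =>
    rw [Finset.sum_range_succ, Finset.sum_range_succ, ← ih]
    obtain ⟨d, hd⟩ := Nat.exists_eq_add_of_le (ha (Nat.le_succ j))
    simp only [Nat.succ_eq_add_one] at hd
    rw [hd, Nat.add_sub_cancel_left]
    ring

theorem tupleEntry_antitone {j : ℕ} {α : Fin j → ℕ} (hα : Antitone α) :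
    Antitone (tupleEntry α) := by
  intro k l hkl
  unfold tupleEntry
  split_ifs with h1 h2
  · exact hα (by simpa using hkl)
  · omega
  · exact Nat.zero_le _
  · exact le_rfl

theorem tupleEntry_of_le {j : ℕ} (α : Fin j → ℕ) {k : ℕ} (hk : j ≤ k) : tupleEntry α k = 0 := by
  simp [tupleEntry, hk]

theorem sum_range_tupleEntry {j : ℕ} (α : Fin j → ℕ) :
    ∑ l ∈ Finset.range j, tupleEntry α l = ∑ i, α i := by
  rw [Finset.sum_range]
  refine Finset.sum_congr rfl fun i _ => ?_
  simp [tupleEntry]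

theorem tupleEntry_tail_sum {j : ℕ} (m : ℕ → ℕ) (k : ℕ) :
    tupleEntry (fun i : Fin j => ∑ l ∈ Finset.Ico (i : ℕ) j, m l) k = ∑ l ∈ Finset.Ico k j, m l := by
  unfold tupleEntry
  split_ifs with h
  · rfl
  · rw [Finset.Ico_eq_empty_of_le (by omega), Finset.sum_empty]

theorem tail_sum_antitone (m : ℕ → ℕ) (j : ℕ) :
    Antitone fun k => ∑ l ∈ Finset.Ico k j, m l := fun _ _ h =>
  Finset.sum_le_sum_of_subset (Finset.Ico_subset_Ico_left h)

theorem tail_sum_sub_succ (m : ℕ → ℕ) {k j : ℕ} (h : k < j) :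
    ∑ l ∈ Finset.Ico k j, m l - ∑ l ∈ Finset.Ico (k + 1) j, m l = m k := by
  rw [Finset.sum_eq_sum_Ico_succ_bot h]
  omega

theorem sum_range_tail_sum (m : ℕ → ℕ) (j : ℕ) :
    ∑ k ∈ Finset.range j, ∑ l ∈ Finset.Ico k j, m l = ∑ l ∈ Finset.range j, (l + 1) * m l := by
  have h := sum_range_succ_mul_sub_succ_of_antitone (tail_sum_antitone m j) j
  rw [← h, Finset.Ico_self, Finset.sum_empty, mul_zero, add_zero]
  refine Finset.sum_congr rfl fun l hl => ?_
  rw [tail_sum_sub_succ m (Finset.mem_range.mp hl)]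

/-- The multiplicity form of the Adomian polynomial. -/
theorem adomian_eq_sum_multiplicities (g : ℝ → ℝ) (v : ℕ → ℝ) (j : ℕ) :
    adomian g v j = ∑ k ∈ Finset.range (j + 1),
      ∑ m ∈ (Finset.piAntidiag (Finset.range j) k).filter
          (fun m => ∑ l ∈ Finset.range j, (l + 1) * m l = j),
        iteratedDeriv k g (v 0) * ∏ l ∈ Finset.range j, v (l + 1) ^ m l / ((m l)! : ℝ) := by
  classical
  rw [Finset.sum_sigma']
  unfold adomian
  -- Conjugation of partitions: α goes to its differences, which count how often each v_l occurs,
  -- and the inverse takes tail sums. The largest part α_1 is the total multiplicity k.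
  refine Finset.sum_bij' (fun α _ => (⟨tupleEntry α 0,
      fun i => tupleEntry α i - tupleEntry α (i + 1)⟩ : Σ _ : ℕ, ℕ → ℕ))
    (fun p _ => fun i : Fin j => ∑ l ∈ Finset.Ico (i : ℕ) j, p.2 l) ?_ ?_ ?_ ?_ ?_
  · intro α hα
    simp only [Finset.mem_filter, Finset.Nat.mem_antidiagonalTuple] at hα
    obtain ⟨hsum, hanti⟩ := hα
    have ha := tupleEntry_antitone hanti
    have h2 := sum_range_succ_mul_sub_succ_of_antitone ha j
    have h1 := sum_Ico_sub_succ_of_antitone ha (Nat.zero_le j)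
    rw [tupleEntry_of_le α le_rfl] at h1 h2
    rw [sum_range_tupleEntry, hsum] at h2
    rw [Nat.sub_zero, ← Finset.range_eq_Ico] at h1
    simp only [mul_zero, add_zero] at h2
    simp only [Finset.mem_sigma, Finset.mem_range, Finset.mem_filter, Finset.mem_piAntidiag]
    refine ⟨?_, ⟨h1, fun i hi => ?_⟩, h2⟩
    · rw [← h1]
      refine Nat.lt_succ_of_le ?_
      conv_rhs => rw [← h2]
      exact Finset.sum_le_sum fun l _ => Nat.le_mul_of_pos_left _ (Nat.succ_pos l)
    · by_contra hij
      rw [tupleEntry_of_le α (by omega), tupleEntry_of_le α (by omega)] at hi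
      simp at hi
  · rintro ⟨k, m⟩ hp
    simp only [Finset.mem_sigma, Finset.mem_range, Finset.mem_filter,
      Finset.mem_piAntidiag] at hp
    obtain ⟨-, ⟨hk, hm⟩, hs⟩ := hp
    simp only [Finset.mem_filter, Finset.Nat.mem_antidiagonalTuple]
    refine ⟨?_, fun a b hab => tail_sum_antitone m j hab⟩
    have h := sum_range_tail_sum m j
    rw [hs, Finset.sum_range] at h
    exact h
  · intro α hα
    simp only [Finset.mem_filter, Finset.Nat.mem_antidiagonalTuple] at hα
    funext i
    have ha := tupleEntry_antitone hα.2
    simp only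
    rw [sum_Ico_sub_succ_of_antitone ha i.2.le, tupleEntry_of_le α le_rfl]
    simp [tupleEntry]
  · rintro ⟨k, m⟩ hp
    simp only [Finset.mem_sigma, Finset.mem_range, Finset.mem_filter,
      Finset.mem_piAntidiag] at hp
    obtain ⟨-, ⟨hk, hm⟩, hs⟩ := hp
    have e1 : tupleEntry (fun i : Fin j => ∑ l ∈ Finset.Ico (i : ℕ) j, m l) 0 = k := by
      rw [tupleEntry_tail_sum, ← Finset.range_eq_Ico, hk]
    have e2 : (fun i => tupleEntry (fun i : Fin j => ∑ l ∈ Finset.Ico (i : ℕ) j, m l) i -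
        tupleEntry (fun i : Fin j => ∑ l ∈ Finset.Ico (i : ℕ) j, m l) (i + 1)) = m := by
      funext i
      rw [tupleEntry_tail_sum, tupleEntry_tail_sum]
      by_cases hi : i < j
      · exact tail_sum_sub_succ m hi
      · rw [Finset.Ico_eq_empty_of_le (by omega), Finset.Ico_eq_empty_of_le (by omega)]
        by_contra h
        exact hi (hm i (fun h0 => h (by simp [h0])))
    simp only [e1, e2]
  · intro α _
    rfl

/-- The formal power series `∑_{i ≥ 1} v_i X^i`. -/
noncomputable def tailSeries (v : ℕ → ℝ) : PowerSeries ℝ :=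
  PowerSeries.mk fun i => if i = 0 then 0 else v i

theorem coeff_tailSeries_zero (v : ℕ → ℝ) : PowerSeries.coeff 0 (tailSeries v) = 0 := by
  simp [tailSeries]

theorem constantCoeff_tailSeries (v : ℕ → ℝ) :
    PowerSeries.constantCoeff (tailSeries v) = 0 := by
  rw [← PowerSeries.coeff_zero_eq_constantCoeff_apply, coeff_tailSeries_zero]

theorem coeff_tailSeries_succ (v : ℕ → ℝ) (i : ℕ) :
    PowerSeries.coeff (i + 1) (tailSeries v) = v (i + 1) := by
  simp [tailSeries]

theorem coeff_pow_congr {F G : PowerSeries ℝ} {j : ℕ}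
    (h : ∀ i ≤ j, PowerSeries.coeff i F = PowerSeries.coeff i G) (k : ℕ) :
    ∀ i ≤ j, PowerSeries.coeff i (F ^ k) = PowerSeries.coeff i (G ^ k) := by
  induction k with
  | zero => simp
  | succ k ih =>
    intro i hi
    rw [pow_succ, pow_succ, PowerSeries.coeff_mul, PowerSeries.coeff_mul]
    refine Finset.sum_congr rfl fun p hp => ?_
    have := Finset.HasAntidiagonal.mem_antidiagonal.mp hp
    rw [ih p.1 (by omega), h p.2 (by omega)]

theorem coeff_tailSeries_pow (v : ℕ → ℝ) (j k : ℕ) :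
    PowerSeries.coeff j (tailSeries v ^ k) =
      ∑ m ∈ (Finset.piAntidiag (Finset.range j) k).filter
          (fun m => ∑ l ∈ Finset.range j, (l + 1) * m l = j),
        (k ! : ℝ) * ∏ l ∈ Finset.range j, v (l + 1) ^ m l / ((m l)! : ℝ) := by
  classical
  -- Only the degrees 1, …, j can reach the coefficient of X^j, so the series is replaced by a
  -- polynomial to which the multinomial theorem applies.
  set P : PowerSeries ℝ := ∑ l ∈ Finset.range j, PowerSeries.monomial (l + 1) (v (l + 1)) with hP
  have hcoef : ∀ i ≤ j, PowerSeries.coeff i (tailSeries v) = PowerSeries.coeff i P := by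
    intro i hi
    rw [hP, map_sum]
    simp only [PowerSeries.coeff_monomial]
    rcases i with _ | i
    · rw [coeff_tailSeries_zero, Finset.sum_eq_zero]
      intro l _
      simp
    · rw [coeff_tailSeries_succ, Finset.sum_eq_single i]
      · simp
      · intro b _ hb
        rw [if_neg (by omega)]
      · intro h
        exact absurd (Finset.mem_range.mpr (by omega)) h
  rw [coeff_pow_congr hcoef k j le_rfl, hP, Finset.sum_pow_eq_sum_piAntidiag, map_sum,
    Finset.sum_filter]
  refine Finset.sum_congr rfl fun m hm => ?_
  have hk := (Finset.mem_piAntidiag.mp hm).1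
  have hprod : ∏ l ∈ Finset.range j, (PowerSeries.monomial (l + 1) (v (l + 1))) ^ m l =
      PowerSeries.monomial (∑ l ∈ Finset.range j, (l + 1) * m l)
        (∏ l ∈ Finset.range j, v (l + 1) ^ m l) := by
    simp only [PowerSeries.monomial_pow]
    rw [PowerSeries.prod_monomial]
    simp only [mul_comm]
  rw [hprod, ← map_natCast (PowerSeries.C (R := ℝ)), PowerSeries.coeff_C_mul,
    PowerSeries.coeff_monomial]
  by_cases hj : ∑ l ∈ Finset.range j, (l + 1) * m l = j
  · rw [if_pos hj.symm, if_pos hj, Finset.prod_div_distrib]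
    have hspec := Nat.multinomial_spec (Finset.range j) m
    rw [hk] at hspec
    have hne : (∏ l ∈ Finset.range j, ((m l)! : ℝ)) ≠ 0 :=
      Finset.prod_ne_zero_iff.mpr fun l _ => by positivity
    have hspec' : (∏ l ∈ Finset.range j, ((m l)! : ℝ)) * Nat.multinomial (Finset.range j) m
        = (k ! : ℝ) := by
      rw [← hspec]; push_cast; rfl
    rw [← hspec']
    field_simp
  · rw [if_neg (Ne.symm hj), if_neg hj, mul_zero]

/-- Adomian polynomials are the coefficients of the composition of the Taylor series of `g` at
`v_0` with `∑_{i ≥ 1} v_i X^i`. -/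
theorem adomian_eq_sum_coeff_pow (g : ℝ → ℝ) (v : ℕ → ℝ) (j : ℕ) :
    adomian g v j = ∑ k ∈ Finset.range (j + 1),
      iteratedDeriv k g (v 0) / (k ! : ℝ) * PowerSeries.coeff j (tailSeries v ^ k) := by
  rw [adomian_eq_sum_multiplicities]
  refine Finset.sum_congr rfl fun k _ => ?_
  rw [coeff_tailSeries_pow, Finset.mul_sum]
  refine Finset.sum_congr rfl fun m _ => ?_
  have : (k ! : ℝ) ≠ 0 := by positivity
  field_simp

theorem adomian_zero (g : ℝ → ℝ) (v : ℕ → ℝ) : adomian g v 0 = g (v 0) := by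
  rw [adomian_eq_sum_coeff_pow]
  simp

/-- Scaling of the Adomian polynomials. -/
theorem adomian_scale (g : ℝ → ℝ) (v : ℕ → ℝ) (z : ℝ) (j : ℕ) :
    adomian g (fun i => z ^ i * v i) j = z ^ j * adomian g v j := by
  rw [adomian_eq_sum_multiplicities, adomian_eq_sum_multiplicities, Finset.mul_sum]
  refine Finset.sum_congr rfl fun k _ => ?_
  rw [Finset.mul_sum]
  refine Finset.sum_congr rfl fun m hm => ?_
  have hj := (Finset.mem_filter.mp hm).2
  have h : ∏ l ∈ Finset.range j, (z ^ (l + 1) * v (l + 1)) ^ m l / ((m l)! : ℝ) =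
      z ^ j * ∏ l ∈ Finset.range j, v (l + 1) ^ m l / ((m l)! : ℝ) := by
    conv_rhs => rw [← hj]
    rw [← Finset.prod_pow_eq_pow_sum, hj, ← Finset.prod_mul_distrib]
    refine Finset.prod_congr rfl fun l _ => ?_
    rw [mul_pow, ← pow_mul, mul_div_assoc]
  simp only [pow_zero, one_mul]
  rw [h]
  ring

/-- Majorization of the Adomian polynomials. -/
theorem abs_adomian_le {g G : ℝ → ℝ} {v w : ℕ → ℝ} {β κ : ℝ} (hβ : 0 ≤ β) (hβ1 : β ≤ 1) {j : ℕ}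
    (hj : 1 ≤ j) (hg : ∀ k, |iteratedDeriv k g (v 0)| ≤ iteratedDeriv k G (w 0))
    (hv : ∀ k, 1 ≤ k → k ≤ j → |v k| ≤ β * (κ ^ k * w k)) :
    |adomian g v j| ≤ β * (κ ^ j * adomian G w j) := by
  rw [adomian_eq_sum_multiplicities, ← adomian_scale, adomian_eq_sum_multiplicities,
    Finset.mul_sum]
  refine (Finset.abs_sum_le_sum_abs _ _).trans (Finset.sum_le_sum fun k _ => ?_)
  rw [Finset.mul_sum]
  refine (Finset.abs_sum_le_sum_abs _ _).trans (Finset.sum_le_sum fun m hm => ?_)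
  obtain ⟨hm1, hm2⟩ := Finset.mem_filter.mp hm
  have hk := (Finset.mem_piAntidiag.mp hm1).1
  -- As j ≥ 1, no monomial is free of the v_l. So each carries a factor β^k with k ≥ 1, and β^k ≤ β
  -- because β ≤ 1.
  have hk1 : 1 ≤ k := by
    rw [← hk]
    by_contra h0
    have h0' : ∑ l ∈ Finset.range j, m l = 0 := by
      simpa using h0
    rw [Finset.sum_eq_zero_iff] at h0'
    rw [Finset.sum_eq_zero fun l hl => by rw [h0' l hl, mul_zero]] at hm2
    omega
  have hw : ∀ l ∈ Finset.range j, 0 ≤ β * (κ ^ (l + 1) * w (l + 1)) := fun l hl =>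
    (abs_nonneg _).trans (hv (l + 1) (by omega) (by have := Finset.mem_range.mp hl; omega))
  have h1 : |∏ l ∈ Finset.range j, v (l + 1) ^ m l / ((m l)! : ℝ)| ≤
      ∏ l ∈ Finset.range j, (β * (κ ^ (l + 1) * w (l + 1))) ^ m l / ((m l)! : ℝ) := by
    rw [Finset.abs_prod]
    refine Finset.prod_le_prod (fun l _ => abs_nonneg _) fun l hl => ?_
    rw [abs_div, abs_pow, Nat.abs_cast]
    gcongr
    exact hv (l + 1) (by omega) (by have := Finset.mem_range.mp hl; omega)
  have h2 : ∏ l ∈ Finset.range j, (β * (κ ^ (l + 1) * w (l + 1))) ^ m l / ((m l)! : ℝ) =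
      β ^ k * ∏ l ∈ Finset.range j, (κ ^ (l + 1) * w (l + 1)) ^ m l / ((m l)! : ℝ) := by
    rw [← hk, ← Finset.prod_pow_eq_pow_sum, ← Finset.prod_mul_distrib]
    refine Finset.prod_congr rfl fun l _ => ?_
    rw [mul_pow, mul_div_assoc]
  -- The hypotheses give the sign of κ^l w_l only after multiplication by β, so β = 0 is treated
  -- apart.
  rcases hβ.eq_or_lt with h0 | hpos
  · rw [abs_mul, ← h0, zero_mul]
    rw [h2, ← h0, zero_pow (by omega), zero_mul] at h1
    rw [le_antisymm h1 (abs_nonneg _), mul_zero]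
  have h3 : 0 ≤ ∏ l ∈ Finset.range j, (κ ^ (l + 1) * w (l + 1)) ^ m l / ((m l)! : ℝ) := by
    refine Finset.prod_nonneg fun l hl => div_nonneg (pow_nonneg ?_ _) (by positivity)
    exact nonneg_of_mul_nonneg_right (hw l hl) hpos
  have h4 : β ^ k ≤ β := by
    simpa using pow_le_pow_of_le_one hβ hβ1 hk1
  simp only [pow_zero, one_mul]
  rw [abs_mul]
  calc _ ≤ iteratedDeriv k G (w 0) * (β ^ k *
        ∏ l ∈ Finset.range j, (κ ^ (l + 1) * w (l + 1)) ^ m l / ((m l)! : ℝ)) := by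
        refine mul_le_mul (hg k) (h1.trans h2.le) (abs_nonneg _) ((abs_nonneg _).trans (hg k))
    _ ≤ iteratedDeriv k G (w 0) * (β *
        ∏ l ∈ Finset.range j, (κ ^ (l + 1) * w (l + 1)) ^ m l / ((m l)! : ℝ)) := by
        refine mul_le_mul_of_nonneg_left (mul_le_mul_of_nonneg_right h4 h3)
          ((abs_nonneg _).trans (hg k))
    _ = _ := by ring

theorem adomian_nonneg {g : ℝ → ℝ} {v : ℕ → ℝ} {j : ℕ} (hg : ∀ k, 0 ≤ iteratedDeriv k g (v 0))
    (hv : ∀ k, 1 ≤ k → k ≤ j → 0 ≤ v k) : 0 ≤ adomian g v j := by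
  rw [adomian_eq_sum_multiplicities]
  refine Finset.sum_nonneg fun k _ => Finset.sum_nonneg fun m _ => mul_nonneg (hg k) ?_
  refine Finset.prod_nonneg fun l hl => div_nonneg (pow_nonneg (hv _ (by omega) ?_) _)
    (by positivity)
  have := Finset.mem_range.mp hl
  omega

theorem adomian_eq_zero {g : ℝ → ℝ} {v : ℕ → ℝ} {j : ℕ} (hj : 1 ≤ j)
    (hv : ∀ k, 1 ≤ k → k ≤ j → v k = 0) : adomian g v j = 0 := by
  rw [adomian_eq_sum_coeff_pow]
  refine Finset.sum_eq_zero fun k _ => ?_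
  have h : ∀ i ≤ j, PowerSeries.coeff i (tailSeries v) = PowerSeries.coeff i 0 := by
    intro i hi
    rcases i with _ | i
    · simp [constantCoeff_tailSeries]
    · rw [coeff_tailSeries_succ, hv _ (by omega) hi, map_zero]
  rw [coeff_pow_congr h k j le_rfl]
  rcases k with _ | k
  · simp [PowerSeries.coeff_one, show j ≠ 0 by omega]
  · simp

/-! ### Summation of Adomian polynomials -/

/-- The Cauchy product: evaluation at 1 is multiplicative on absolutely summable series. Complex
coefficients are allowed because characteristic functions are treated in the same way. -/
theorem summable_norm_coeff_mul {𝕜 : Type*} [RCLike 𝕜] {F G : PowerSeries 𝕜}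
    (hF : Summable fun i => ‖PowerSeries.coeff i F‖)
    (hG : Summable fun i => ‖PowerSeries.coeff i G‖) :
    (Summable fun i => ‖PowerSeries.coeff i (F * G)‖) ∧
      ∑' i, PowerSeries.coeff i (F * G) =
        (∑' i, PowerSeries.coeff i F) * ∑' i, PowerSeries.coeff i G := by
  set f : ℕ → 𝕜 := fun i => PowerSeries.coeff i F with hf
  set g : ℕ → 𝕜 := fun i => PowerSeries.coeff i G with hg
  have h : ∀ i, PowerSeries.coeff i (F * G) =
      ∑ p ∈ Finset.HasAntidiagonal.antidiagonal i, f p.1 * g p.2 := fun i =>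
    PowerSeries.coeff_mul i F G
  simp only [h]
  exact ⟨summable_norm_sum_mul_antidiagonal_of_summable_norm (f := f) (g := g) hF hG,
    (tsum_mul_tsum_eq_tsum_sum_antidiagonal_of_summable_norm (f := f) (g := g) hF hG).symm⟩

theorem summable_norm_coeff_pow {𝕜 : Type*} [RCLike 𝕜] {F : PowerSeries 𝕜}
    (hF : Summable fun i => ‖PowerSeries.coeff i F‖) (k : ℕ) :
    (Summable fun i => ‖PowerSeries.coeff i (F ^ k)‖) ∧
      ∑' i, PowerSeries.coeff i (F ^ k) = (∑' i, PowerSeries.coeff i F) ^ k := by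
  induction k with
  | zero =>
    simp only [pow_zero, PowerSeries.coeff_one]
    refine ⟨summable_of_ne_finset_zero (s := {0}) fun i hi => ?_, ?_⟩
    · simp only [Finset.mem_singleton] at hi
      simp [hi]
    · rw [tsum_eq_single 0 fun i hi => by simp [hi]]
      simp
  | succ k ih =>
    have h := summable_norm_coeff_mul ih.1 hF
    rw [pow_succ, pow_succ, ← ih.2]
    exact h

theorem abs_coeff_pow_le {F G : PowerSeries ℝ}
    (h : ∀ i, |PowerSeries.coeff i F| ≤ PowerSeries.coeff i G) (k : ℕ) :
    ∀ i, |PowerSeries.coeff i (F ^ k)| ≤ PowerSeries.coeff i (G ^ k) := by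
  induction k with
  | zero => intro i; simp only [pow_zero, PowerSeries.coeff_one]; split_ifs <;> simp
  | succ k ih =>
    intro i
    rw [pow_succ, pow_succ, PowerSeries.coeff_mul, PowerSeries.coeff_mul]
    refine (Finset.abs_sum_le_sum_abs _ _).trans (Finset.sum_le_sum fun p _ => ?_)
    rw [abs_mul]
    exact mul_le_mul (ih _) (h _) (abs_nonneg _) ((abs_nonneg _).trans (ih _))

theorem coeff_pow_eq_zero_of_lt {F : PowerSeries ℝ} (hF : PowerSeries.constantCoeff F = 0)
    {j k : ℕ} (h : j < k) : PowerSeries.coeff j (F ^ k) = 0 := by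
  have h1 : (PowerSeries.X : PowerSeries ℝ) ^ k ∣ F ^ k :=
    pow_dvd_pow_of_dvd (PowerSeries.X_dvd_iff.mpr hF) k
  exact PowerSeries.X_pow_dvd_iff.mp h1 j h

/-- If the Taylor series of `g` at `v_0` converges absolutely to `g` on a disc of radius
`∑_{j ≥ 1} |v_j|`, then the Adomian polynomials sum up to `g (∑ v_j)`. -/
theorem hasSum_adomian {g : ℝ → ℝ} {v : ℕ → ℝ} (hv : Summable fun j => |v j|)
    (habs : Summable fun k => |iteratedDeriv k g (v 0) / (k ! : ℝ)| * (∑' j, |v (j + 1)|) ^ k)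
    (hg : HasSum (fun k => iteratedDeriv k g (v 0) / (k ! : ℝ) * (∑' j, v (j + 1)) ^ k)
      (g (∑' j, v j))) :
    (Summable fun j => |adomian g v j|) ∧ HasSum (adomian g v) (g (∑' j, v j)) := by
  obtain ⟨F, hFdef⟩ : ∃ F, F = tailSeries v := ⟨_, rfl⟩
  obtain ⟨G, hGdef⟩ : ∃ G, G = tailSeries fun j => |v j| := ⟨_, rfl⟩
  have hF0 : PowerSeries.constantCoeff F = 0 := by
    rw [hFdef, constantCoeff_tailSeries]
  have hFG : ∀ i, |PowerSeries.coeff i F| ≤ PowerSeries.coeff i G := by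
    rintro (_ | i)
    · rw [hFdef, hGdef, coeff_tailSeries_zero, coeff_tailSeries_zero, abs_zero]
    · rw [hFdef, hGdef, coeff_tailSeries_succ, coeff_tailSeries_succ]
  have hv1 : Summable fun j => |v (j + 1)| := (summable_nat_add_iff 1).mpr hv
  have hGs : Summable fun i => ‖PowerSeries.coeff i G‖ := by
    refine (summable_nat_add_iff 1).mp ?_
    simpa only [hGdef, coeff_tailSeries_succ, Real.norm_eq_abs, abs_abs] using hv1
  have hGabs : ∀ i, ‖PowerSeries.coeff i G‖ = PowerSeries.coeff i G := fun i =>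
    Real.norm_of_nonneg ((abs_nonneg _).trans (hFG i))
  have hFs : Summable fun i => ‖PowerSeries.coeff i F‖ :=
    Summable.of_nonneg_of_le (fun _ => norm_nonneg _)
      (fun i => (hFG i).trans_eq (hGabs i).symm) hGs
  have hFsum : ∑' i, PowerSeries.coeff i F = ∑' j, v (j + 1) := by
    rw [hFs.of_norm.tsum_eq_zero_add, hFdef, coeff_tailSeries_zero, zero_add]
    simp only [coeff_tailSeries_succ]
  have hGsum : ∑' i, PowerSeries.coeff i G = ∑' j, |v (j + 1)| := by
    rw [hGs.of_norm.tsum_eq_zero_add, hGdef, coeff_tailSeries_zero, zero_add]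
    simp only [coeff_tailSeries_succ]
  -- A double series: summing over j first gives the Taylor series of g, summing over k first gives
  -- the Adomian polynomials. The series with |v_j| in place of v_j provides the absolute
  -- summability that permits the exchange.
  obtain ⟨T, hT⟩ : ∃ T : ℕ × ℕ → ℝ, ∀ k j, T (k, j) =
      iteratedDeriv k g (v 0) / (k ! : ℝ) * PowerSeries.coeff j (F ^ k) :=
    ⟨fun p => iteratedDeriv p.1 g (v 0) / (p.1 ! : ℝ) * PowerSeries.coeff p.2 (F ^ p.1),
      fun _ _ => rfl⟩
  have hrow : ∀ k, Summable fun j => |T (k, j)| := fun k => by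
    simp only [hT, abs_mul]
    exact ((summable_norm_coeff_pow hFs k).1).mul_left _
  have hTs : Summable fun p => |T p| := by
    rw [summable_prod_of_nonneg fun _ => abs_nonneg _]
    refine ⟨hrow, Summable.of_nonneg_of_le (fun k => tsum_nonneg fun _ => abs_nonneg _)
      (fun k => ?_) habs⟩
    have h1 := summable_norm_coeff_pow hGs k
    rw [← hGsum, ← h1.2, ← tsum_mul_left]
    refine Summable.tsum_le_tsum (fun j => ?_) (hrow k) (h1.1.of_norm.mul_left _)
    simp only [hT, abs_mul]
    exact mul_le_mul_of_nonneg_left (abs_coeff_pow_le hFG k j) (abs_nonneg _)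
  have hcol : ∀ j, HasSum (fun k => T (k, j)) (adomian g v j) := fun j => by
    rw [adomian_eq_sum_coeff_pow, ← hFdef]
    simp only [hT]
    refine hasSum_sum_of_ne_finset_zero (L := .unconditional ℕ) fun k hk => ?_
    rw [coeff_pow_eq_zero_of_lt hF0 (by simpa using hk), mul_zero]
  have hswap : Summable fun p : ℕ × ℕ => |T p.swap| :=
    (Equiv.prodComm ℕ ℕ).summable_iff.mpr hTs
  constructor
  · refine Summable.of_nonneg_of_le (fun _ => abs_nonneg _) (fun j => ?_) hswap.prod
    have h : Summable fun k => ‖T (k, j)‖ := hswap.prod_factor j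
    rw [← (hcol j).tsum_eq]
    exact norm_tsum_le_tsum_norm h
  · have h1 : HasSum T (g (∑' j, v j)) := by
      have h2 : HasSum (fun k => ∑' j, T (k, j)) (g (∑' j, v j)) := by
        convert hg using 2 with k
        simp only [hT]
        rw [tsum_mul_left, (summable_norm_coeff_pow hFs k).2, hFsum]
      have h3 : HasSum T (∑' p, T p) := hTs.of_abs.hasSum
      have h4 := h3.prod_fiberwise fun k => (hrow k).of_abs.hasSum
      rwa [h4.unique h2] at h3
    have h5 : HasSum (fun p : ℕ × ℕ => T p.swap) (g (∑' j, v j)) :=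
      (Equiv.prodComm ℕ ℕ).hasSum_iff.mpr h1
    exact h5.prod_fiberwise fun j => hcol j

/-! ### Taylor series of functions with dominated derivatives -/

/-- The Lagrange remainder in a form valid for either sign of h, and also for h = 0 and n = 0. -/
theorem exists_taylor_remainder {f : ℝ → ℝ} (hf : ContDiff ℝ ∞ f) (x h : ℝ) (n : ℕ) :
    ∃ ξ ∈ uIcc x (x + h), f (x + h) - ∑ k ∈ Finset.range n,
      iteratedDeriv k f x / (k ! : ℝ) * h ^ k = iteratedDeriv n f ξ / (n ! : ℝ) * h ^ n := by
  rcases n with _ | n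
  · exact ⟨x + h, right_mem_uIcc, by simp⟩
  rcases eq_or_ne h 0 with rfl | hh
  · refine ⟨x, left_mem_uIcc, ?_⟩
    rw [Finset.sum_range_succ']
    simp
  have hx : x ≠ x + h := by simpa using hh
  have hu : UniqueDiffOn ℝ (uIcc x (x + h)) := uniqueDiffOn_uIcc hx
  obtain ⟨ξ, hξ, he⟩ := taylor_mean_remainder_lagrange_iteratedDeriv (f := f) (n := n) hx
    (hf.of_le (mod_cast le_top)).contDiffOn
  refine ⟨ξ, uIoo_subset_uIcc_self hξ, ?_⟩
  rw [taylor_within_apply] at he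
  rw [add_sub_cancel_left] at he
  have hsum : ∑ k ∈ Finset.range (n + 1), ((k ! : ℝ)⁻¹ * h ^ k) •
      iteratedDerivWithin k f (uIcc x (x + h)) x =
      ∑ k ∈ Finset.range (n + 1), iteratedDeriv k f x / (k ! : ℝ) * h ^ k := by
    refine Finset.sum_congr rfl fun k _ => ?_
    rw [iteratedDerivWithin_eq_iteratedDeriv hu (hf.contDiffAt.of_le (mod_cast le_top))
      left_mem_uIcc, smul_eq_mul]
    ring
  rw [← hsum, he]
  ring

/-- The Taylor coefficients of an absolutely monotone function on `[0, ∞)` are summable with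
every weight. -/
theorem summable_iteratedDeriv_mul_pow {G : ℝ → ℝ} (hG : ContDiff ℝ ∞ G)
    (hpos : ∀ (k : ℕ) (u : ℝ), 0 ≤ u → 0 ≤ iteratedDeriv k G u) {M H : ℝ} (hM : 0 ≤ M)
    (hH : 0 ≤ H) : Summable fun k => iteratedDeriv k G M / (k ! : ℝ) * H ^ k := by
  -- All terms and the Lagrange remainder are nonnegative, so every partial sum is at most G(M + H).
  refine summable_of_sum_range_le (c := G (M + H)) (fun k => ?_) fun n => ?_
  · have := hpos k M hM
    positivity
  · obtain ⟨ξ, hξ, he⟩ := exists_taylor_remainder hG M H n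
    have h0 : 0 ≤ ξ := by
      rw [uIcc_of_le (by linarith)] at hξ
      exact hM.trans hξ.1
    have := hpos n ξ h0
    have : 0 ≤ iteratedDeriv n G ξ / (n ! : ℝ) * H ^ n := by positivity
    linarith

/-- A function whose derivatives are dominated by those of an absolutely monotone function is
the sum of its Taylor series. -/
theorem hasSum_taylor {f G : ℝ → ℝ} (hf : ContDiff ℝ ∞ f) (hG : ContDiff ℝ ∞ G)
    (hpos : ∀ (k : ℕ) (u : ℝ), 0 ≤ u → 0 ≤ iteratedDeriv k G u) {x h M : ℝ} (hM : 0 ≤ M)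
    (hdom : ∀ k, ∀ u ∈ uIcc x (x + h), |iteratedDeriv k f u| ≤ iteratedDeriv k G M) :
    HasSum (fun k => iteratedDeriv k f x / (k ! : ℝ) * h ^ k) (f (x + h)) := by
  have hs := summable_iteratedDeriv_mul_pow hG hpos hM (abs_nonneg h)
  have hs' : Summable fun k => iteratedDeriv k f x / (k ! : ℝ) * h ^ k := by
    refine Summable.of_norm_bounded hs fun k => ?_
    rw [Real.norm_eq_abs, abs_mul, abs_div, abs_pow, Nat.abs_cast]
    gcongr
    exact hdom k x left_mem_uIcc
  refine (hs'.hasSum_iff_tendsto_nat).mpr ?_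
  rw [tendsto_iff_norm_sub_tendsto_zero]
  -- The remainder is at most the n-th term of the convergent Taylor series of G at M, hence tends
  -- to 0.
  refine squeeze_zero (fun _ => norm_nonneg _) (fun n => ?_) hs.tendsto_atTop_zero
  obtain ⟨ξ, hξ, he⟩ := exists_taylor_remainder hf x h n
  rw [norm_sub_rev, he, Real.norm_eq_abs, abs_mul, abs_div, abs_pow, Nat.abs_cast]
  gcongr
  exact hdom n ξ hξ

/-- The derivatives of an absolutely monotone function are monotone. -/
theorem iteratedDeriv_mono_of_nonneg {G : ℝ → ℝ} (hG : ContDiff ℝ ∞ G)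
    (hpos : ∀ (k : ℕ) (u : ℝ), 0 ≤ u → 0 ≤ iteratedDeriv k G u) (k : ℕ) {x y : ℝ} (hx : 0 ≤ x)
    (hxy : x ≤ y) : iteratedDeriv k G x ≤ iteratedDeriv k G y := by
  have hm : MonotoneOn (iteratedDeriv k G) (Ici 0) := by
    have hd : Differentiable ℝ (iteratedDeriv k G) :=
      hG.differentiable_iteratedDeriv k (mod_cast WithTop.coe_lt_top _)
    refine monotoneOn_of_deriv_nonneg (convex_Ici 0) hd.continuous.continuousOn
      hd.differentiableOn fun u hu => ?_
    rw [← iteratedDeriv_succ]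
    rw [interior_Ici] at hu
    exact hpos _ _ (le_of_lt hu)
  exact hm hx (hx.trans hxy) hxy

/-- An everywhere convergent power series is smooth. -/
theorem contDiff_of_hasSum_pow {N : ℝ → ℝ} {a : ℕ → ℝ}
    (hN : ∀ u : ℝ, HasSum (fun i : ℕ => a i * u ^ i) (N u)) : ContDiff ℝ ∞ N := by
  have hr : (FormalMultilinearSeries.ofScalars ℝ a).radius = ⊤ := by
    refine ENNReal.eq_top_of_forall_nnreal_le fun r => ?_
    refine FormalMultilinearSeries.le_radius_of_tendsto _ (l := 0) ?_
    have h := (hN r).summable.tendsto_atTop_zero.norm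
    simp only [norm_zero, norm_mul, norm_pow] at h
    simpa [FormalMultilinearSeries.ofScalars_norm] using h
  have hb := (FormalMultilinearSeries.ofScalars ℝ a).hasFPowerSeriesOnBall (by simp [hr])
  have he : (FormalMultilinearSeries.ofScalars ℝ a).sum = N := by
    funext u
    simp only [FormalMultilinearSeries.sum, FormalMultilinearSeries.ofScalars_apply_eq,
      smul_eq_mul]
    exact (hN u).tsum_eq
  rw [he, hr] at hb
  have h2 : AnalyticOnNhd ℝ N univ := by
    have := hb.analyticOnNhd
    simpa using this
  exact contDiffOn_univ.mp (h2.contDiffOn uniqueDiffOn_univ)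

/-! ### The equation of the majorant generating function and its radius of convergence -/

/-- The convolution in the recurrence is a coefficient of a square: the end terms of the Cauchy
product vanish because the constant term is zero. -/
theorem coeff_tailSeries_sq (w : ℕ → ℝ) (j : ℕ) :
    PowerSeries.coeff (j + 1) (tailSeries w ^ 2) =
      ∑ p ∈ Finset.Icc 1 j, w (j + 1 - p) * w p := by
  rw [sq, PowerSeries.coeff_mul, Finset.Nat.sum_antidiagonal_eq_sum_range_succ_mk,
    Finset.sum_range_succ, Finset.sum_range_succ']
  simp only [Nat.sub_self, coeff_tailSeries_zero, mul_zero, zero_mul, add_zero]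
  have hI : Finset.Icc 1 j = Finset.Ico (0 + 1) (j + 1) := by
    ext k
    simp only [Finset.mem_Icc, Finset.mem_Ico]
    omega
  rw [hI, ← Finset.sum_Ico_add', ← Finset.range_eq_Ico]
  refine Finset.sum_congr rfl fun p hp => ?_
  have hp' := Finset.mem_range.mp hp
  obtain ⟨i, hi⟩ : ∃ i, j + 1 - (p + 1) = i + 1 := ⟨j - p - 1, by omega⟩
  rw [hi, coeff_tailSeries_succ, coeff_tailSeries_succ, mul_comm]

theorem hasSum_coeff_tailSeries_sq {w : ℕ → ℝ} (hw : ∀ j, 0 ≤ w j) (hws : Summable w) :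
    HasSum (fun j => PowerSeries.coeff (j + 1) (tailSeries w ^ 2)) ((∑' j, w (j + 1)) ^ 2) := by
  have hFs : Summable fun i => ‖PowerSeries.coeff i (tailSeries w)‖ := by
    refine (summable_nat_add_iff 1).mp ?_
    simpa only [coeff_tailSeries_succ, Real.norm_eq_abs, abs_of_nonneg (hw _)] using
      (summable_nat_add_iff 1).mpr hws
  have hFsum : ∑' i, PowerSeries.coeff i (tailSeries w) = ∑' j, w (j + 1) := by
    rw [hFs.of_norm.tsum_eq_zero_add, coeff_tailSeries_zero, zero_add]
    simp only [coeff_tailSeries_succ]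
  have hF2 := summable_norm_coeff_pow hFs 2
  rw [← hFsum, ← hF2.2, hF2.1.of_norm.tsum_eq_zero_add]
  have : PowerSeries.coeff 0 (tailSeries w ^ 2) = 0 :=
    coeff_pow_eq_zero_of_lt (constantCoeff_tailSeries w) (by norm_num)
  rw [this, zero_add]
  exact ((summable_nat_add_iff 1).mpr hF2.1.of_norm).hasSum

section Majorant

variable {Q : ℝ} {G : ℝ → ℝ}

/-- The nonlinear term of the equation of the generating function, as a function of `f - v_0`. -/
noncomputable def majorantRhs (Q : ℝ) (G : ℝ → ℝ) (S : ℝ) : ℝ :=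
  (1 + 8 / 3) * (Q * (8 / 3 + S) + G (8 / 3 + S) + deriv G (8 / 3) * (8 / 3) - G (8 / 3))

theorem majorantSeq_nonneg (hQ : 0 ≤ Q) (hpos : ∀ (k : ℕ) (u : ℝ), 0 ≤ u → 0 ≤ iteratedDeriv k G u)
    (j : ℕ) : 0 ≤ majorantSeq Q G j := by
  induction j using Nat.strong_induction_on with
  | _ j ih =>
    match j with
    | 0 => rw [majorantSeq_zero]; norm_num
    | 1 =>
      have h := hpos 1 (8 / 3) (by norm_num)
      rw [iteratedDeriv_one] at h
      rw [majorantSeq_one, majorantSeq_zero]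
      positivity
    | j + 2 =>
      have h0 := ih 0 (by omega)
      rw [majorantSeq_succ Q G (by omega)]
      refine add_nonneg (Finset.sum_nonneg fun p hp => ?_) (mul_nonneg (by linarith)
        (add_nonneg (mul_nonneg hQ (ih _ (by omega))) (adomian_nonneg (fun k => ?_) ?_)))
      · have := Finset.mem_Icc.mp hp
        exact mul_nonneg (ih _ (by omega)) (ih _ (by omega))
      · rw [majorantSeq_zero]
        exact hpos k _ (by norm_num)
      · intro k _ hk
        exact ih k (by omega)

/-- One recurrence for all j. The exceptional first step has G'(v̄_0) v̄_0 where the general formula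
would give A_0 = G(v̄_0), and the conditional term corrects this. -/
theorem majorantSeq_succ_scaled (Q : ℝ) (G : ℝ → ℝ) (z : ℝ) (j : ℕ) :
    z ^ (j + 1) * majorantSeq Q G (j + 1) =
      ∑ p ∈ Finset.Icc 1 j, (z ^ (j + 1 - p) * majorantSeq Q G (j + 1 - p)) *
        (z ^ p * majorantSeq Q G p) +
      (1 + 8 / 3) * z * (Q * (z ^ j * majorantSeq Q G j) +
        adomian G (fun i => z ^ i * majorantSeq Q G i) j +
        if j = 0 then deriv G (8 / 3) * (8 / 3) - G (8 / 3) else 0) := by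
  rcases Nat.eq_zero_or_pos j with rfl | hj
  · simp only [zero_add, adomian_zero, if_true, majorantSeq_one, majorantSeq_zero]
    simp
    ring
  · have hp : ∀ p ∈ Finset.Icc 1 j, (z ^ (j + 1 - p) * majorantSeq Q G (j + 1 - p)) *
        (z ^ p * majorantSeq Q G p) =
        z ^ (j + 1) * (majorantSeq Q G (j + 1 - p) * majorantSeq Q G p) := by
      intro p hp
      have := Finset.mem_Icc.mp hp
      have e : z ^ (j + 1) = z ^ (j + 1 - p) * z ^ p := by
        rw [← pow_add]
        congr 1
        omega
      rw [e]
      ring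
    rw [Finset.sum_congr rfl hp, ← Finset.mul_sum, majorantSeq_succ Q G hj, majorantSeq_zero,
      adomian_scale, if_neg (by omega), pow_succ]
    ring

theorem hasSum_taylor_majorant (hG : ContDiff ℝ ∞ G)
    (hpos : ∀ (k : ℕ) (u : ℝ), 0 ≤ u → 0 ≤ iteratedDeriv k G u) {x h : ℝ} (hx : 0 ≤ x)
    (hh : 0 ≤ h) : HasSum (fun k => iteratedDeriv k G x / (k ! : ℝ) * h ^ k) (G (x + h)) := by
  refine hasSum_taylor hG hG hpos (M := x + h) (by linarith) fun k u hu => ?_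
  rw [uIcc_of_le (by linarith)] at hu
  rw [abs_of_nonneg (hpos k u (hx.trans hu.1))]
  exact iteratedDeriv_mono_of_nonneg hG hpos k (hx.trans hu.1) hu.2

/-- Adomian polynomials of an absolutely monotone function along a nonnegative sequence. -/
theorem hasSum_adomian_of_nonneg (hG : ContDiff ℝ ∞ G)
    (hpos : ∀ (k : ℕ) (u : ℝ), 0 ≤ u → 0 ≤ iteratedDeriv k G u) {w : ℕ → ℝ} (hw : ∀ j, 0 ≤ w j)
    (hs : Summable w) : HasSum (adomian G w) (G (∑' j, w j)) := by
  have habs : ∀ j, |w j| = w j := fun j => abs_of_nonneg (hw j)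
  have h0 : 0 ≤ ∑' j, w (j + 1) := tsum_nonneg fun _ => hw _
  have hc : ∀ k, |iteratedDeriv k G (w 0) / (k ! : ℝ)| = iteratedDeriv k G (w 0) / (k ! : ℝ) :=
    fun k => abs_of_nonneg (div_nonneg (hpos k _ (hw 0)) (by positivity))
  refine (hasSum_adomian (by simpa only [habs] using hs) ?_ ?_).2
  · simp only [habs, hc]
    exact summable_iteratedDeriv_mul_pow hG hpos (hw 0) h0
  · rw [hs.tsum_eq_zero_add]
    exact hasSum_taylor_majorant hG hpos (hw 0) h0

/-- Summation of the recurrence over j: the convolutions give the square, the Adomian polynomials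
give G at the full sum. -/
theorem majorant_equation (hQ : 0 ≤ Q) (hG : ContDiff ℝ ∞ G)
    (hpos : ∀ (k : ℕ) (u : ℝ), 0 ≤ u → 0 ≤ iteratedDeriv k G u) {z : ℝ} (hz : 0 ≤ z)
    (hs : Summable fun j => z ^ j * majorantSeq Q G j) :
    ∑' j, z ^ (j + 1) * majorantSeq Q G (j + 1) =
      (∑' j, z ^ (j + 1) * majorantSeq Q G (j + 1)) ^ 2 +
      z * majorantRhs Q G (∑' j, z ^ (j + 1) * majorantSeq Q G (j + 1)) := by
  obtain ⟨w, hwdef⟩ : ∃ w : ℕ → ℝ, w = fun j => z ^ j * majorantSeq Q G j := ⟨_, rfl⟩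
  have hw : ∀ j, 0 ≤ w j := fun j => by
    rw [hwdef]
    exact mul_nonneg (pow_nonneg hz j) (majorantSeq_nonneg hQ hpos j)
  have hw0 : w 0 = 8 / 3 := by simp [hwdef, majorantSeq_zero]
  have hws : Summable w := by rw [hwdef]; exact hs
  have hrec : ∀ j, w (j + 1) = PowerSeries.coeff (j + 1) (tailSeries w ^ 2) +
      (1 + 8 / 3) * z * (Q * w j + adomian G w j +
        if j = 0 then deriv G (8 / 3) * (8 / 3) - G (8 / 3) else 0) := fun j => by
    rw [coeff_tailSeries_sq, hwdef]
    exact majorantSeq_succ_scaled Q G z j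
  have hS : ∀ j, z ^ (j + 1) * majorantSeq Q G (j + 1) = w (j + 1) := fun j => by rw [hwdef]
  simp only [hS]
  have hsum : ∑' j, w j = 8 / 3 + ∑' j, w (j + 1) := by rw [hws.tsum_eq_zero_add, hw0]
  have hA := hasSum_adomian_of_nonneg hG hpos hw hws
  have hsq := hasSum_coeff_tailSeries_sq hw hws
  have hd : HasSum (fun j : ℕ => if j = 0 then deriv G (8 / 3) * (8 / 3) - G (8 / 3) else 0)
      (deriv G (8 / 3) * (8 / 3) - G (8 / 3)) := hasSum_ite_eq 0 _
  have htot := hsq.add ((((hws.hasSum.mul_left Q).add hA).add hd).mul_left ((1 + 8 / 3) * z))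
  have heq : ∑' j, w (j + 1) = _ := (tsum_congr hrec).trans htot.tsum_eq
  rw [hsum] at heq
  unfold majorantRhs
  linarith

theorem majorantRhs_nonneg (hQ : 0 ≤ Q) (hG : ContDiff ℝ ∞ G)
    (hpos : ∀ (k : ℕ) (u : ℝ), 0 ≤ u → 0 ≤ iteratedDeriv k G u) {S : ℝ} (hS : 0 ≤ S) :
    0 ≤ majorantRhs Q G S := by
  have h1 := iteratedDeriv_mono_of_nonneg hG hpos 0 (x := 8 / 3) (y := 8 / 3 + S) (by norm_num)
    (by linarith)
  have h2 := hpos 1 (8 / 3) (by norm_num)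
  rw [iteratedDeriv_one] at h2
  simp only [iteratedDeriv_zero] at h1
  have : 0 ≤ Q * (8 / 3 + S) := by positivity
  unfold majorantRhs
  refine mul_nonneg (by norm_num) ?_
  linarith [mul_nonneg h2 (by norm_num : (0 : ℝ) ≤ 8 / 3)]

theorem majorantRhs_mono (hQ : 0 ≤ Q) (hG : ContDiff ℝ ∞ G)
    (hpos : ∀ (k : ℕ) (u : ℝ), 0 ≤ u → 0 ≤ iteratedDeriv k G u) {S T : ℝ} (hS : 0 ≤ S)
    (hST : S ≤ T) : majorantRhs Q G S ≤ majorantRhs Q G T := by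
  have h1 := iteratedDeriv_mono_of_nonneg hG hpos 0 (x := 8 / 3 + S) (y := 8 / 3 + T) (by linarith)
    (by linarith)
  simp only [iteratedDeriv_zero] at h1
  have : Q * (8 / 3 + S) ≤ Q * (8 / 3 + T) := by gcongr
  unfold majorantRhs
  refine mul_le_mul_of_nonneg_left ?_ (by norm_num)
  linarith

/-- The sequence cut off after index n satisfies the same relations for the first n + 1 steps. Its
complete sums are at least the partial ones, all terms being nonnegative, so the equation becomes an
inequality that bootstraps a bound before convergence is known. -/
theorem majorant_partial_sum_le (hQ : 0 ≤ Q) (hG : ContDiff ℝ ∞ G)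
    (hpos : ∀ (k : ℕ) (u : ℝ), 0 ≤ u → 0 ≤ iteratedDeriv k G u) {z : ℝ} (hz : 0 ≤ z) (n : ℕ) :
    ∑ j ∈ Finset.range (n + 1), z ^ (j + 1) * majorantSeq Q G (j + 1) ≤
      (∑ j ∈ Finset.range n, z ^ (j + 1) * majorantSeq Q G (j + 1)) ^ 2 +
      z * majorantRhs Q G (∑ j ∈ Finset.range n, z ^ (j + 1) * majorantSeq Q G (j + 1)) := by
  obtain ⟨t, ht⟩ : ∃ t : ℕ → ℝ, t = fun j => if j ≤ n then z ^ j * majorantSeq Q G j else 0 :=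
    ⟨_, rfl⟩
  have ht1 : ∀ j ≤ n, z ^ j * majorantSeq Q G j = t j := fun j hj => by simp [ht, hj]
  have ht2 : ∀ j, n < j → t j = 0 := fun j hj => by simp [ht, hj]
  have hw : ∀ j, 0 ≤ t j := fun j => by
    rcases le_or_gt j n with h | h
    · rw [← ht1 j h]
      exact mul_nonneg (pow_nonneg hz j) (majorantSeq_nonneg hQ hpos j)
    · rw [ht2 j h]
  have ht0 : t 0 = 8 / 3 := by rw [← ht1 0 (Nat.zero_le n)]; simp [majorantSeq_zero]
  have hts : Summable t := summable_of_ne_finset_zero (s := Finset.range (n + 1)) fun j hj =>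
    ht2 j (by simpa using hj)
  have hS : ∑' j, t (j + 1) = ∑ j ∈ Finset.range n, z ^ (j + 1) * majorantSeq Q G (j + 1) := by
    rw [tsum_eq_sum (s := Finset.range n) fun j hj => ht2 _ (by
      have : n ≤ j := by simpa using hj
      omega)]
    refine Finset.sum_congr rfl fun j hj => (ht1 _ ?_).symm
    have := Finset.mem_range.mp hj
    omega
  have hsum : ∑' j, t j = 8 / 3 + ∑' j, t (j + 1) := by rw [hts.tsum_eq_zero_add, ht0]
  have hrec : ∀ j ∈ Finset.range (n + 1), z ^ (j + 1) * majorantSeq Q G (j + 1) =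
      PowerSeries.coeff (j + 1) (tailSeries t ^ 2) +
      (1 + 8 / 3) * z * (Q * t j + adomian G t j +
        if j = 0 then deriv G (8 / 3) * (8 / 3) - G (8 / 3) else 0) := fun j hj => by
    have hjn : j ≤ n := Nat.lt_succ_iff.mp (Finset.mem_range.mp hj)
    rw [coeff_tailSeries_sq, majorantSeq_succ_scaled, ht1 j hjn,
      adomian_congr G (w := t) fun k hk => ht1 k (hk.trans hjn)]
    congr 1
    refine Finset.sum_congr rfl fun p hp => ?_
    have := Finset.mem_Icc.mp hp
    rw [ht1 _ (by omega), ht1 _ (by omega)]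
  have hc : ∀ j, 0 ≤ PowerSeries.coeff (j + 1) (tailSeries t ^ 2) := fun j => by
    rw [coeff_tailSeries_sq]
    exact Finset.sum_nonneg fun p _ => mul_nonneg (hw _) (hw _)
  have hA : ∀ j, 0 ≤ adomian G t j := fun j =>
    adomian_nonneg (fun k => hpos k _ (hw 0)) fun k _ _ => hw k
  have h1 := sum_le_hasSum (Finset.range (n + 1)) (fun j _ => hc j)
    (hasSum_coeff_tailSeries_sq hw hts)
  have h2 := sum_le_hasSum (Finset.range (n + 1)) (fun j _ => hA j)
    (hasSum_adomian_of_nonneg hG hpos hw hts)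
  have h3 := sum_le_hasSum (Finset.range (n + 1)) (fun j _ => hw j) hts.hasSum
  have h4 : ∑ j ∈ Finset.range (n + 1),
      (if j = 0 then deriv G (8 / 3) * (8 / 3) - G (8 / 3) else 0) =
      deriv G (8 / 3) * (8 / 3) - G (8 / 3) := by simp
  rw [Finset.sum_congr rfl hrec, Finset.sum_add_distrib, ← Finset.mul_sum,
    Finset.sum_add_distrib, Finset.sum_add_distrib, ← Finset.mul_sum, h4, ← hS]
  rw [hsum] at h2 h3
  have h5 := mul_le_mul_of_nonneg_left h3 hQ
  have h6 := mul_le_mul_of_nonneg_left (add_le_add h5 h2)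
    (mul_nonneg (by norm_num : (0 : ℝ) ≤ 1 + 8 / 3) hz)
  unfold majorantRhs
  linarith

theorem majorantRadius_pos (hQ : 0 ≤ Q) (hG : ContDiff ℝ ∞ G)
    (hpos : ∀ (k : ℕ) (u : ℝ), 0 ≤ u → 0 ≤ iteratedDeriv k G u) : 0 < majorantRadius Q G := by
  have hH := majorantRhs_nonneg hQ hG hpos (S := 1 / 2) (by norm_num)
  -- With this z the map S ↦ S² + z H(S) sends [0, 1/2] into itself, since (1/2)² + 1/4 = 1/2.
  obtain ⟨z, hzdef⟩ : ∃ z : ℝ, z = 1 / (4 * (majorantRhs Q G (1 / 2) + 1)) := ⟨_, rfl⟩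
  have hz : 0 < z := by rw [hzdef]; positivity
  have hzH : z * majorantRhs Q G (1 / 2) ≤ 1 / 4 := by
    rw [hzdef, div_mul_eq_mul_div, div_le_iff₀ (by positivity)]
    linarith
  have hnn : ∀ j, 0 ≤ z ^ j * majorantSeq Q G j := fun j =>
    mul_nonneg (pow_nonneg hz.le j) (majorantSeq_nonneg hQ hpos j)
  have hS : ∀ n, ∑ j ∈ Finset.range n, z ^ (j + 1) * majorantSeq Q G (j + 1) ≤ 1 / 2 := by
    intro n
    induction n with
    | zero => simp
    | succ n ih =>
      have h0 : 0 ≤ ∑ j ∈ Finset.range n, z ^ (j + 1) * majorantSeq Q G (j + 1) :=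
        Finset.sum_nonneg fun j _ => hnn _
      have h1 := majorant_partial_sum_le hQ hG hpos hz.le n
      have h2 := mul_le_mul_of_nonneg_left (majorantRhs_mono hQ hG hpos h0 ih) hz.le
      nlinarith
  have hle : ∀ j, z ^ j * majorantSeq Q G j ≤ 3 := by
    rintro (_ | j)
    · simp [majorantSeq_zero]; norm_num
    · have h1 := hS (j + 1)
      rw [Finset.sum_range_succ] at h1
      have h0 : 0 ≤ ∑ j ∈ Finset.range j, z ^ (j + 1) * majorantSeq Q G (j + 1) :=
        Finset.sum_nonneg fun j _ => hnn _
      linarith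
  have hr := FormalMultilinearSeries.le_radius_of_bound
    (FormalMultilinearSeries.ofScalars ℝ (majorantSeq Q G)) 3 (r := z.toNNReal) fun n => by
      rw [FormalMultilinearSeries.ofScalars_norm, Real.coe_toNNReal z hz.le,
        Real.norm_of_nonneg (majorantSeq_nonneg hQ hpos n), mul_comm]
      exact hle n
  refine lt_of_lt_of_le ?_ hr
  exact ENNReal.coe_pos.mpr (Real.toNNReal_pos.mpr hz)

theorem summable_majorantSeq {z : ℝ} (hz : 0 ≤ z) (h : ENNReal.ofReal z < majorantRadius Q G) :
    Summable fun j => z ^ j * majorantSeq Q G j := by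
  have := FormalMultilinearSeries.summable_norm_mul_pow _ h
  refine Summable.of_norm ?_
  convert this using 2 with j
  rw [FormalMultilinearSeries.ofScalars_norm, Real.coe_toNNReal z hz, norm_mul, norm_pow,
    Real.norm_of_nonneg hz, mul_comm]

/-- In S = S² + z H(S) the last term is nonnegative, so S ≥ S² and S ≤ 1, however close z is to R.
-/
theorem majorant_tail_le_one (hQ : 0 ≤ Q) (hG : ContDiff ℝ ∞ G)
    (hpos : ∀ (k : ℕ) (u : ℝ), 0 ≤ u → 0 ≤ iteratedDeriv k G u) {z : ℝ} (hz : 0 ≤ z)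
    (h : ENNReal.ofReal z < majorantRadius Q G) (n : ℕ) :
    ∑ j ∈ Finset.range n, z ^ (j + 1) * majorantSeq Q G (j + 1) ≤ 1 := by
  have hs := summable_majorantSeq hz h
  have hnn : ∀ j, 0 ≤ z ^ (j + 1) * majorantSeq Q G (j + 1) := fun j =>
    mul_nonneg (pow_nonneg hz _) (majorantSeq_nonneg hQ hpos _)
  have h0 : 0 ≤ ∑' j, z ^ (j + 1) * majorantSeq Q G (j + 1) := tsum_nonneg hnn
  have he := majorant_equation hQ hG hpos hz hs
  have h1 := mul_nonneg hz (majorantRhs_nonneg hQ hG hpos h0)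
  refine (Summable.sum_le_tsum _ (fun j _ => hnn j) ((summable_nat_add_iff 1).mpr hs)).trans ?_
  by_contra hlt
  nlinarith

/-- The bound 1 on the tail sum then holds for all z ≥ 0, which a positive coefficient would violate
for large z. -/
theorem majorantSeq_eq_zero_of_radius_eq_top (hQ : 0 ≤ Q) (hG : ContDiff ℝ ∞ G)
    (hpos : ∀ (k : ℕ) (u : ℝ), 0 ≤ u → 0 ≤ iteratedDeriv k G u) (h : majorantRadius Q G = ⊤)
    (j : ℕ) : majorantSeq Q G (j + 1) = 0 := by
  by_contra hne
  have hv : 0 < majorantSeq Q G (j + 1) :=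
    lt_of_le_of_ne (majorantSeq_nonneg hQ hpos _) (Ne.symm hne)
  set z : ℝ := max 1 (2 / majorantSeq Q G (j + 1)) with hz
  have hz1 : 1 ≤ z := le_max_left _ _
  have h1 := majorant_tail_le_one hQ hG hpos (z := z) (by linarith) (by
    rw [h]; exact ENNReal.ofReal_lt_top) (j + 1)
  rw [Finset.sum_range_succ] at h1
  have h0 : 0 ≤ ∑ j ∈ Finset.range j, z ^ (j + 1) * majorantSeq Q G (j + 1) :=
    Finset.sum_nonneg fun j _ =>
      mul_nonneg (pow_nonneg (by linarith) _) (majorantSeq_nonneg hQ hpos _)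
  have h2 : z ≤ z ^ (j + 1) := le_self_pow₀ hz1 (by omega)
  have h3 : 2 / majorantSeq Q G (j + 1) ≤ z := le_max_right _ _
  rw [div_le_iff₀ hv] at h3
  nlinarith

theorem majorantSeq_eq_zero_of_one_eq_zero (h : majorantSeq Q G 1 = 0) (j : ℕ) :
    majorantSeq Q G (j + 1) = 0 := by
  induction j using Nat.strong_induction_on with
  | _ j ih =>
    rcases j with _ | j
    · exact h
    · have hv : ∀ k, 1 ≤ k → k ≤ j + 1 → majorantSeq Q G k = 0 := fun k h1 h2 => by
        obtain ⟨i, rfl⟩ : ∃ i, k = i + 1 := ⟨k - 1, by omega⟩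
        exact ih i (by omega)
      rw [majorantSeq_succ Q G (by omega), adomian_eq_zero (by omega) hv, hv (j + 1) (by omega) le_rfl,
        Finset.sum_eq_zero]
      · simp
      · intro p hp
        have := Finset.mem_Icc.mp hp
        rw [hv p this.1 this.2, mul_zero]

/-- At a finite radius of convergence the generating function still converges. -/
theorem summable_majorantSeq_radius (hQ : 0 ≤ Q) (hG : ContDiff ℝ ∞ G)
    (hpos : ∀ (k : ℕ) (u : ℝ), 0 ≤ u → 0 ≤ iteratedDeriv k G u) (h : majorantRadius Q G ≠ ⊤) :
    Summable fun j => (majorantRadius Q G).toReal ^ j * majorantSeq Q G j := by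
  have hρ : 0 < (majorantRadius Q G).toReal :=
    ENNReal.toReal_pos (majorantRadius_pos hQ hG hpos).ne' h
  refine (summable_nat_add_iff 1).mp (summable_of_sum_range_le (c := 1) (fun j =>
    mul_nonneg (pow_nonneg hρ.le _) (majorantSeq_nonneg hQ hpos _)) fun n => ?_)
  have hc : Continuous fun z : ℝ =>
      ∑ j ∈ Finset.range n, z ^ (j + 1) * majorantSeq Q G (j + 1) := by fun_prop
  -- Each finite partial sum is continuous in z, so the bound 1 passes to the limit z ↑ R.
  refine le_of_tendsto ((hc.tendsto _).mono_left nhdsWithin_le_nhds)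
    (Filter.mem_of_superset (Ioo_mem_nhdsLT hρ) fun z hz => ?_)
  refine majorant_tail_le_one hQ hG hpos hz.1.le ?_ n
  rw [ENNReal.ofReal_lt_iff_lt_toReal hz.1.le h]
  exact hz.2

end Majorant

/-! ### Lagrange inversion for formal power series -/

/-- F^k starts at degree k at the earliest, so the composition is a finite sum in each degree. -/
theorem coeff_subst_eq_sum {F : PowerSeries ℝ} (hF : PowerSeries.constantCoeff F = 0)
    (ψ : PowerSeries ℝ) {j n : ℕ} (hj : j < n) :
    PowerSeries.coeff j (ψ.subst F) =
      ∑ k ∈ Finset.range n, PowerSeries.coeff k ψ * PowerSeries.coeff j (F ^ k) := by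
  rw [PowerSeries.coeff_subst' (PowerSeries.HasSubst.of_constantCoeff_zero' hF)]
  rw [finsum_eq_sum_of_support_subset (s := Finset.range n)]
  · rfl
  · intro k hk
    by_contra hkn
    refine hk ?_
    have : j < k := by
      have : ¬ k < n := by simpa using hkn
      omega
    simp only [coeff_pow_eq_zero_of_lt hF this, smul_zero]

/-- For F = XU this coefficient is the residue of F'/F^{k+1}. It is 1 for k = 0; for k ≥ 1 the
quotient is the derivative of a Laurent series and has no residue. The computation avoids Laurent
series by differentiating U^{-(k+1)} in its place. -/
theorem coeff_derivative_mul_inv_pow {U : PowerSeries ℝ}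
    (hU : PowerSeries.constantCoeff U ≠ 0) (k : ℕ) :
    PowerSeries.coeff k
      (PowerSeries.derivative ℝ (PowerSeries.X * U) * (U⁻¹) ^ (k + 1)) = if k = 0 then 1 else 0 := by
  have hUV : U * U⁻¹ = 1 := PowerSeries.mul_inv_cancel U hU
  have hd : PowerSeries.derivative ℝ (PowerSeries.X * U) =
      U + PowerSeries.X * PowerSeries.derivative ℝ U := by
    rw [Derivation.leibniz, PowerSeries.derivative_X]
    simp only [smul_eq_mul, mul_one]
    ring
  rw [hd]
  rcases k with _ | k
  · simp [hU]
  · have h1 : (U + PowerSeries.X * PowerSeries.derivative ℝ U) * (U⁻¹) ^ (k + 1 + 1) =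
        (U⁻¹) ^ (k + 1) + PowerSeries.X * (PowerSeries.derivative ℝ U * (U⁻¹) ^ (k + 2)) := by
      calc _ = (U * U⁻¹) * (U⁻¹) ^ (k + 1) +
            PowerSeries.X * (PowerSeries.derivative ℝ U * (U⁻¹) ^ (k + 2)) := by ring
        _ = _ := by rw [hUV, one_mul]
    have h2 : PowerSeries.derivative ℝ ((U⁻¹) ^ (k + 1)) =
        -(PowerSeries.C ((k : ℝ) + 1) * (PowerSeries.derivative ℝ U * (U⁻¹) ^ (k + 2))) := by
      rw [Derivation.leibniz_pow, PowerSeries.derivative_inv']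
      simp only [smul_eq_mul, nsmul_eq_mul, map_add, map_natCast, map_one]
      simp only [Nat.add_sub_cancel]
      push_cast
      ring
    have h3 := congrArg (PowerSeries.coeff k) h2
    rw [PowerSeries.coeff_derivative, map_neg, PowerSeries.coeff_C_mul] at h3
    have h4 : PowerSeries.coeff (k + 1) ((U⁻¹) ^ (k + 1)) =
        -PowerSeries.coeff k (PowerSeries.derivative ℝ U * (U⁻¹) ^ (k + 2)) := by
      have : ((k : ℝ) + 1) ≠ 0 := by positivity
      apply mul_right_cancel₀ this
      rw [h3]
      ring
    rw [h1, map_add, PowerSeries.coeff_succ_X_mul, h4]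
    simp

/-- **Lagrange inversion**: if `F = X Φ(F)`, then `n [X^n] F = [X^{n-1}] Φ^n`. -/
theorem lagrange_inversion {F Φ : PowerSeries ℝ} (hF : PowerSeries.constantCoeff F = 0)
    (hΦ : PowerSeries.constantCoeff Φ ≠ 0) (h : F = PowerSeries.X * Φ.subst F) (n : ℕ) :
    ((n : ℝ) + 1) * PowerSeries.coeff (n + 1) F = PowerSeries.coeff n (Φ ^ (n + 1)) := by
  have hs : PowerSeries.HasSubst F := PowerSeries.HasSubst.of_constantCoeff_zero' hF
  obtain ⟨U, hUdef⟩ : ∃ U : PowerSeries ℝ, U = Φ.subst F := ⟨_, rfl⟩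
  rw [← hUdef] at h
  have hU : PowerSeries.constantCoeff U ≠ 0 := by
    rw [hUdef, ← PowerSeries.coeff_zero_eq_constantCoeff_apply,
      coeff_subst_eq_sum hF Φ (Nat.zero_lt_one)]
    simpa using hΦ
  have hUn : U ^ (n + 1) = (Φ ^ (n + 1)).subst F := by
    rw [hUdef, PowerSeries.subst_pow hs]
  have hUV : U * U⁻¹ = 1 := PowerSeries.mul_inv_cancel U hU
  set D := PowerSeries.derivative ℝ F with hD
  -- U^{n+1} = Φ^{n+1}(F) is replaced by its polynomial part T in F; the difference is divisible by
  -- X^{n+1} and does not affect the coefficient of X^n.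
  obtain ⟨T, hT⟩ : ∃ T : PowerSeries ℝ, T = ∑ m ∈ Finset.range (n + 1),
      PowerSeries.C (PowerSeries.coeff m (Φ ^ (n + 1))) * F ^ m := ⟨_, rfl⟩
  have hdvd : (PowerSeries.X : PowerSeries ℝ) ^ (n + 1) ∣ U ^ (n + 1) - T := by
    rw [PowerSeries.X_pow_dvd_iff]
    intro i hi
    rw [map_sub, hUn, coeff_subst_eq_sum hF _ hi, hT, map_sum]
    simp only [PowerSeries.coeff_C_mul, sub_self]
  have h1 : D = D * (U⁻¹) ^ (n + 1) * (U ^ (n + 1) - T) + D * (U⁻¹) ^ (n + 1) * T := by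
    have : D * (U⁻¹) ^ (n + 1) * U ^ (n + 1) = D := by
      rw [mul_assoc, ← mul_pow, mul_comm (U⁻¹), hUV, one_pow, mul_one]
    rw [← mul_add, sub_add_cancel, this]
  have h2 : PowerSeries.coeff n D = ((n : ℝ) + 1) * PowerSeries.coeff (n + 1) F := by
    rw [hD, PowerSeries.coeff_derivative, mul_comm]
  rw [← h2, h1, map_add, PowerSeries.X_pow_dvd_iff.mp (hdvd.mul_left _) n (Nat.lt_succ_self n),
    zero_add, hT, Finset.mul_sum, map_sum]
  -- The term with F^m contributes the residue of F'/F^{n+1-m}, which is nonzero only for m = n.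
  have hterm : ∀ m ∈ Finset.range (n + 1), PowerSeries.coeff n (D * (U⁻¹) ^ (n + 1) *
      (PowerSeries.C (PowerSeries.coeff m (Φ ^ (n + 1))) * F ^ m)) =
      if m = n then PowerSeries.coeff n (Φ ^ (n + 1)) else 0 := by
    intro m hm
    obtain ⟨k, rfl⟩ := Nat.exists_eq_add_of_le (Nat.lt_succ_iff.mp (Finset.mem_range.mp hm))
    have e : D * (U⁻¹) ^ (m + k + 1) *
        (PowerSeries.C (PowerSeries.coeff m (Φ ^ (m + k + 1))) * F ^ m) =
        PowerSeries.C (PowerSeries.coeff m (Φ ^ (m + k + 1))) *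
          (PowerSeries.X ^ m * (D * (U⁻¹) ^ (k + 1))) := by
      have : (U⁻¹) ^ (m + k + 1) * F ^ m = PowerSeries.X ^ m * (U⁻¹) ^ (k + 1) := by
        calc _ = (U⁻¹) ^ (m + k + 1) * (PowerSeries.X * U) ^ m := by rw [← h]
          _ = PowerSeries.X ^ m * (U⁻¹) ^ (k + 1) * (U * U⁻¹) ^ m := by ring
          _ = _ := by rw [hUV, one_pow, mul_one]
      linear_combination (D * PowerSeries.C (PowerSeries.coeff m (Φ ^ (m + k + 1)))) * this
    rw [e, PowerSeries.coeff_C_mul, add_comm m k, PowerSeries.coeff_X_pow_mul, hD]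
    conv_lhs => rw [h]
    rw [coeff_derivative_mul_inv_pow hU]
    rcases Nat.eq_zero_or_pos k with rfl | hk
    · simp
    · rw [if_neg (by omega), if_neg (by omega), mul_zero]
  rw [Finset.sum_congr rfl hterm]
  simp

/-! ### Fourier bound for coefficients of powers -/

theorem integral_exp_int_mul_I (N : ℤ) :
    ∫ t in (-Real.pi)..Real.pi, Complex.exp (N * Complex.I * t) =
      if N = 0 then 2 * (Real.pi : ℂ) else 0 := by
  split_ifs with h
  · simp [h]
    ring
  · have hc : (N * Complex.I : ℂ) ≠ 0 := mul_ne_zero (by exact_mod_cast h) Complex.I_ne_zero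
    rw [integral_exp_mul_complex hc]
    have e : Complex.exp (N * Complex.I * (Real.pi : ℝ)) =
        Complex.exp (N * Complex.I * ((-Real.pi : ℝ) : ℂ)) := by
      rw [Complex.exp_eq_exp_iff_exists_int]
      refine ⟨N, ?_⟩
      push_cast
      ring
    rw [e, sub_self, zero_div]

/-- On [-π, π] the modulus equals 2 cos(t/2), and the cosine lies below a parabola there. -/
theorem norm_one_add_exp_le {t : ℝ} (ht : t ∈ Icc (-Real.pi) Real.pi) :
    ‖1 + Complex.exp (t * Complex.I)‖ ≤ 2 - t ^ 2 / Real.pi ^ 2 := by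
  have hc : Real.cos (t / 2) ≤ 1 - 2 / Real.pi ^ 2 * (t / 2) ^ 2 := by
    refine Real.cos_le_one_sub_mul_cos_sq ?_
    rw [abs_le]
    constructor <;> linarith [ht.1, ht.2, Real.pi_pos]
  have hc0 : 0 ≤ Real.cos (t / 2) :=
    Real.cos_nonneg_of_mem_Icc ⟨by linarith [ht.1], by linarith [ht.2]⟩
  have hn : ‖1 + Complex.exp (t * Complex.I)‖ = 2 * Real.cos (t / 2) := by
    rw [← abs_of_nonneg (norm_nonneg _), ← abs_of_nonneg (mul_nonneg zero_le_two hc0),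
      ← sq_eq_sq_iff_abs_eq_abs, Complex.sq_norm, Complex.exp_mul_I, ← Complex.ofReal_cos,
      ← Complex.ofReal_sin, Complex.normSq_apply]
    simp only [Complex.add_re, Complex.one_re, Complex.ofReal_re, Complex.mul_re, Complex.I_re,
      mul_zero, Complex.ofReal_im, Complex.I_im, mul_one, sub_self, add_zero, Complex.add_im,
      Complex.one_im, Complex.mul_im, zero_add]
    have h2 : Real.cos t = 2 * Real.cos (t / 2) ^ 2 - 1 := by
      rw [← Real.cos_two_mul]
      congr 1
      ring
    have h3 := Real.sin_sq_add_cos_sq t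
    nlinarith
  rw [hn]
  have : 2 * (1 - 2 / Real.pi ^ 2 * (t / 2) ^ 2) = 2 - t ^ 2 / Real.pi ^ 2 := by ring
  linarith

/-- The common part min(a, b)(1 + e^{it}) is split off and shows the cancellation; the rest is
estimated by the triangle inequality. -/
theorem norm_add_mul_exp_le {a b t : ℝ} (ha : 0 ≤ a) (hb : 0 ≤ b)
    (ht : t ∈ Icc (-Real.pi) Real.pi) :
    ‖(a : ℂ) + b * Complex.exp (t * Complex.I)‖ ≤
      a + b - min a b * (t ^ 2 / Real.pi ^ 2) := by
  have hm : 0 ≤ min a b := le_min ha hb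
  have hma : min a b ≤ a := min_le_left a b
  have hmb : min a b ≤ b := min_le_right a b
  have he : (a : ℂ) + b * Complex.exp (t * Complex.I) =
      (min a b : ℝ) * (1 + Complex.exp (t * Complex.I)) + ((a - min a b : ℝ) : ℂ) +
        ((b - min a b : ℝ) : ℂ) * Complex.exp (t * Complex.I) := by
    push_cast
    ring
  rw [he]
  refine (norm_add₃_le).trans ?_
  rw [norm_mul, norm_mul, Complex.norm_exp_ofReal_mul_I, Complex.norm_real, Complex.norm_real,
    Complex.norm_real, Real.norm_of_nonneg hm, Real.norm_of_nonneg (sub_nonneg.mpr hma),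
    Real.norm_of_nonneg (sub_nonneg.mpr hmb)]
  have := mul_le_mul_of_nonneg_left (norm_one_add_exp_le ht) hm
  linarith

/-- The characteristic function of a sequence of coefficients. -/
noncomputable def charSeries (P : PowerSeries ℝ) (t : ℝ) : PowerSeries ℂ :=
  PowerSeries.rescale (Complex.exp (t * Complex.I)) (PowerSeries.map Complex.ofRealHom P)

theorem coeff_charSeries (P : PowerSeries ℝ) (t : ℝ) (k : ℕ) :
    PowerSeries.coeff k (charSeries P t) =
      PowerSeries.coeff k P * Complex.exp (t * Complex.I) ^ k := by
  rw [charSeries, PowerSeries.coeff_rescale, PowerSeries.coeff_map, mul_comm]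
  rfl

theorem charSeries_pow (P : PowerSeries ℝ) (t : ℝ) (n : ℕ) :
    charSeries P t ^ n = charSeries (P ^ n) t := by
  simp only [charSeries, map_pow]

theorem norm_coeff_charSeries (P : PowerSeries ℝ) (t : ℝ) (k : ℕ) :
    ‖PowerSeries.coeff k (charSeries P t)‖ = ‖PowerSeries.coeff k P‖ := by
  rw [coeff_charSeries, norm_mul, norm_pow, Complex.norm_exp_ofReal_mul_I, one_pow, mul_one,
    Complex.norm_real]

/-- Fourier inversion. The terms have norms independent of t, so absolute summability of the
coefficients permits termwise integration. -/
theorem two_pi_mul_coeff_eq_integral {P : PowerSeries ℝ}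
    (hP : Summable fun k => ‖PowerSeries.coeff k P‖) (m : ℕ) :
    ∫ t in (-Real.pi)..Real.pi, (∑' k, PowerSeries.coeff k (charSeries P t)) *
      Complex.exp (-(m : ℤ) * Complex.I * t) = 2 * Real.pi * ((PowerSeries.coeff m P : ℝ) : ℂ) := by
  have hterm : ∀ (k : ℕ) (t : ℝ), PowerSeries.coeff k (charSeries P t) *
      Complex.exp (-(m : ℤ) * Complex.I * t) =
      PowerSeries.coeff k P * Complex.exp (((k : ℤ) - (m : ℤ) : ℤ) * Complex.I * t) := by
    intro k t
    rw [coeff_charSeries, ← Complex.exp_nat_mul, mul_assoc, ← Complex.exp_add]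
    congr 2
    push_cast
    ring
  let f : ℕ → C(ℝ, ℂ) := fun k =>
    ⟨fun t => ((PowerSeries.coeff k P : ℝ) : ℂ) * Complex.exp (((k : ℤ) - (m : ℤ) : ℤ) * Complex.I * t),
      by fun_prop⟩
  have hfn : ∀ k (t : ℝ), ‖f k t‖ = ‖PowerSeries.coeff k P‖ := fun k t => by
    change ‖((PowerSeries.coeff k P : ℝ) : ℂ) * Complex.exp (((k : ℤ) - (m : ℤ) : ℤ) * Complex.I * t)‖ = _
    rw [← hterm, norm_mul, norm_coeff_charSeries, Complex.norm_exp]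
    simp
  have hsum : Summable fun k =>
      ‖(f k).restrict (⟨uIcc (-Real.pi) Real.pi, isCompact_uIcc⟩ : TopologicalSpace.Compacts ℝ)‖ := by
    refine Summable.of_nonneg_of_le (fun _ => norm_nonneg _) (fun k => ?_) hP
    rw [ContinuousMap.norm_le _ (norm_nonneg _)]
    intro t
    exact (hfn k t).le
  have h := intervalIntegral.hasSum_intervalIntegral_of_summable_norm hsum
  have h2 : HasSum (fun k => ∫ t in (-Real.pi)..Real.pi, f k t)
      (2 * Real.pi * ((PowerSeries.coeff m P : ℝ) : ℂ)) := by
    have : (fun k => ∫ t in (-Real.pi)..Real.pi, f k t) =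
        fun k => if k = m then 2 * Real.pi * ((PowerSeries.coeff m P : ℝ) : ℂ) else 0 := by
      funext k
      change ∫ t in (-Real.pi)..Real.pi, ((PowerSeries.coeff k P : ℝ) : ℂ) *
        Complex.exp (((k : ℤ) - (m : ℤ) : ℤ) * Complex.I * t) = _
      rw [intervalIntegral.integral_const_mul, integral_exp_int_mul_I]
      by_cases hk : k = m
      · subst hk; simp; ring
      · rw [if_neg (by omega), if_neg hk, mul_zero]
    rw [this]
    exact hasSum_ite_eq m _
  rw [← h.unique h2]
  refine intervalIntegral.integral_congr fun t _ => ?_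
  rw [← tsum_mul_right]
  exact tsum_congr fun k => hterm k t

/-- Concentration of the coefficients of the powers of a probability generating function. -/
theorem exists_coeff_pow_le_div_sqrt {P : PowerSeries ℝ} (hp : ∀ k, 0 ≤ PowerSeries.coeff k P)
    (hsum : HasSum (fun k => PowerSeries.coeff k P) 1) (h0 : 0 < PowerSeries.coeff 0 P)
    (h1 : 0 < PowerSeries.coeff 1 P) :
    ∃ C > (0 : ℝ), ∀ n : ℕ, 1 ≤ n → ∀ m, PowerSeries.coeff m (P ^ n) ≤ C / √n := by
  obtain ⟨b, hbdef⟩ : ∃ b, b = min (PowerSeries.coeff 0 P) (PowerSeries.coeff 1 P) / Real.pi ^ 2 :=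
    ⟨_, rfl⟩
  have hb : 0 < b := by
    rw [hbdef]
    exact div_pos (lt_min h0 h1) (by positivity)
  have hP : Summable fun k => ‖PowerSeries.coeff k P‖ := by
    simpa only [Real.norm_of_nonneg (hp _)] using hsum.summable
  -- The first two terms lose b t² against their total mass, the others are bounded by theirs, and 1
  -- - b t² ≤ exp(-b t²).
  have hchar : ∀ t ∈ Icc (-Real.pi) Real.pi,
      ‖∑' k, PowerSeries.coeff k (charSeries P t)‖ ≤ Real.exp (-b * t ^ 2) := by
    intro t ht
    have hs : Summable fun k => ‖PowerSeries.coeff k (charSeries P t)‖ := by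
      simpa only [norm_coeff_charSeries] using hP
    rw [← hs.of_norm.sum_add_tsum_nat_add 2]
    have htail : ‖∑' k, PowerSeries.coeff (k + 2) (charSeries P t)‖ ≤
        1 - PowerSeries.coeff 0 P - PowerSeries.coeff 1 P := by
      have h2 := hsum.summable.sum_add_tsum_nat_add 2
      rw [hsum.tsum_eq] at h2
      simp only [Finset.sum_range_succ, Finset.sum_range_zero, zero_add] at h2
      have hs2 : Summable fun k => ‖PowerSeries.coeff (k + 2) (charSeries P t)‖ :=
        (summable_nat_add_iff (f := fun k => ‖PowerSeries.coeff k (charSeries P t)‖) 2).mpr hs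
      refine (norm_tsum_le_tsum_norm hs2).trans ?_
      simp only [norm_coeff_charSeries, Real.norm_of_nonneg (hp _)]
      linarith
    have hhead := norm_add_mul_exp_le (hp 0) (hp 1) ht
    refine (norm_add_le _ _).trans ?_
    simp only [Finset.sum_range_succ, Finset.sum_range_zero, zero_add, coeff_charSeries, pow_zero,
      mul_one, pow_one] at htail ⊢
    have he := Real.add_one_le_exp (-b * t ^ 2)
    have hbt : min (PowerSeries.coeff 0 P) (PowerSeries.coeff 1 P) * (t ^ 2 / Real.pi ^ 2) =
        b * t ^ 2 := by rw [hbdef]; ring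
    rw [hbt] at hhead
    linarith
  -- The n-th power of the characteristic function is below exp(-n b t²), whose integral over ℝ is
  -- √(π/(n b)). The factor 1/(2π) of the inversion formula is not exploited.
  refine ⟨√(Real.pi / b), by positivity, fun n hn m => ?_⟩
  have hn0 : (0 : ℝ) < n := by exact_mod_cast hn
  have hPn := summable_norm_coeff_pow hP n
  have hint := two_pi_mul_coeff_eq_integral hPn.1 m
  have hnorm : ‖∫ t in (-Real.pi)..Real.pi, (∑' k, PowerSeries.coeff k (charSeries (P ^ n) t)) *
      Complex.exp (-(m : ℤ) * Complex.I * t)‖ ≤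
      ∫ t in (-Real.pi)..Real.pi, Real.exp (-(n * b) * t ^ 2) := by
    refine intervalIntegral.norm_integral_le_of_norm_le (by linarith [Real.pi_pos])
      (Filter.Eventually.of_forall fun t ht => ?_) (Continuous.intervalIntegrable (by fun_prop) _ _)
    have hs : Summable fun k => ‖PowerSeries.coeff k (charSeries P t)‖ := by
      simpa only [norm_coeff_charSeries] using hP
    rw [norm_mul, ← charSeries_pow, (summable_norm_coeff_pow hs n).2, norm_pow]
    have he : ‖Complex.exp (-(m : ℤ) * Complex.I * t)‖ = 1 := by
      rw [Complex.norm_exp]; simp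
    rw [he, mul_one]
    refine (pow_le_pow_left₀ (norm_nonneg _) (hchar t (Ioc_subset_Icc_self ht)) n).trans_eq ?_
    rw [← Real.exp_nat_mul]
    congr 1
    ring
  have hgauss : ∫ t in (-Real.pi)..Real.pi, Real.exp (-(n * b) * t ^ 2) ≤
      √(Real.pi / (n * b)) := by
    rw [← integral_gaussian, intervalIntegral.integral_of_le (by linarith [Real.pi_pos])]
    exact setIntegral_le_integral (integrable_exp_neg_mul_sq (by positivity))
      (Filter.Eventually.of_forall fun t => (Real.exp_pos _).le)
  rw [hint, norm_mul, Complex.norm_real] at hnorm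
  have h2pi : (1 : ℝ) ≤ ‖(2 * Real.pi : ℂ)‖ := by
    rw [norm_mul, Complex.norm_real, Real.norm_of_nonneg Real.pi_pos.le]
    simp
    linarith [Real.pi_gt_three]
  have hle : PowerSeries.coeff m (P ^ n) ≤ ‖(2 * Real.pi : ℂ)‖ * ‖PowerSeries.coeff m (P ^ n)‖ :=
    (le_abs_self _).trans (le_mul_of_one_le_left (abs_nonneg _) h2pi)
  refine (hle.trans (hnorm.trans hgauss)).trans_eq ?_
  rw [← Real.sqrt_div (by positivity)]
  congr 1
  field_simp

/-! ### Decay of the majorant coefficients at the radius of convergence -/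

section Majorant

variable {Q : ℝ} {G : ℝ → ℝ}

/-- The Taylor series at `0` of `majorantRhs`. -/
noncomputable def majorantRhsSeries (Q : ℝ) (G : ℝ → ℝ) : PowerSeries ℝ :=
  PowerSeries.mk fun k => (1 + 8 / 3) * (iteratedDeriv k G (8 / 3) / (k ! : ℝ) +
    (if k = 0 then Q * (8 / 3) + deriv G (8 / 3) * (8 / 3) - G (8 / 3) else 0) +
    if k = 1 then Q else 0)

theorem coeff_majorantRhsSeries_nonneg (hQ : 0 ≤ Q)
    (hpos : ∀ (k : ℕ) (u : ℝ), 0 ≤ u → 0 ≤ iteratedDeriv k G u) (k : ℕ) :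
    0 ≤ PowerSeries.coeff k (majorantRhsSeries Q G) := by
  rw [majorantRhsSeries, PowerSeries.coeff_mk]
  refine mul_nonneg (by norm_num) ?_
  have h := hpos k (8 / 3) (by norm_num)
  have h1 := hpos 1 (8 / 3) (by norm_num)
  rw [iteratedDeriv_one] at h1
  rcases k with _ | k
  · simp only [iteratedDeriv_zero, if_true, Nat.factorial_zero, Nat.cast_one, div_one]
    rw [if_neg (by norm_num)]
    have : 0 ≤ Q * (8 / 3) + deriv G (8 / 3) * (8 / 3) := by positivity
    linarith
  · rw [if_neg (by omega)]
    split_ifs <;> positivity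

theorem hasSum_majorantRhsSeries (hG : ContDiff ℝ ∞ G)
    (hpos : ∀ (k : ℕ) (u : ℝ), 0 ≤ u → 0 ≤ iteratedDeriv k G u) {S : ℝ} (hS : 0 ≤ S) :
    HasSum (fun k => PowerSeries.coeff k (majorantRhsSeries Q G) * S ^ k) (majorantRhs Q G S) := by
  have h1 := hasSum_taylor_majorant hG hpos (x := 8 / 3) (by norm_num) hS
  have h2 : HasSum (fun k : ℕ => if k = 0 then
      Q * (8 / 3) + deriv G (8 / 3) * (8 / 3) - G (8 / 3) else 0)
      (Q * (8 / 3) + deriv G (8 / 3) * (8 / 3) - G (8 / 3)) := hasSum_ite_eq 0 _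
  have h3 : HasSum (fun k : ℕ => if k = 1 then Q * S else 0) (Q * S) := hasSum_ite_eq 1 _
  have h := ((h1.add h2).add h3).mul_left (1 + 8 / 3)
  have he : majorantRhs Q G S = (1 + 8 / 3) * (G (8 / 3 + S) +
      (Q * (8 / 3) + deriv G (8 / 3) * (8 / 3) - G (8 / 3)) + Q * S) := by
    unfold majorantRhs
    ring
  rw [he]
  refine h.congr_fun fun k => ?_
  rw [majorantRhsSeries, PowerSeries.coeff_mk]
  rcases k with _ | _ | k
  · simp
  · simp
    ring
  · simp
    ring

theorem coeff_zero_majorantRhsSeries (Q : ℝ) (G : ℝ → ℝ) :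
    PowerSeries.coeff 0 (majorantRhsSeries Q G) = majorantSeq Q G 1 := by
  rw [majorantRhsSeries, PowerSeries.coeff_mk, majorantSeq_one, majorantSeq_zero]
  simp

/-- The recurrence with z = 1, read as an identity of formal series. No convergence is involved, so
Lagrange inversion can use it. -/
theorem tailSeries_majorantSeq (Q : ℝ) (G : ℝ → ℝ) :
    tailSeries (majorantSeq Q G) = tailSeries (majorantSeq Q G) ^ 2 +
      PowerSeries.X * (majorantRhsSeries Q G).subst (tailSeries (majorantSeq Q G)) := by
  set F := tailSeries (majorantSeq Q G) with hF
  have hF0 : PowerSeries.constantCoeff F = 0 := constantCoeff_tailSeries _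
  ext j
  rcases j with _ | j
  · rw [map_add, PowerSeries.coeff_zero_X_mul, coeff_pow_eq_zero_of_lt hF0 (by norm_num), hF,
      coeff_tailSeries_zero, add_zero]
  · rw [map_add, PowerSeries.coeff_succ_X_mul, hF, coeff_tailSeries_succ, coeff_tailSeries_sq,
      ← hF, coeff_subst_eq_sum hF0 _ (Nat.lt_succ_self j)]
    have h := majorantSeq_succ_scaled Q G 1 j
    simp only [one_pow, one_mul, mul_one] at h
    rw [h]
    congr 1
    have hterm : ∀ k, PowerSeries.coeff k (majorantRhsSeries Q G) * PowerSeries.coeff j (F ^ k) =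
        (1 + 8 / 3) * (iteratedDeriv k G (8 / 3) / (k ! : ℝ) * PowerSeries.coeff j (F ^ k) +
        (if k = 0 then (Q * (8 / 3) + deriv G (8 / 3) * (8 / 3) - G (8 / 3)) *
          PowerSeries.coeff j (1 : PowerSeries ℝ) else 0) +
        if k = 1 then Q * PowerSeries.coeff j F else 0) := by
      intro k
      rw [majorantRhsSeries, PowerSeries.coeff_mk]
      rcases k with _ | _ | k
      · rw [if_pos rfl, if_pos rfl, if_neg (by omega), if_neg (by omega), pow_zero]
        ring
      · simp only [zero_add, pow_one, one_ne_zero, if_true, if_false]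
        ring
      · rw [if_neg (by omega), if_neg (by omega), if_neg (by omega), if_neg (by omega)]
        ring
    simp only [hterm]
    rw [← Finset.mul_sum, Finset.sum_add_distrib, Finset.sum_add_distrib, adomian_eq_sum_coeff_pow,
      majorantSeq_zero, ← hF, Finset.sum_ite_eq' (Finset.range (j + 1)) 0,
      Finset.sum_ite_eq' (Finset.range (j + 1)) 1,
      if_pos (Finset.mem_range.mpr (Nat.succ_pos j))]
    rcases j with _ | j
    · rw [if_pos rfl, if_neg (by simp), majorantSeq_zero, PowerSeries.coeff_one, if_pos rfl]
      ring
    · rw [if_pos (Finset.mem_range.mpr (by omega)), hF, coeff_tailSeries_succ,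
        PowerSeries.coeff_one, if_neg (by omega), if_neg (by omega)]
      ring

/-- The series `Φ` with `F = X Φ(F)`. -/
noncomputable def inversionSeries (Q : ℝ) (G : ℝ → ℝ) : PowerSeries ℝ :=
  majorantRhsSeries Q G * PowerSeries.mk fun _ => (1 : ℝ)

theorem coeff_inversionSeries (Q : ℝ) (G : ℝ → ℝ) (k : ℕ) :
    PowerSeries.coeff k (inversionSeries Q G) =
      ∑ i ∈ Finset.range (k + 1), PowerSeries.coeff i (majorantRhsSeries Q G) := by
  rw [inversionSeries, PowerSeries.coeff_mul, Finset.Nat.sum_antidiagonal_eq_sum_range_succ_mk]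
  simp

/-- From F - F² = X H(F): division by 1 - F replaces H by H/(1 - X) and puts the equation into
Lagrange form. -/
theorem tailSeries_eq_X_mul_subst (Q : ℝ) (G : ℝ → ℝ) :
    tailSeries (majorantSeq Q G) = PowerSeries.X *
      (inversionSeries Q G).subst (tailSeries (majorantSeq Q G)) := by
  have h := tailSeries_majorantSeq Q G
  set F := tailSeries (majorantSeq Q G) with hF
  have hF0 : PowerSeries.constantCoeff F = 0 := constantCoeff_tailSeries _
  have hs : PowerSeries.HasSubst F := PowerSeries.HasSubst.of_constantCoeff_zero' hF0
  have hg : inversionSeries Q G * (1 - PowerSeries.X) = majorantRhsSeries Q G := by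
    rw [inversionSeries, mul_assoc]
    exact (congrArg _ (PowerSeries.mk_one_mul_one_sub_eq_one ℝ)).trans (mul_one _)
  have hone : (1 : PowerSeries ℝ).subst F = 1 := by
    rw [← PowerSeries.coe_substAlgHom hs, map_one]
  have h1 : (inversionSeries Q G).subst F * (1 - F) = (majorantRhsSeries Q G).subst F := by
    rw [← hg, PowerSeries.subst_mul hs, PowerSeries.subst_sub hs, PowerSeries.subst_X hs, hone]
  have hne : (1 - F) ≠ 0 := by
    intro h0
    have := congrArg PowerSeries.constantCoeff h0
    simp [hF0] at this
  refine mul_right_cancel₀ hne ?_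
  rw [mul_assoc, h1]
  linear_combination h

/-- The coefficients of the generating function decay like `j^{-3/2} R^{-j}`. -/
theorem exists_majorantSeq_bound (hQ : 0 ≤ Q) (hG : ContDiff ℝ ∞ G)
    (hpos : ∀ (k : ℕ) (u : ℝ), 0 ≤ u → 0 ≤ iteratedDeriv k G u) :
    ∃ c > (0 : ℝ), ∃ ε > (0 : ℝ), ∀ j : ℕ, 1 ≤ j →
      majorantRadius Q G ^ j * ENNReal.ofReal (majorantSeq Q G j) ≤
        ENNReal.ofReal (c / (j : ℝ) ^ (1 + ε)) := by
  -- If all v̄_j with j ≥ 1 vanish, the left-hand side is 0 even for infinite R, by ∞ · 0 = 0.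
  -- Otherwise R is finite and v̄_1 > 0.
  by_cases hzero : ∀ j, majorantSeq Q G (j + 1) = 0
  · refine ⟨1, one_pos, 1, one_pos, fun j hj => ?_⟩
    obtain ⟨i, rfl⟩ : ∃ i, j = i + 1 := ⟨j - 1, by omega⟩
    rw [hzero i, ENNReal.ofReal_zero, mul_zero]
    exact zero_le
  have htop : majorantRadius Q G ≠ ⊤ := fun h =>
    hzero (majorantSeq_eq_zero_of_radius_eq_top hQ hG hpos h)
  have hv1 : 0 < majorantSeq Q G 1 := lt_of_le_of_ne (majorantSeq_nonneg hQ hpos 1)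
    fun h => hzero (majorantSeq_eq_zero_of_one_eq_zero h.symm)
  obtain ⟨ρ, hρdef⟩ : ∃ ρ, ρ = (majorantRadius Q G).toReal := ⟨_, rfl⟩
  have hρ : 0 < ρ := by
    rw [hρdef]
    exact ENNReal.toReal_pos (majorantRadius_pos hQ hG hpos).ne' htop
  have hR : majorantRadius Q G = ENNReal.ofReal ρ := by rw [hρdef, ENNReal.ofReal_toReal htop]
  have hs := summable_majorantSeq_radius hQ hG hpos htop
  rw [← hρdef] at hs
  have heq := majorant_equation hQ hG hpos hρ.le hs
  have hs1 := (summable_nat_add_iff 1).mpr hs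
  have hnn : ∀ j, 0 ≤ ρ ^ (j + 1) * majorantSeq Q G (j + 1) := fun j =>
    mul_nonneg (pow_nonneg hρ.le _) (majorantSeq_nonneg hQ hpos _)
  obtain ⟨τ, hτdef⟩ : ∃ τ, τ = ∑' j, ρ ^ (j + 1) * majorantSeq Q G (j + 1) := ⟨_, rfl⟩
  rw [← hτdef] at heq
  have hτ0 : 0 < τ := by
    rw [hτdef]
    refine hs1.tsum_pos hnn 0 ?_
    exact mul_pos (pow_pos hρ _) hv1
  have hH0 : majorantSeq Q G 1 ≤ majorantRhs Q G τ := by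
    have h := sum_le_hasSum {0} (fun k _ => mul_nonneg (coeff_majorantRhsSeries_nonneg hQ hpos k)
      (pow_nonneg hτ0.le k)) (hasSum_majorantRhsSeries (Q := Q) hG hpos hτ0.le)
    rw [Finset.sum_singleton, coeff_zero_majorantRhsSeries, pow_zero, mul_one] at h
    exact h
  have hHpos : 0 < majorantRhs Q G τ := hv1.trans_le hH0
  -- Strictness matters: 1/(1 - X) has to converge at τ. It comes from H(τ) ≥ v̄_1 > 0 in τ = τ² + ρ
  -- H(τ).
  have hτ1 : τ < 1 := by
    have := mul_pos hρ hHpos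
    by_contra hge
    nlinarith
  set Φ := inversionSeries Q G with hΦ
  have hh : ∀ k, 0 ≤ PowerSeries.coeff k (majorantRhsSeries Q G) :=
    coeff_majorantRhsSeries_nonneg hQ hpos
  -- Φ(τ) = H(τ)/(1 - τ), and the equation for τ gives ρ H(τ) = τ(1 - τ).
  have hΦsum : HasSum (fun k => PowerSeries.coeff k Φ * τ ^ k) (τ / ρ) := by
    have hHs := hasSum_majorantRhsSeries (Q := Q) hG hpos hτ0.le
    have hgeo := hasSum_geometric_of_lt_one hτ0.le hτ1
    have hp : Summable fun k => ‖PowerSeries.coeff k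
        (PowerSeries.rescale τ (majorantRhsSeries Q G))‖ := by
      simp only [PowerSeries.coeff_rescale]
      convert hHs.summable using 2 with k
      rw [mul_comm, Real.norm_of_nonneg (mul_nonneg (hh k) (pow_nonneg hτ0.le k))]
    have hq : Summable fun k => ‖PowerSeries.coeff k
        (PowerSeries.rescale τ (PowerSeries.mk fun _ => (1 : ℝ)))‖ := by
      simp only [PowerSeries.coeff_rescale, PowerSeries.coeff_mk, mul_one, norm_pow,
        Real.norm_of_nonneg hτ0.le]
      exact hgeo.summable
    have hm := summable_norm_coeff_mul hp hq
    rw [← map_mul] at hm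
    change _ ∧ ∑' i, PowerSeries.coeff i (PowerSeries.rescale τ Φ) = _ at hm
    have hm1 : Summable fun k => PowerSeries.coeff k (PowerSeries.rescale τ Φ) := hm.1.of_norm
    have := hm1.hasSum
    rw [hm.2] at this
    simp only [PowerSeries.coeff_rescale, PowerSeries.coeff_mk, mul_one] at this
    rw [hgeo.tsum_eq, tsum_congr fun k => mul_comm _ _, hHs.tsum_eq] at this
    convert this using 1
    · funext k
      rw [mul_comm]
    · have h1 : (1 - τ) ≠ 0 := by linarith
      field_simp
      linarith
  have hΦ0 : PowerSeries.coeff 0 Φ = majorantSeq Q G 1 := by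
    rw [hΦ, coeff_inversionSeries, Finset.sum_range_one, coeff_zero_majorantRhsSeries]
  -- The factor 1/(1 - X) makes this coefficient at least v̄_1. Two adjacent positive coefficients
  -- exclude periodicity, whatever H is.
  have hΦ1 : 0 < PowerSeries.coeff 1 Φ := by
    rw [hΦ, coeff_inversionSeries, Finset.sum_range_succ, Finset.sum_range_one,
      coeff_zero_majorantRhsSeries]
    linarith [hh 1]
  -- Normalized by Φ(τ) = τ/ρ, the coefficients of Φ(τX) form a probability distribution.
  set P : PowerSeries ℝ := PowerSeries.C (ρ / τ) * PowerSeries.rescale τ Φ with hP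
  have hPc : ∀ k, PowerSeries.coeff k P = ρ / τ * (PowerSeries.coeff k Φ * τ ^ k) := fun k => by
    rw [hP, PowerSeries.coeff_C_mul, PowerSeries.coeff_rescale, mul_comm (τ ^ k)]
  have hPpow : ∀ n k, PowerSeries.coeff k (P ^ n) =
      (ρ / τ) ^ n * (PowerSeries.coeff k (Φ ^ n) * τ ^ k) := fun n k => by
    rw [hP, mul_pow, ← map_pow, ← map_pow, PowerSeries.coeff_C_mul, PowerSeries.coeff_rescale,
      mul_comm (τ ^ k)]
  have hratio : 0 < ρ / τ := div_pos hρ hτ0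
  obtain ⟨C, hC, hbound⟩ := exists_coeff_pow_le_div_sqrt (P := P)
    (fun k => by
      rw [hPc, hΦ, coeff_inversionSeries]
      exact mul_nonneg hratio.le (mul_nonneg (Finset.sum_nonneg fun i _ => hh i)
        (pow_nonneg hτ0.le k)))
    (by
      simp only [hPc]
      have := hΦsum.mul_left (ρ / τ)
      rwa [div_mul_div_cancel₀ hτ0.ne', div_self hρ.ne'] at this)
    (by
      rw [hPc, hΦ0, pow_zero, mul_one]
      exact mul_pos hratio hv1)
    (by
      rw [hPc]
      positivity)
  -- The exponent 3/2 is one power of j from Lagrange inversion plus 1/2 from concentration. The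
  -- factor τ remains because coefficient n of a power n + 1 is scaled by τ^n / τ^{n+1}.
  refine ⟨τ * C, mul_pos hτ0 hC, 1 / 2, by norm_num, fun j hj => ?_⟩
  obtain ⟨n, rfl⟩ : ∃ n, j = n + 1 := ⟨j - 1, by omega⟩
  rw [hR, ← ENNReal.ofReal_pow hρ.le, ← ENNReal.ofReal_mul (pow_nonneg hρ.le _)]
  refine ENNReal.ofReal_le_ofReal ?_
  have hL := lagrange_inversion (constantCoeff_tailSeries (majorantSeq Q G))
    (Φ := Φ) (by
      rw [← PowerSeries.coeff_zero_eq_constantCoeff_apply, hΦ0]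
      exact hv1.ne') (tailSeries_eq_X_mul_subst Q G) n
  rw [coeff_tailSeries_succ] at hL
  have hb := hbound (n + 1) (by omega) n
  rw [hPpow, ← hL] at hb
  have hn : (0 : ℝ) < (n : ℝ) + 1 := by positivity
  push_cast at hb ⊢
  have e1 : ((n : ℝ) + 1) ^ (1 + (1 / 2 : ℝ)) = ((n : ℝ) + 1) * √((n : ℝ) + 1) := by
    rw [Real.rpow_add hn, Real.rpow_one, Real.sqrt_eq_rpow]
  have e2 : (ρ / τ) ^ (n + 1) * (((n : ℝ) + 1) * majorantSeq Q G (n + 1) * τ ^ n) =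
      ρ ^ (n + 1) * majorantSeq Q G (n + 1) * ((n : ℝ) + 1) / τ := by
    rw [div_pow, pow_succ τ]
    field_simp
  rw [e2, div_le_div_iff₀ hτ0 (Real.sqrt_pos.mpr hn)] at hb
  rw [e1, le_div_iff₀ (mul_pos hn (Real.sqrt_pos.mpr hn))]
  linarith

end Majorant

/-! ### Second-order equations in the sense of Carathéodory -/

namespace SecondDerivEq

variable {a b : ℝ} {w d g : ℝ → ℝ}

theorem mono (h : SecondDerivEq a b w d g) {a' b' : ℝ} (ha : a ≤ a') (hab : a' ≤ b') (hb : b' ≤ b) :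
    SecondDerivEq a' b' w d g := by
  obtain ⟨h1, h2, h3⟩ := h
  refine ⟨fun x hx => (h1 x ⟨ha.trans hx.1, hx.2.trans hb⟩).mono (Icc_subset_Icc ha hb), ?_, ?_⟩
  · refine h2.mono ?_
    rw [uIcc_of_le hab, uIcc_of_le (ha.trans (hab.trans hb))]
    exact Icc_subset_Icc ha hb
  · exact ae_restrict_of_ae_restrict_of_subset (Ioo_subset_Ioo ha hb) h3

theorem congr (h : SecondDerivEq a b w d g) {w' g' : ℝ → ℝ} (hw : ∀ x ∈ Icc a b, w' x = w x)
    (hg : ∀ x ∈ Ioo a b, g' x = g x) : SecondDerivEq a b w' d g' := by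
  obtain ⟨h1, h2, h3⟩ := h
  refine ⟨fun x hx => (h1 x hx).congr hw (hw x hx), h2, ?_⟩
  filter_upwards [h3, ae_restrict_mem measurableSet_Ioo] with x hx hxm
  rw [hg x hxm]
  exact hx

theorem add (h : SecondDerivEq a b w d g) {w' d' g' : ℝ → ℝ} (h' : SecondDerivEq a b w' d' g') :
    SecondDerivEq a b (fun x => w x + w' x) (fun x => d x + d' x) (fun x => g x + g' x) := by
  obtain ⟨h1, h2, h3⟩ := h
  obtain ⟨h1', h2', h3'⟩ := h'
  refine ⟨fun x hx => (h1 x hx).add (h1' x hx), h2.add h2', ?_⟩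
  filter_upwards [h3, h3'] with x hx hx'
  exact hx.add hx'

theorem continuousOn (h : SecondDerivEq a b w d g) : ContinuousOn w (Icc a b) :=
  fun x hx => (h.1 x hx).continuousWithinAt

/-- The derivative is absolutely continuous, hence bounded, so the function is Lipschitz. -/
theorem absolutelyContinuous (h : SecondDerivEq a b w d g) (hab : a ≤ b) :
    AbsolutelyContinuousOnInterval w a b := by
  obtain ⟨K, hK⟩ := h.2.1.exists_bound
  have hK0 : 0 ≤ K := (norm_nonneg _).trans (hK a left_mem_uIcc)
  have hl : LipschitzOnWith K.toNNReal w (Icc a b) := by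
    refine (convex_Icc a b).lipschitzOnWith_of_nnnorm_hasDerivWithin_le h.1 fun x hx => ?_
    rw [← NNReal.coe_le_coe, coe_nnnorm, Real.coe_toNNReal K hK0]
    exact hK x (by rwa [uIcc_of_le hab])
  refine LipschitzOnWith.absolutelyContinuousOnInterval (K := K.toNNReal) ?_
  rwa [uIcc_of_le hab]

/-- Variation of constants. -/
theorem integral_sin_mul (h : SecondDerivEq a b w d g) {s : ℝ} (hs : s ≠ 0) (x : ℝ) {y : ℝ}
    (hy : y ∈ Icc a b) :
    ∫ t in a..y, Real.sin (s * (x - t)) / s * (g t + s ^ 2 * w t) =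
      (d y * (Real.sin (s * (x - y)) / s) + w y * Real.cos (s * (x - y))) -
      (d a * (Real.sin (s * (x - a)) / s) + w a * Real.cos (s * (x - a))) := by
  have h' := h.mono le_rfl hy.1 hy.2
  have hk : ContDiff ℝ 1 fun t => Real.sin (s * (x - t)) / s := by fun_prop
  have hc : ContDiff ℝ 1 fun t => Real.cos (s * (x - t)) := by fun_prop
  -- The derivative in t of d(t) sin(s(x - t))/s + w(t) cos(s(x - t)) is almost everywhere the
  -- kernel times w'' + s² w. The sum is absolutely continuous, so it is the integral of this
  -- derivative.
  have hE := (h'.2.1.fun_mul hk.contDiffOn.absolutelyContinuousOnInterval).fun_add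
    ((h'.absolutelyContinuous hy.1).fun_mul hc.contDiffOn.absolutelyContinuousOnInterval)
  rw [← hE.integral_deriv_eq_sub, intervalIntegral.integral_of_le hy.1,
    intervalIntegral.integral_of_le hy.1, integral_Ioc_eq_integral_Ioo,
    integral_Ioc_eq_integral_Ioo]
  refine integral_congr_ae ?_
  filter_upwards [h'.2.2, ae_restrict_mem measurableSet_Ioo] with t hd ht
  have hw : HasDerivAt w (d t) t :=
    (h'.1 t (Ioo_subset_Icc_self ht)).hasDerivAt (Icc_mem_nhds ht.1 ht.2)
  have hi : HasDerivAt (fun t => s * (x - t)) (-s) t := by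
    simpa using ((hasDerivAt_id t).const_sub x).const_mul s
  have hs1 : HasDerivAt (fun t => Real.sin (s * (x - t)) / s)
      (Real.cos (s * (x - t)) * (-s) / s) t := hi.sin.div_const s
  have hc1 : HasDerivAt (fun t => Real.cos (s * (x - t)))
      (-Real.sin (s * (x - t)) * (-s)) t := hi.cos
  rw [((hd.fun_mul hs1).fun_add (hw.fun_mul hc1)).deriv]
  field_simp
  ring

end SecondDerivEq

namespace SolvesTransmission

theorem congr {g₁ g₂ w₁ w₂ g₁' g₂' w₁' w₂' : ℝ → ℝ} {σ J : ℝ}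
    (h : SolvesTransmission g₁ g₂ σ J w₁ w₂)
    (hw₁ : ∀ x ∈ Icc (0 : ℝ) (1 / 2), w₁' x = w₁ x) (hw₂ : ∀ x ∈ Icc (1 / 2 : ℝ) 1, w₂' x = w₂ x)
    (hg₁ : ∀ x ∈ Ioo (0 : ℝ) (1 / 2), g₁' x = g₁ x)
    (hg₂ : ∀ x ∈ Ioo (1 / 2 : ℝ) 1, g₂' x = g₂ x) : SolvesTransmission g₁' g₂' σ J w₁' w₂' := by
  obtain ⟨d₁, d₂, h1, h2, h3, h4, h5, h6, h7⟩ := h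
  refine ⟨d₁, d₂, h1.congr hw₁ hg₁, h2.congr hw₂ hg₂, ?_, ?_, h5, ?_, h7⟩
  · rw [hw₁ 0 (by norm_num), h3]
  · rw [hw₂ 1 (by norm_num), h4]
  · rw [hw₁ _ (by norm_num), hw₂ _ (by norm_num), h6]

theorem add {g₁ g₂ w₁ w₂ g₁' g₂' w₁' w₂' : ℝ → ℝ} {σ J σ' J' : ℝ}
    (h : SolvesTransmission g₁ g₂ σ J w₁ w₂) (h' : SolvesTransmission g₁' g₂' σ' J' w₁' w₂') :
    SolvesTransmission (fun x => g₁ x + g₁' x) (fun x => g₂ x + g₂' x) (σ + σ') (J + J')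
      (fun x => w₁ x + w₁' x) (fun x => w₂ x + w₂' x) := by
  obtain ⟨d₁, d₂, h1, h2, h3, h4, h5, h6, h7⟩ := h
  obtain ⟨d₁', d₂', h1', h2', h3', h4', h5', h6', h7'⟩ := h'
  refine ⟨fun x => d₁ x + d₁' x, fun x => d₂ x + d₂' x, h1.add h1', h2.add h2', ?_, ?_, ?_, ?_, ?_⟩
  · simp only [h3, h3', add_zero]
  · simp only [h4, h4', add_zero]
  · simp only [h5, h5']
  · simp only
    linarith
  · simp only
    linarith

end SolvesTransmission

/-! ### Gluing at 1/2 and the Volterra operator -/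

/-- The function that is `f₁` up to `1 / 2` and `f₂` from there on. -/
noncomputable def glue (f₁ f₂ : ℝ → ℝ) (x : ℝ) : ℝ := if x ≤ 1 / 2 then f₁ x else f₂ x

theorem glue_of_le {f₁ f₂ : ℝ → ℝ} {x : ℝ} (h : x ≤ 1 / 2) : glue f₁ f₂ x = f₁ x := if_pos h

theorem glue_of_gt {f₁ f₂ : ℝ → ℝ} {x : ℝ} (h : 1 / 2 < x) : glue f₁ f₂ x = f₂ x :=
  if_neg (not_le.mpr h)

theorem glue_of_ge {f₁ f₂ : ℝ → ℝ} (he : f₁ (1 / 2) = f₂ (1 / 2)) {x : ℝ} (h : 1 / 2 ≤ x) :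
    glue f₁ f₂ x = f₂ x := by
  rcases h.eq_or_lt with rfl | h
  · rw [glue_of_le le_rfl, he]
  · exact glue_of_gt h

theorem continuousOn_glue {f₁ f₂ : ℝ → ℝ} (h₁ : ContinuousOn f₁ (Icc 0 (1 / 2)))
    (h₂ : ContinuousOn f₂ (Icc (1 / 2) 1)) (he : f₁ (1 / 2) = f₂ (1 / 2)) :
    ContinuousOn (glue f₁ f₂) (Icc 0 1) := by
  rw [← Icc_union_Icc_eq_Icc (show (0 : ℝ) ≤ 1 / 2 by norm_num) (show (1 / 2 : ℝ) ≤ 1 by norm_num)]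
  refine ContinuousOn.union_of_isClosed (h₁.congr fun x hx => glue_of_le hx.2)
    (h₂.congr fun x hx => glue_of_ge he hx.1) isClosed_Icc isClosed_Icc

theorem intervalIntegral_congr_uIoc {f g : ℝ → ℝ} {a b : ℝ} (h : EqOn f g (uIoc a b)) :
    ∫ x in a..b, f x = ∫ x in a..b, g x :=
  intervalIntegral.integral_congr_ae (Filter.Eventually.of_forall fun _ hx => h hx)

theorem integral_glue {f₁ f₂ : ℝ → ℝ} (h₁ : IntervalIntegrable f₁ volume 0 (1 / 2))
    (h₂ : IntervalIntegrable f₂ volume (1 / 2) 1) :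
    IntervalIntegrable (glue f₁ f₂) volume 0 1 ∧
      ∫ x in (0 : ℝ)..1, glue f₁ f₂ x =
        (∫ x in (0 : ℝ)..(1 / 2), f₁ x) + ∫ x in (1 / 2 : ℝ)..1, f₂ x := by
  have e₁ : EqOn f₁ (glue f₁ f₂) (uIoc 0 (1 / 2)) := fun x hx => by
    rw [uIoc_of_le (by norm_num)] at hx
    exact (glue_of_le hx.2).symm
  have e₂ : EqOn f₂ (glue f₁ f₂) (uIoc (1 / 2) 1) := fun x hx => by
    rw [uIoc_of_le (by norm_num)] at hx
    exact (glue_of_gt hx.1).symm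
  have i₁ := h₁.congr e₁
  have i₂ := h₂.congr e₂
  refine ⟨i₁.trans i₂, ?_⟩
  rw [← intervalIntegral.integral_add_adjacent_intervals i₁ i₂,
    intervalIntegral_congr_uIoc e₁, intervalIntegral_congr_uIoc e₂]

/-- The solution of `w'' + s² w = F`, `w(0) = w'(0) = 0`. -/
noncomputable def volterra (s : ℝ) (F : ℝ → ℝ) (x : ℝ) : ℝ :=
  ∫ t in (0 : ℝ)..x, Real.sin (s * (x - t)) / s * F t

theorem intervalIntegrable_of_mem {F : ℝ → ℝ} (hF : IntervalIntegrable F volume 0 1) {x : ℝ}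
    (hx : x ∈ Icc (0 : ℝ) 1) : IntervalIntegrable F volume 0 x := by
  refine hF.mono_set ?_
  rw [uIcc_of_le hx.1, uIcc_of_le zero_le_one]
  exact Icc_subset_Icc_right hx.2

/-- Variation of constants on each half. The boundary terms at 0 vanish, and those at 1/2 cancel
because w and w' have no jump, so both halves merge into a single integral. -/
theorem SolvesTransmission.glue_eq_volterra {s : ℝ} (hs : s ≠ 0) {F₁ F₂ w₁ w₂ : ℝ → ℝ}
    (hF₁ : IntervalIntegrable F₁ volume 0 (1 / 2)) (hF₂ : IntervalIntegrable F₂ volume (1 / 2) 1)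
    (h : SolvesTransmission (fun x => F₁ x - s ^ 2 * w₁ x) (fun x => F₂ x - s ^ 2 * w₂ x) 0 0 w₁ w₂)
    {x : ℝ} (hx : x ∈ Icc (0 : ℝ) 1) : glue w₁ w₂ x = volterra s (glue F₁ F₂) x := by
  obtain ⟨d₁, d₂, h1, h2, h3, h4, h5, h6, h7⟩ := h
  have hk : Continuous fun t => Real.sin (s * (x - t)) / s := by fun_prop
  have e₁ : ∀ y ≤ (1 / 2 : ℝ), 0 ≤ y →
      ∫ t in (0 : ℝ)..y, Real.sin (s * (x - t)) / s * glue F₁ F₂ t =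
      ∫ t in (0 : ℝ)..y, Real.sin (s * (x - t)) / s * (F₁ t - s ^ 2 * w₁ t + s ^ 2 * w₁ t) := by
    intro y hy hy0
    refine intervalIntegral.integral_congr fun t ht => ?_
    rw [uIcc_of_le hy0] at ht
    simp only [glue_of_le (ht.2.trans hy), sub_add_cancel]
  unfold volterra
  rcases le_or_gt x (1 / 2) with hle | hgt
  · rw [glue_of_le hle, e₁ x hle hx.1, h1.integral_sin_mul hs x ⟨hx.1, hle⟩]
    simp [h3, h5]
  · have e₂ : ∫ t in (1 / 2 : ℝ)..x, Real.sin (s * (x - t)) / s * glue F₁ F₂ t =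
        ∫ t in (1 / 2 : ℝ)..x, Real.sin (s * (x - t)) / s *
          (F₂ t - s ^ 2 * w₂ t + s ^ 2 * w₂ t) := by
      refine intervalIntegral_congr_uIoc fun t ht => ?_
      rw [uIoc_of_le hgt.le] at ht
      simp only [glue_of_gt ht.1, sub_add_cancel]
    have hi := (integral_glue hF₁ hF₂).1.continuousOn_mul hk.continuousOn
    rw [← intervalIntegral.integral_add_adjacent_intervals (b := 1 / 2)
      (hi.mono_set (by
        rw [uIcc_of_le (by norm_num), uIcc_of_le zero_le_one]
        exact Icc_subset_Icc_right (by norm_num)))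
      (hi.mono_set (by
        rw [uIcc_of_le hgt.le, uIcc_of_le zero_le_one]
        exact Icc_subset_Icc (by norm_num) hx.2)), e₁ _ le_rfl (by norm_num), e₂,
      h1.integral_sin_mul hs x (right_mem_Icc.mpr (by norm_num)),
      h2.integral_sin_mul hs x ⟨hgt.le, hx.2⟩, glue_of_gt hgt, h3, h5]
    rw [sub_eq_zero] at h6 h7
    rw [h6, h7]
    simp

/-- The addition theorem writes the integral as (sin(sx) C(x) - cos(sx) S(x))/s with primitives C
and S. As F is merely integrable, these are differentiable only almost everywhere, whereas the first
derivative of the combination is needed at every point. -/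
theorem secondDerivEq_volterra {s : ℝ} (hs : s ≠ 0) {F : ℝ → ℝ}
    (hF : IntervalIntegrable F volume 0 1) :
    ∃ D : ℝ → ℝ, D 0 = 0 ∧
      SecondDerivEq 0 1 (volterra s F) D (fun x => F x - s ^ 2 * volterra s F x) := by
  have hci : IntervalIntegrable (fun t => Real.cos (s * t) * F t) volume 0 1 :=
    hF.continuousOn_mul (Continuous.continuousOn (by fun_prop))
  have hsi : IntervalIntegrable (fun t => Real.sin (s * t) * F t) volume 0 1 :=
    hF.continuousOn_mul (Continuous.continuousOn (by fun_prop))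
  obtain ⟨C, hC⟩ : ∃ C : ℝ → ℝ, C = fun x => ∫ t in (0 : ℝ)..x, Real.cos (s * t) * F t := ⟨_, rfl⟩
  obtain ⟨S, hS⟩ : ∃ S : ℝ → ℝ, S = fun x => ∫ t in (0 : ℝ)..x, Real.sin (s * t) * F t := ⟨_, rfl⟩
  have hW : ∀ x ∈ Icc (0 : ℝ) 1, volterra s F x =
      Real.sin (s * x) / s * C x - Real.cos (s * x) / s * S x := by
    intro x hx
    rw [hC, hS]
    simp only
    rw [← intervalIntegral.integral_const_mul, ← intervalIntegral.integral_const_mul,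
      ← intervalIntegral.integral_sub ((intervalIntegrable_of_mem hci hx).const_mul _)
        ((intervalIntegrable_of_mem hsi hx).const_mul _)]
    refine intervalIntegral.integral_congr fun t _ => ?_
    simp only [mul_sub, Real.sin_sub]
    ring
  have hCa : AbsolutelyContinuousOnInterval C 0 1 := by
    rw [hC]
    exact hci.absolutelyContinuousOnInterval_intervalIntegral left_mem_uIcc
  have hSa : AbsolutelyContinuousOnInterval S 0 1 := by
    rw [hS]
    exact hsi.absolutelyContinuousOnInterval_intervalIntegral left_mem_uIcc
  have hCd : ∀ᵐ x, x ∈ uIcc (0 : ℝ) 1 → HasDerivAt C (Real.cos (s * x) * F x) x := by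
    filter_upwards [hci.ae_hasDerivAt_integral] with x hx hxm
    rw [hC]
    exact hx hxm 0 left_mem_uIcc
  have hSd : ∀ᵐ x, x ∈ uIcc (0 : ℝ) 1 → HasDerivAt S (Real.sin (s * x) * F x) x := by
    filter_upwards [hsi.ae_hasDerivAt_integral] with x hx hxm
    rw [hS]
    exact hx hxm 0 left_mem_uIcc
  have hac : ∀ f : ℝ → ℝ, ContDiff ℝ 1 f → AbsolutelyContinuousOnInterval f 0 1 := fun f hf =>
    hf.contDiffOn.absolutelyContinuousOnInterval
  obtain ⟨D, hD⟩ : ∃ D : ℝ → ℝ, D = fun x => Real.cos (s * x) * C x + Real.sin (s * x) * S x :=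
    ⟨_, rfl⟩
  obtain ⟨W, hWd⟩ : ∃ W : ℝ → ℝ,
      W = fun x => Real.sin (s * x) / s * C x - Real.cos (s * x) / s * S x := ⟨_, rfl⟩
  have hWa : AbsolutelyContinuousOnInterval W 0 1 := by
    rw [hWd]
    exact ((hac _ (by fun_prop)).fun_mul hCa).fun_sub ((hac _ (by fun_prop)).fun_mul hSa)
  have hDa : AbsolutelyContinuousOnInterval D 0 1 := by
    rw [hD]
    exact ((hac _ (by fun_prop)).fun_mul hCa).fun_add ((hac _ (by fun_prop)).fun_mul hSa)
  have hsin : ∀ x, HasDerivAt (fun x => Real.sin (s * x)) (Real.cos (s * x) * s) x := fun x => by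
    simpa using ((hasDerivAt_id x).const_mul s).sin
  have hcos : ∀ x, HasDerivAt (fun x => Real.cos (s * x)) (-Real.sin (s * x) * s) x := fun x => by
    simpa using ((hasDerivAt_id x).const_mul s).cos
  have hWae : ∀ᵐ x, x ∈ uIcc (0 : ℝ) 1 → HasDerivAt W (D x) x := by
    filter_upwards [hCd, hSd] with x h1 h2 hx
    rw [hWd, hD]
    refine ((((hsin x).div_const s).fun_mul (h1 hx)).fun_sub
      (((hcos x).div_const s).fun_mul (h2 hx))).congr_deriv ?_
    field_simp
    ring
  have hDae : ∀ᵐ x, x ∈ uIcc (0 : ℝ) 1 → HasDerivAt D (F x - s ^ 2 * W x) x := by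
    filter_upwards [hCd, hSd] with x h1 h2 hx
    rw [hWd, hD]
    refine (((hcos x).fun_mul (h1 hx)).fun_add ((hsin x).fun_mul (h2 hx))).congr_deriv ?_
    have := Real.sin_sq_add_cos_sq (s * x)
    field_simp
    linear_combination (F x) * this
  have hDc : ContinuousOn D (Icc 0 1) := by
    have := hDa.continuousOn
    rwa [uIcc_of_le zero_le_one] at this
  -- W is absolutely continuous with derivative D almost everywhere, hence the integral of D.
  -- Continuity of D then gives differentiability everywhere on [0, 1].
  have hWint : ∀ x ∈ Icc (0 : ℝ) 1, W x = ∫ t in (0 : ℝ)..x, D t := by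
    intro x hx
    have hsub : uIcc 0 x ⊆ uIcc (0 : ℝ) 1 := by
      rw [uIcc_of_le hx.1, uIcc_of_le zero_le_one]
      exact Icc_subset_Icc_right hx.2
    have h := (hWa.mono hsub).integral_deriv_eq_sub
    have h0 : W 0 = 0 := by rw [hWd, hC, hS]; simp
    rw [h0, sub_zero] at h
    rw [← h]
    refine intervalIntegral.integral_congr_ae ?_
    filter_upwards [hWae] with t ht htm
    exact (ht (hsub (uIoc_subset_uIcc htm))).deriv
  refine ⟨D, by rw [hD, hC, hS]; simp, ?_⟩
  have hWD : SecondDerivEq 0 1 W D (fun x => F x - s ^ 2 * W x) := by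
    refine ⟨fun x hx => ?_, hDa, ?_⟩
    · have : Fact (x ∈ Icc (0 : ℝ) 1) := ⟨hx⟩
      have hDi : IntervalIntegrable D volume 0 x :=
        intervalIntegrable_of_mem (hDa.continuousOn.intervalIntegrable) hx
      have h := intervalIntegral.integral_hasDerivWithinAt_right (s := Icc (0 : ℝ) 1)
        (t := Icc (0 : ℝ) 1) hDi (hDc.stronglyMeasurableAtFilter_nhdsWithin measurableSet_Icc x)
        (hDc x hx)
      exact h.congr hWint (hWint x hx)
    · rw [ae_restrict_iff' measurableSet_Ioo]
      filter_upwards [hDae] with x hx hxm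
      exact hx (by rw [uIcc_of_le zero_le_one]; exact Ioo_subset_Icc_self hxm)
  refine hWD.congr (fun x hx => by rw [hW x hx, hWd]) fun x hx => ?_
  rw [hW x (Ioo_subset_Icc_self hx), hWd]

theorem solvesTransmission_volterra {s : ℝ} (hs : s ≠ 0) {F : ℝ → ℝ}
    (hF : IntervalIntegrable F volume 0 1) (h1 : volterra s F 1 = 0) :
    SolvesTransmission (fun x => F x - s ^ 2 * volterra s F x)
      (fun x => F x - s ^ 2 * volterra s F x) 0 0 (volterra s F) (volterra s F) := by
  obtain ⟨D, hD0, hD⟩ := secondDerivEq_volterra hs hF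
  exact ⟨D, D, hD.mono le_rfl (by norm_num) (by norm_num),
    hD.mono (by norm_num) (by norm_num) le_rfl, by simp [volterra], h1, hD0, sub_self _, sub_self _⟩

theorem continuousOn_volterra {s : ℝ} (hs : s ≠ 0) {F : ℝ → ℝ}
    (hF : IntervalIntegrable F volume 0 1) : ContinuousOn (volterra s F) (Icc 0 1) := by
  obtain ⟨D, -, hD⟩ := secondDerivEq_volterra hs hF
  exact hD.continuousOn

/-! ### The FD-method in integral form: equivalence and existence -/

section FDSequence

variable {q N : ℝ → ℝ} {lam : ℕ → ℝ} {u : ℕ → ℝ → ℝ}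

theorem fdRhs_eq (q N : ℝ → ℝ) (lam : ℕ → ℝ) (u : ℕ → ℝ → ℝ) (j : ℕ) (x : ℝ) :
    fdRhs q N lam u j x = fdSource q N lam u j x - lam (j + 1) * u 0 x := by
  have hI : Finset.range (j + 1) = insert 0 (Finset.Icc 1 j) := by
    ext k
    simp only [Finset.mem_range, Finset.mem_insert, Finset.mem_Icc]
    omega
  unfold fdRhs fdSource
  rw [hI, Finset.sum_insert (by simp), Nat.sub_zero]
  ring

theorem fdSource_congr {lam' : ℕ → ℝ} {u' : ℕ → ℝ → ℝ} {j : ℕ} {x : ℝ}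
    (hl : ∀ k, 1 ≤ k → k ≤ j → lam k = lam' k) (hu : ∀ k ≤ j, u k x = u' k x) :
    fdSource q N lam u j x = fdSource q N lam' u' j x := by
  unfold fdSource
  rw [adomian_congr N (w := fun k => u' k x) hu, hu j le_rfl]
  congr 3
  refine Finset.sum_congr rfl fun p hp => ?_
  have := Finset.mem_Icc.mp hp
  rw [hl _ (by omega) (by omega), hu p this.2]

theorem fdRhs_congr {lam' : ℕ → ℝ} {u' : ℕ → ℝ → ℝ} {j : ℕ} {x : ℝ}
    (hl : ∀ k, 1 ≤ k → k ≤ j + 1 → lam k = lam' k) (hu : ∀ k ≤ j, u k x = u' k x) :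
    fdRhs q N lam u j x = fdRhs q N lam' u' j x := by
  rw [fdRhs_eq, fdRhs_eq, fdSource_congr (fun k h1 h2 => hl k h1 (by omega)) hu,
    hl _ (by omega) le_rfl, hu 0 (Nat.zero_le j)]

theorem continuousOn_adomian (hN : ContDiff ℝ ∞ N) {s : Set ℝ} {j : ℕ}
    (hu : ∀ k ≤ j, ContinuousOn (u k) s) : ContinuousOn (fun x => adomian N (fun k => u k x) j) s := by
  unfold adomian
  refine continuousOn_finsetSum _ fun α _ => ContinuousOn.mul ?_ ?_
  · exact (hN.continuous_iteratedDeriv _ (mod_cast le_top)).comp_continuousOn (hu 0 (Nat.zero_le j))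
  · refine continuousOn_finsetProd _ fun k hk => ContinuousOn.div_const (ContinuousOn.pow ?_ _) _
    exact hu _ (Finset.mem_range.mp hk)

theorem intervalIntegrable_fdSource {a b : ℝ} (hab : a ≤ b) (hq : IntervalIntegrable q volume a b)
    (hN : ContDiff ℝ ∞ N) {j : ℕ} (hu : ∀ k ≤ j, ContinuousOn (u k) (Icc a b)) :
    IntervalIntegrable (fdSource q N lam u j) volume a b := by
  have hu' : ∀ k ≤ j, ContinuousOn (u k) (uIcc a b) := by rwa [uIcc_of_le hab]
  unfold fdSource
  refine ((ContinuousOn.intervalIntegrable ?_).add (hq.mul_continuousOn (hu' j le_rfl))).add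
    (continuousOn_adomian hN hu').intervalIntegrable
  refine (continuousOn_finsetSum _ fun p hp => ?_).neg
  exact continuousOn_const.mul (hu' p (Finset.mem_Icc.mp hp).2)

theorem intervalIntegrable_fdRhs {a b : ℝ} (hab : a ≤ b) (hq : IntervalIntegrable q volume a b)
    (hN : ContDiff ℝ ∞ N) {j : ℕ} (hu : ∀ k ≤ j, ContinuousOn (u k) (Icc a b)) :
    IntervalIntegrable (fdRhs q N lam u j) volume a b := by
  have h : fdRhs q N lam u j = fun x => fdSource q N lam u j x - lam (j + 1) * u 0 x :=
    funext fun x => fdRhs_eq q N lam u j x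
  rw [h]
  refine (intervalIntegrable_fdSource hab hq hN hu).sub (ContinuousOn.intervalIntegrable ?_)
  rw [uIcc_of_le hab]
  exact continuousOn_const.mul (hu 0 (Nat.zero_le j))

theorem fdSource_glue (q N : ℝ → ℝ) (lam : ℕ → ℝ) (u₁ u₂ : ℕ → ℝ → ℝ) (j : ℕ) (x : ℝ) :
    fdSource q N lam (fun k => glue (u₁ k) (u₂ k)) j x =
      glue (fdSource q N lam u₁ j) (fdSource q N lam u₂ j) x := by
  rcases le_or_gt x (1 / 2) with h | h
  · rw [glue_of_le h]
    exact fdSource_congr (fun _ _ _ => rfl) fun k _ => glue_of_le h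
  · rw [glue_of_gt h]
    exact fdSource_congr (fun _ _ _ => rfl) fun k _ => glue_of_gt h

theorem fdRhs_glue (q N : ℝ → ℝ) (lam : ℕ → ℝ) (u₁ u₂ : ℕ → ℝ → ℝ) (j : ℕ) (x : ℝ) :
    fdRhs q N lam (fun k => glue (u₁ k) (u₂ k)) j x =
      glue (fdRhs q N lam u₁ j) (fdRhs q N lam u₂ j) x := by
  rcases le_or_gt x (1 / 2) with h | h
  · rw [glue_of_le h]
    exact fdRhs_congr (fun _ _ _ => rfl) fun k _ => glue_of_le h
  · rw [glue_of_gt h]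
    exact fdRhs_congr (fun _ _ _ => rfl) fun k _ => glue_of_gt h

/-- The FD-method in integral form on the whole of `[0, 1]`. -/
structure IsVolterraFD (q N : ℝ → ℝ) (s : ℝ) (f₀ : ℝ → ℝ) (lam : ℕ → ℝ) (u : ℕ → ℝ → ℝ) : Prop where
  lam_zero : lam 0 = s ^ 2
  zero_eq : ∀ x ∈ Icc (0 : ℝ) 1, u 0 x = f₀ x
  continuousOn : ∀ j, ContinuousOn (u j) (Icc 0 1)
  succ_eq : ∀ j, ∀ x ∈ Icc (0 : ℝ) 1, u (j + 1) x = volterra s (fdRhs q N lam u j) x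
  boundary : ∀ j, volterra s (fdRhs q N lam u j) 1 = 0

theorem intervalIntegrable_left {f : ℝ → ℝ} (h : IntervalIntegrable f volume 0 1) :
    IntervalIntegrable f volume 0 (1 / 2) :=
  intervalIntegrable_of_mem h (by norm_num)

theorem intervalIntegrable_right {f : ℝ → ℝ} (h : IntervalIntegrable f volume 0 1) :
    IntervalIntegrable f volume (1 / 2) 1 := by
  refine h.mono_set ?_
  rw [uIcc_of_le (by norm_num), uIcc_of_le zero_le_one]
  exact Icc_subset_Icc_left (by norm_num)

theorem IsFDSequence.continuousOn {lam₀ : ℝ} {f₁ f₂ : ℝ → ℝ} {u₁ u₂ : ℕ → ℝ → ℝ}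
    (h : IsFDSequence q N lam₀ f₁ f₂ lam u₁ u₂) (hf₁ : Continuous f₁) (hf₂ : Continuous f₂)
    (hf : f₁ (1 / 2) = f₂ (1 / 2)) (j : ℕ) :
    ContinuousOn (u₁ j) (Icc 0 (1 / 2)) ∧ ContinuousOn (u₂ j) (Icc (1 / 2) 1) ∧
      u₁ j (1 / 2) = u₂ j (1 / 2) := by
  obtain ⟨-, h1, h2, h3⟩ := h
  rcases j with _ | j
  · refine ⟨hf₁.continuousOn.congr h1, hf₂.continuousOn.congr h2, ?_⟩
    rw [h1 _ (by norm_num), h2 _ (by norm_num), hf]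
  · obtain ⟨d₁, d₂, e1, e2, -, -, -, e6, -⟩ := h3 j
    exact ⟨e1.continuousOn, e2.continuousOn, (sub_eq_zero.mp e6).symm⟩

theorem IsFDSequence.isVolterraFD {s : ℝ} (hs : s ≠ 0) (hq : IntervalIntegrable q volume 0 1)
    (hN : ContDiff ℝ ∞ N) {f₁ f₂ : ℝ → ℝ} {u₁ u₂ : ℕ → ℝ → ℝ}
    (h : IsFDSequence q N (s ^ 2) f₁ f₂ lam u₁ u₂) (hf₁ : Continuous f₁) (hf₂ : Continuous f₂)
    (hf : f₁ (1 / 2) = f₂ (1 / 2)) :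
    IsVolterraFD q N s (glue f₁ f₂) lam (fun j => glue (u₁ j) (u₂ j)) := by
  have hc := h.continuousOn hf₁ hf₂ hf
  obtain ⟨h0, h1, h2, h3⟩ := h
  have hF₁ : ∀ j, IntervalIntegrable (fdRhs q N lam u₁ j) volume 0 (1 / 2) := fun j =>
    intervalIntegrable_fdRhs (by norm_num) (intervalIntegrable_left hq) hN fun k _ => (hc k).1
  have hF₂ : ∀ j, IntervalIntegrable (fdRhs q N lam u₂ j) volume (1 / 2) 1 := fun j =>
    intervalIntegrable_fdRhs (by norm_num) (intervalIntegrable_right hq) hN fun k _ => (hc k).2.1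
  have hg : ∀ j, fdRhs q N lam (fun k => glue (u₁ k) (u₂ k)) j =
      glue (fdRhs q N lam u₁ j) (fdRhs q N lam u₂ j) := fun j => funext (fdRhs_glue q N lam u₁ u₂ j)
  have hstep : ∀ j, ∀ x ∈ Icc (0 : ℝ) 1, glue (u₁ (j + 1)) (u₂ (j + 1)) x =
      volterra s (fdRhs q N lam (fun k => glue (u₁ k) (u₂ k)) j) x := fun j x hx => by
    rw [hg]
    exact (h3 j).glue_eq_volterra hs (hF₁ j) (hF₂ j) hx
  refine ⟨h0, fun x hx => ?_, fun j => continuousOn_glue (hc j).1 (hc j).2.1 (hc j).2.2, hstep,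
    fun j => ?_⟩
  · rcases le_or_gt x (1 / 2) with hle | hgt
    · rw [glue_of_le hle, glue_of_le hle, h1 x ⟨hx.1, hle⟩]
    · rw [glue_of_gt hgt, glue_of_gt hgt, h2 x ⟨hgt.le, hx.2⟩]
  · rw [← hstep j 1 (by norm_num), glue_of_gt (by norm_num)]
    obtain ⟨_, _, _, _, _, h4, _⟩ := h3 j
    exact h4

theorem IsVolterraFD.isFDSequence {s : ℝ} (hs : s ≠ 0) (hq : IntervalIntegrable q volume 0 1)
    (hN : ContDiff ℝ ∞ N) {f₁ f₂ : ℝ → ℝ} (hf : f₁ (1 / 2) = f₂ (1 / 2))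
    (h : IsVolterraFD q N s (glue f₁ f₂) lam u) : IsFDSequence q N (s ^ 2) f₁ f₂ lam u u := by
  refine ⟨h.lam_zero, fun x hx => ?_, fun x hx => ?_, fun j => ?_⟩
  · rw [h.zero_eq x ⟨hx.1, hx.2.trans (by norm_num)⟩, glue_of_le hx.2]
  · rw [h.zero_eq x ⟨le_trans (by norm_num) hx.1, hx.2⟩, glue_of_ge hf hx.1]
  · have hL : Icc (0 : ℝ) (1 / 2) ⊆ Icc 0 1 := Icc_subset_Icc_right (by norm_num)
    have hR : Icc (1 / 2 : ℝ) 1 ⊆ Icc 0 1 := Icc_subset_Icc_left (by norm_num)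
    have hi := intervalIntegrable_fdRhs (lam := lam) (j := j) zero_le_one hq hN
      fun k _ => h.continuousOn k
    refine (solvesTransmission_volterra hs hi (h.boundary j)).congr
      (fun x hx => h.succ_eq j x (hL hx)) (fun x hx => h.succ_eq j x (hR hx))
      (fun x hx => ?_) (fun x hx => ?_)
    · rw [h.succ_eq j x (hL (Ioo_subset_Icc_self hx))]
    · rw [h.succ_eq j x (hR (Ioo_subset_Icc_self hx))]

/-- The history of the FD-method after `j` steps. -/
noncomputable def fdState (q N : ℝ → ℝ) (s : ℝ) (f₀ : ℝ → ℝ) (B : ℝ) :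
    ℕ → (ℕ → ℝ) × (ℕ → ℝ → ℝ)
  | 0 => (fun _ => s ^ 2, fun _ => f₀)
  | j + 1 =>
    -- B stands for `volterra s f₀ 1`; the quotient is the value for which the next correction
    -- vanishes at 1. Entries beyond the current index keep their initial values and are never read.
    (Function.update (fdState q N s f₀ B j).1 (j + 1)
      (volterra s (fdSource q N (fdState q N s f₀ B j).1 (fdState q N s f₀ B j).2 j) 1 / B),
    Function.update (fdState q N s f₀ B j).2 (j + 1)
      (volterra s (fdRhs q N (Function.update (fdState q N s f₀ B j).1 (j + 1)
        (volterra s (fdSource q N (fdState q N s f₀ B j).1 (fdState q N s f₀ B j).2 j) 1 / B))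
        (fdState q N s f₀ B j).2 j)))

theorem fdState_stable (q N : ℝ → ℝ) (s : ℝ) (f₀ : ℝ → ℝ) (B : ℝ) {i j : ℕ} (h : i ≤ j) :
    (fdState q N s f₀ B j).1 i = (fdState q N s f₀ B i).1 i ∧
      (fdState q N s f₀ B j).2 i = (fdState q N s f₀ B i).2 i := by
  induction j, h using Nat.le_induction with
  | base => exact ⟨rfl, rfl⟩
  | succ j hij ih =>
    rw [← ih.1, ← ih.2, fdState]
    exact ⟨Function.update_of_ne (by omega) _ _, Function.update_of_ne (by omega) _ _⟩

theorem volterra_congr {s : ℝ} {F F' : ℝ → ℝ} (h : ∀ t ∈ Icc (0 : ℝ) 1, F t = F' t) {x : ℝ}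
    (hx : x ∈ Icc (0 : ℝ) 1) : volterra s F x = volterra s F' x := by
  refine intervalIntegral.integral_congr fun t ht => ?_
  rw [uIcc_of_le hx.1] at ht
  simp only [h t ⟨ht.1, ht.2.trans hx.2⟩]

/-- λ^{(j+1)} enters the right-hand side only through the multiple -λ^{(j+1)} u^{(0)}. The condition
at x = 1 is therefore one linear equation for it, solvable when the Volterra integral of u^{(0)} at
1 is nonzero. -/
theorem volterra_one_fdRhs {s : ℝ} (hq : IntervalIntegrable q volume 0 1) (hN : ContDiff ℝ ∞ N)
    {j : ℕ} (hu : ∀ k ≤ j, ContinuousOn (u k) (Icc 0 1)) :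
    volterra s (fdRhs q N lam u j) 1 =
      volterra s (fdSource q N lam u j) 1 - lam (j + 1) * volterra s (u 0) 1 := by
  have hk : ContinuousOn (fun t => Real.sin (s * (1 - t)) / s) (uIcc 0 1) :=
    Continuous.continuousOn (by fun_prop)
  have hu0 : IntervalIntegrable (u 0) volume 0 1 := by
    refine ContinuousOn.intervalIntegrable ?_
    rw [uIcc_of_le zero_le_one]
    exact hu 0 (Nat.zero_le j)
  unfold volterra
  rw [← intervalIntegral.integral_const_mul, ← intervalIntegral.integral_sub
    ((intervalIntegrable_fdSource zero_le_one hq hN hu).continuousOn_mul hk)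
    ((hu0.continuousOn_mul hk).const_mul _)]
  refine intervalIntegral.integral_congr fun t _ => ?_
  simp only [fdRhs_eq]
  ring

theorem exists_isVolterraFD {s : ℝ} (hs : s ≠ 0) (hq : IntervalIntegrable q volume 0 1)
    (hN : ContDiff ℝ ∞ N) {f₀ : ℝ → ℝ} (hf₀ : ContinuousOn f₀ (Icc 0 1))
    (hB : volterra s f₀ 1 ≠ 0) : ∃ lam u, IsVolterraFD q N s f₀ lam u := by
  obtain ⟨B, hBdef⟩ : ∃ B, B = volterra s f₀ 1 := ⟨_, rfl⟩
  obtain ⟨lam, hlam⟩ : ∃ lam : ℕ → ℝ, lam = fun j => (fdState q N s f₀ B j).1 j := ⟨_, rfl⟩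
  obtain ⟨u, hu⟩ : ∃ u : ℕ → ℝ → ℝ, u = fun j => (fdState q N s f₀ B j).2 j := ⟨_, rfl⟩
  have hl : ∀ i j, i ≤ j → (fdState q N s f₀ B j).1 i = lam i := fun i j h => by
    rw [hlam]
    exact (fdState_stable q N s f₀ B h).1
  have hu' : ∀ i j, i ≤ j → (fdState q N s f₀ B j).2 i = u i := fun i j h => by
    rw [hu]
    exact (fdState_stable q N s f₀ B h).2
  have hlam_succ : ∀ j, lam (j + 1) = volterra s (fdSource q N lam u j) 1 / B := fun j => by
    rw [← hl (j + 1) (j + 1) le_rfl, fdState]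
    simp only [Function.update_self]
    congr 1
    exact volterra_congr (fun t _ => fdSource_congr (fun k _ hk => hl k j hk)
      fun k hk => congrFun (hu' k j hk) t) (by norm_num)
  have hu_succ : ∀ j, ∀ x ∈ Icc (0 : ℝ) 1, u (j + 1) x = volterra s (fdRhs q N lam u j) x :=
      fun j x hx => by
    rw [← hu' (j + 1) (j + 1) le_rfl, fdState]
    simp only [Function.update_self]
    refine volterra_congr (fun t _ => fdRhs_congr (fun k _ hk => ?_)
      fun k hk => congrFun (hu' k j hk) t) hx
    have := hl k (j + 1) hk
    rw [fdState] at this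
    exact this
  have hu0 : u 0 = f₀ := by
    rw [hu]
    rfl
  have hcont : ∀ j, ContinuousOn (u j) (Icc 0 1) := fun j => by
    induction j using Nat.strong_induction_on with
    | _ j ih =>
      rcases j with _ | j
      · rw [hu0]
        exact hf₀
      · refine (continuousOn_volterra hs (intervalIntegrable_fdRhs (lam := lam) zero_le_one hq hN
          fun k hk => ih k (Nat.lt_succ_of_le hk))).congr (hu_succ j)
  refine ⟨lam, u, ?_, fun x _ => by rw [hu0], hcont, hu_succ, fun j => ?_⟩
  · rw [hlam]
    rfl
  · rw [volterra_one_fdRhs hq hN fun k _ => hcont k, hlam_succ, hu0, ← hBdef,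
      div_mul_cancel₀ _ (hBdef ▸ hB), sub_self]

end FDSequence

/-! ### Domination of the corrections by the majorant sequence -/

/-- The oscillation of the kernel is kept for the constant Y and the trial function, where its mean
gains something; against q, which is only integrable, |sin| ≤ 1 is used. -/
theorem abs_volterra_le {q f₀ F : ℝ → ℝ} {s Y a b L : ℝ} (hs : 0 < s) (ha : 0 ≤ a) (hb : 0 ≤ b)
    (hq : IntervalIntegrable q volume 0 1) (hf₀ : ContinuousOn f₀ (Icc 0 1))
    (hF : ∀ t ∈ Icc (0 : ℝ) 1, |F t| ≤ Y + (|q t| * a + b) + L * |f₀ t|) {x : ℝ}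
    (hx : x ∈ Icc (0 : ℝ) 1) :
    |volterra s F x| ≤ (Y * (∫ t in (0 : ℝ)..x, |Real.sin (s * (x - t))|) +
      ((∫ t in (0 : ℝ)..1, |q t|) * a + b) +
      L * ∫ t in (0 : ℝ)..x, |Real.sin (s * (x - t))| * |f₀ t|) / s := by
  have hsub : uIcc 0 x ⊆ Icc (0 : ℝ) 1 := by
    rw [uIcc_of_le hx.1]
    exact Icc_subset_Icc_right hx.2
  have i1 : IntervalIntegrable (fun t => |Real.sin (s * (x - t))|) volume 0 x :=
    Continuous.intervalIntegrable (by fun_prop) _ _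
  have i2 : IntervalIntegrable (fun t => |q t|) volume 0 x := (intervalIntegrable_of_mem hq hx).abs
  have i3 : IntervalIntegrable (fun t => |Real.sin (s * (x - t))| * |f₀ t|) volume 0 x :=
    ContinuousOn.intervalIntegrable
      ((Continuous.continuousOn (by fun_prop)).mul (hf₀.mono hsub).abs)
  have i4 : IntervalIntegrable (fun t => |q t| * a + b) volume 0 x :=
    (i2.mul_const a).add intervalIntegrable_const
  have hle : |volterra s F x| ≤ ∫ t in (0 : ℝ)..x, (Y * |Real.sin (s * (x - t))| +
      (|q t| * a + b) + L * (|Real.sin (s * (x - t))| * |f₀ t|)) / s := by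
    rw [volterra, ← Real.norm_eq_abs]
    refine intervalIntegral.norm_integral_le_of_norm_le hx.1
      (Filter.Eventually.of_forall fun t ht => ?_)
      ((((i1.const_mul Y).add i4).add (i3.const_mul L)).div_const s)
    have htm : t ∈ Icc (0 : ℝ) 1 := ⟨ht.1.le, ht.2.trans hx.2⟩
    rw [Real.norm_eq_abs, abs_mul, abs_div, abs_of_pos hs, div_mul_eq_mul_div]
    refine div_le_div_of_nonneg_right ?_ hs.le
    have h1 := mul_le_mul_of_nonneg_left (hF t htm) (abs_nonneg (Real.sin (s * (x - t))))
    have h2 : |Real.sin (s * (x - t))| * (|q t| * a + b) ≤ |q t| * a + b :=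
      mul_le_of_le_one_left (by positivity) (Real.abs_sin_le_one _)
    linarith
  refine hle.trans ?_
  rw [intervalIntegral.integral_div, intervalIntegral.integral_add ((i1.const_mul Y).add i4)
    (i3.const_mul L), intervalIntegral.integral_add (i1.const_mul Y) i4,
    intervalIntegral.integral_const_mul, intervalIntegral.integral_const_mul,
    intervalIntegral.integral_add (i2.mul_const a) intervalIntegrable_const,
    intervalIntegral.integral_mul_const, intervalIntegral.integral_const]
  refine div_le_div_of_nonneg_right ?_ hs.le
  have h1 : ∫ t in (0 : ℝ)..x, |q t| ≤ ∫ t in (0 : ℝ)..1, |q t| :=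
    intervalIntegral.integral_mono_interval le_rfl hx.1 hx.2
      (Filter.Eventually.of_forall fun _ => abs_nonneg _) hq.abs
  have h2 := mul_le_mul_of_nonneg_right h1 ha
  have h3 : (x - 0) • b ≤ b := by
    rw [sub_zero, smul_eq_mul]
    exact mul_le_of_le_one_left hb hx.2
  linarith

/-- The constants of a trial function that enter the convergence estimates. -/
structure TrialBounds (s β κ θ η ζ M : ℝ) (f₀ : ℝ → ℝ) : Prop where
  s_pos : 0 < s
  β_pos : 0 < β
  β_le_one : β ≤ 1
  κ_nonneg : 0 ≤ κ
  θ_nonneg : 0 ≤ θ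
  ζ_le_one : ζ ≤ 1
  M_le : M ≤ 8 / 3
  continuousOn : ContinuousOn f₀ (Icc 0 1)
  abs_le : ∀ x ∈ Icc (0 : ℝ) 1, |f₀ x| ≤ M
  abs_volterra : |volterra s f₀ 1| = β / s
  integral_one_le : ∫ t in (0 : ℝ)..1, |Real.sin (s * (1 - t))| ≤ ζ
  integral_le : ∀ x ∈ Icc (0 : ℝ) 1, ∫ t in (0 : ℝ)..x, |Real.sin (s * (x - t))| ≤ η
  integral_mul_le : ∀ x ∈ Icc (0 : ℝ) 1,
    ∫ t in (0 : ℝ)..x, |Real.sin (s * (x - t))| * |f₀ t| ≤ θ * β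
  -- What the induction consumes: the first inequality serves the convolution, the second the terms
  -- with q and the Adomian polynomial. The last two serve the first correction, with 8/3 = v̄_0 and
  -- 11/3 = 1 + v̄_0.
  bound_sum : θ * ζ + η ≤ κ * s
  bound_rest : θ + 1 ≤ 11 / 3 * (κ * s)
  bound_first : (θ + 1) * M ≤ 11 / 3 * (κ * s) * (8 / 3 * β)
  bound_lam : M ≤ 11 / 3 * (8 / 3 * β)

section Estimates

variable {q N G : ℝ → ℝ} {s β κ θ η ζ M : ℝ} {f₀ : ℝ → ℝ} {lam : ℕ → ℝ} {u : ℕ → ℝ → ℝ}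

theorem TrialBounds.M_nonneg (hT : TrialBounds s β κ θ η ζ M f₀) : 0 ≤ M :=
  (abs_nonneg _).trans (hT.abs_le 0 (by norm_num))

theorem iteratedDeriv_nonneg_of_dominated
    (hdom : ∀ (k : ℕ) (u : ℝ), |iteratedDeriv k N u| ≤ iteratedDeriv k G |u|) (k : ℕ) (y : ℝ)
    (hy : 0 ≤ y) : 0 ≤ iteratedDeriv k G y := by
  have := (abs_nonneg _).trans (hdom k y)
  rwa [abs_of_nonneg hy] at this

theorem abs_iteratedDeriv_le_of_dominated (hG : ContDiff ℝ ∞ G)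
    (hdom : ∀ (k : ℕ) (u : ℝ), |iteratedDeriv k N u| ≤ iteratedDeriv k G |u|) (k : ℕ) {y m : ℝ}
    (hy : |y| ≤ m) : |iteratedDeriv k N y| ≤ iteratedDeriv k G m :=
  (hdom k y).trans (iteratedDeriv_mono_of_nonneg hG (iteratedDeriv_nonneg_of_dominated hdom) k
    (abs_nonneg y) hy)

/-- The mean value theorem with N(0) = 0. Keeping the factor |y| transfers the smallness of the
trial function to N(u^{(0)}); hence G'(v̄_0) v̄_0 rather than G(v̄_0) in v̄_1. -/
theorem abs_le_deriv_mul_of_dominated (hN : ContDiff ℝ ∞ N) (hN0 : N 0 = 0) (hG : ContDiff ℝ ∞ G)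
    (hdom : ∀ (k : ℕ) (u : ℝ), |iteratedDeriv k N u| ≤ iteratedDeriv k G |u|) {y m : ℝ}
    (hy : |y| ≤ m) : |N y| ≤ deriv G m * |y| := by
  have hd : Differentiable ℝ N := hN.differentiable (by simp)
  have h := (convex_Icc (-m) m).norm_image_sub_le_of_norm_deriv_le (f := N) (C := deriv G m)
    (x := 0) (y := y) (fun z _ => hd z) (fun z hz => by
      have := abs_iteratedDeriv_le_of_dominated hG hdom 1 (abs_le.mpr hz)
      rwa [iteratedDeriv_one, iteratedDeriv_one] at this)
    (abs_le.mp (by rw [abs_zero]; exact (abs_nonneg y).trans hy)) (abs_le.mp hy)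
  simpa [hN0] using h

/-- For j ≥ 1 every term contains some u^{(p)} with p ≥ 1, which provides the factor β; the
eigenvalue corrections carry none. -/
theorem fdSource_abs_le (hG : ContDiff ℝ ∞ G)
    (hdom : ∀ (k : ℕ) (u : ℝ), |iteratedDeriv k N u| ≤ iteratedDeriv k G |u|)
    (hβ : 0 ≤ β) (hβ1 : β ≤ 1) {v : ℕ → ℝ} (hv0 : v 0 = 8 / 3) {j : ℕ} {t : ℝ} (hj : 1 ≤ j)
    (hu0 : |u 0 t| ≤ 8 / 3) (hu : ∀ p, 1 ≤ p → p ≤ j → |u p t| ≤ β * (κ ^ p * v p))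
    (hlam : ∀ p, 1 ≤ p → p ≤ j → |lam p| ≤ κ ^ (p - 1) * v p) :
    |fdSource q N lam u j t| ≤ β * (κ ^ j * ∑ p ∈ Finset.Icc 1 j, v (j + 1 - p) * v p) +
      (|q t| * (β * (κ ^ j * v j)) + β * (κ ^ j * adomian G v j)) := by
  unfold fdSource
  have h1 : |∑ p ∈ Finset.Icc 1 j, lam (j + 1 - p) * u p t| ≤
      β * (κ ^ j * ∑ p ∈ Finset.Icc 1 j, v (j + 1 - p) * v p) := by
    rw [Finset.mul_sum, Finset.mul_sum]
    refine (Finset.abs_sum_le_sum_abs _ _).trans (Finset.sum_le_sum fun p hp => ?_)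
    have hp' := Finset.mem_Icc.mp hp
    have hl := hlam (j + 1 - p) (by omega) (by omega)
    -- The bound for λ^{(p)} has exponent p - 1, so the indices j + 1 - p and p give exactly κ^j.
    have e : κ ^ j = κ ^ (j + 1 - p - 1) * κ ^ p := by
      rw [← pow_add]
      congr 1
      omega
    rw [abs_mul, e]
    refine (mul_le_mul hl (hu p hp'.1 hp'.2) (abs_nonneg _)
      ((abs_nonneg _).trans hl)).trans_eq ?_
    ring
  have h2 : |q t * u j t| ≤ |q t| * (β * (κ ^ j * v j)) := by
    rw [abs_mul]
    exact mul_le_mul_of_nonneg_left (hu j hj le_rfl) (abs_nonneg _)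
  have h3 : |adomian N (fun k => u k t) j| ≤ β * (κ ^ j * adomian G v j) := by
    refine abs_adomian_le hβ hβ1 hj (fun k => ?_) hu
    rw [hv0]
    exact abs_iteratedDeriv_le_of_dominated hG hdom k hu0
  have h4 := abs_add_le (-∑ p ∈ Finset.Icc 1 j, lam (j + 1 - p) * u p t + q t * u j t)
    (adomian N (fun k => u k t) j)
  have h5 := abs_add_le (-∑ p ∈ Finset.Icc 1 j, lam (j + 1 - p) * u p t) (q t * u j t)
  rw [abs_neg] at h5
  linarith

/-- One step of the FD-method in terms of a bound of the source. -/
theorem IsVolterraFD.step_bound (h : IsVolterraFD q N s f₀ lam u)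
    (hT : TrialBounds s β κ θ η ζ M f₀) (hq : IntervalIntegrable q volume 0 1)
    (hN : ContDiff ℝ ∞ N) {j : ℕ} {Y a b : ℝ} (hY : 0 ≤ Y) (ha : 0 ≤ a) (hb : 0 ≤ b)
    (hsrc : ∀ t ∈ Icc (0 : ℝ) 1, |fdSource q N lam u j t| ≤ Y + (|q t| * a + b)) :
    |lam (j + 1)| * β ≤ ζ * Y + ((∫ t in (0 : ℝ)..1, |q t|) * a + b) ∧
      ∀ x ∈ Icc (0 : ℝ) 1, |u (j + 1) x| * s ≤
        (θ * ζ + η) * Y + (θ + 1) * ((∫ t in (0 : ℝ)..1, |q t|) * a + b) := by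
  have hs := hT.s_pos
  obtain ⟨Z, hZ⟩ : ∃ Z, Z = (∫ t in (0 : ℝ)..1, |q t|) * a + b := ⟨_, rfl⟩
  -- The condition at x = 1 equates |λ^{(j+1)}| β/s with the Volterra integral of the source at 1.
  have hl : |lam (j + 1)| * β ≤ ζ * Y + Z := by
    have h1 := abs_volterra_le (F := fdSource q N lam u j) (L := 0) hs ha hb hq hT.continuousOn
      (fun t ht => by simpa using hsrc t ht) (x := 1) (by norm_num)
    have h2 := volterra_one_fdRhs (lam := lam) (s := s) (j := j) hq hN fun k _ => h.continuousOn k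
    rw [h.boundary, eq_comm, sub_eq_zero, volterra_congr h.zero_eq (by norm_num)] at h2
    rw [h2, abs_mul, hT.abs_volterra, mul_div_assoc', div_le_div_iff_of_pos_right hs, ← hZ] at h1
    have h3 := mul_le_mul_of_nonneg_left hT.integral_one_le hY
    linarith
  refine ⟨hZ ▸ hl, fun x hx => ?_⟩
  have h1 := abs_volterra_le (F := fdRhs q N lam u j) (Y := Y) (L := |lam (j + 1)|) hs ha hb hq
    hT.continuousOn (fun t ht => by
      rw [fdRhs_eq, h.zero_eq t ht]
      refine (abs_sub _ _).trans ?_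
      rw [abs_mul]
      linarith [hsrc t ht]) hx
  rw [← h.succ_eq j x hx, le_div_iff₀ hs, ← hZ] at h1
  have h2 := mul_le_mul_of_nonneg_left (hT.integral_le x hx) hY
  have h3 := mul_le_mul_of_nonneg_left (hT.integral_mul_le x hx) (abs_nonneg (lam (j + 1)))
  -- The contribution of λ^{(j+1)} u^{(0)} is at most θ β |λ^{(j+1)}|, so θ times the eigenvalue
  -- estimate is added.
  have h4 := mul_le_mul_of_nonneg_left hl hT.θ_nonneg
  rw [← hZ]
  linarith

/-- The corrections are dominated by the majorant sequence. -/
theorem IsVolterraFD.corrections_le (h : IsVolterraFD q N s f₀ lam u)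
    (hT : TrialBounds s β κ θ η ζ M f₀) (hq : IntervalIntegrable q volume 0 1)
    (hN : ContDiff ℝ ∞ N) (hN0 : N 0 = 0) (hG : ContDiff ℝ ∞ G)
    (hdom : ∀ (k : ℕ) (u : ℝ), |iteratedDeriv k N u| ≤ iteratedDeriv k G |u|) {v : ℕ → ℝ}
    (hv : v = majorantSeq (∫ t in (0 : ℝ)..1, |q t|) G) (j : ℕ) :
    |lam (j + 1)| ≤ κ ^ j * v (j + 1) ∧
      ∀ x ∈ Icc (0 : ℝ) 1, |u (j + 1) x| ≤ β * (κ ^ (j + 1) * v (j + 1)) := by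
  have hpos := iteratedDeriv_nonneg_of_dominated hdom
  obtain ⟨Q, hQdef⟩ : ∃ Q, Q = ∫ t in (0 : ℝ)..1, |q t| := ⟨_, rfl⟩
  rw [← hQdef] at hv
  have hQ : 0 ≤ Q := by
    rw [hQdef]
    exact intervalIntegral.integral_nonneg zero_le_one fun _ _ => abs_nonneg _
  have hvn : ∀ j, 0 ≤ v j := fun j => hv ▸ majorantSeq_nonneg hQ hpos j
  have hv0 : v 0 = 8 / 3 := hv ▸ majorantSeq_zero Q G
  have hs := hT.s_pos
  have hβ := hT.β_pos
  have hκ := hT.κ_nonneg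
  have hu0 : ∀ t ∈ Icc (0 : ℝ) 1, |u 0 t| ≤ M := fun t ht => by
    rw [h.zero_eq t ht]
    exact hT.abs_le t ht
  induction j using Nat.strong_induction_on with
  | _ j ih =>
    rcases j with _ | j
    · have hD : 0 ≤ deriv G (8 / 3) := by
        have := hpos 1 (8 / 3) (by norm_num)
        rwa [iteratedDeriv_one] at this
      -- There is no convolution yet, hence Y = 0, and the trial function is measured by M instead
      -- of by β.
      have hstep := h.step_bound hT hq hN (j := 0) (Y := 0) (a := M) (b := deriv G (8 / 3) * M)
        le_rfl hT.M_nonneg (mul_nonneg hD hT.M_nonneg) fun t ht => by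
          have h1 : fdSource q N lam u 0 t = q t * u 0 t + N (u 0 t) := by
            simp [fdSource, adomian_zero]
          have h2 := abs_le_deriv_mul_of_dominated hN hN0 hG hdom ((hu0 t ht).trans hT.M_le)
          have h3 := mul_le_mul_of_nonneg_left (hu0 t ht) hD
          have h4 := mul_le_mul_of_nonneg_left (hu0 t ht) (abs_nonneg (q t))
          rw [h1]
          refine (abs_add_le _ _).trans ?_
          rw [abs_mul]
          linarith
      rw [← hQdef] at hstep
      have hv1 : v 1 = 11 / 3 * (8 / 3) * (Q + deriv G (8 / 3)) := by
        rw [hv, majorantSeq_one, majorantSeq_zero]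
        ring
      have hQD : 0 ≤ Q + deriv G (8 / 3) := by positivity
      rw [zero_add, hv1]
      constructor
      · rw [pow_zero, one_mul]
        refine le_of_mul_le_mul_right (hstep.1.trans ?_) hβ
        have := mul_le_mul_of_nonneg_right hT.bound_lam hQD
        linarith
      · intro x hx
        refine le_of_mul_le_mul_right ((hstep.2 x hx).trans ?_) hs
        have := mul_le_mul_of_nonneg_right hT.bound_first hQD
        rw [pow_one]
        linarith
    · have hlam : ∀ p, 1 ≤ p → p ≤ j + 1 → |lam p| ≤ κ ^ (p - 1) * v p := fun p h1 h2 => by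
        obtain ⟨i, rfl⟩ : ∃ i, p = i + 1 := ⟨p - 1, by omega⟩
        exact (ih i (by omega)).1
      have hu : ∀ t ∈ Icc (0 : ℝ) 1, ∀ p, 1 ≤ p → p ≤ j + 1 → |u p t| ≤ β * (κ ^ p * v p) :=
          fun t ht p h1 h2 => by
        obtain ⟨i, rfl⟩ : ∃ i, p = i + 1 := ⟨p - 1, by omega⟩
        exact (ih i (by omega)).2 t ht
      have hA : 0 ≤ adomian G v (j + 1) :=
        adomian_nonneg (fun k => hpos k _ (hvn 0)) fun k _ _ => hvn k
      obtain ⟨Sg, hSg⟩ : ∃ Sg, Sg = ∑ p ∈ Finset.Icc 1 (j + 1), v (j + 1 + 1 - p) * v p := ⟨_, rfl⟩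
      have hSg0 : 0 ≤ Sg := by
        rw [hSg]
        exact Finset.sum_nonneg fun p _ => mul_nonneg (hvn _) (hvn _)
      have hκj : 0 ≤ κ ^ (j + 1) := pow_nonneg hκ _
      have hstep := h.step_bound hT hq hN (j := j + 1)
        (mul_nonneg hβ.le (mul_nonneg hκj hSg0))
        (mul_nonneg hβ.le (mul_nonneg hκj (hvn (j + 1))))
        (mul_nonneg hβ.le (mul_nonneg hκj hA)) fun t ht => by
          rw [hSg]
          exact fdSource_abs_le hG hdom hβ.le hT.β_le_one hv0 (by omega)
            ((hu0 t ht).trans hT.M_le) (hu t ht) hlam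
      rw [← hQdef] at hstep
      have hvs : v (j + 1 + 1) = Sg + 11 / 3 * (Q * v (j + 1) + adomian G v (j + 1)) := by
        rw [hSg, hv, majorantSeq_succ Q G (by omega), majorantSeq_zero]
        ring
      have hX : 0 ≤ Q * v (j + 1) + adomian G v (j + 1) :=
        add_nonneg (mul_nonneg hQ (hvn _)) hA
      have hBK : 0 ≤ β * κ ^ (j + 1) := mul_nonneg hβ.le hκj
      rw [hvs]
      constructor
      · refine le_of_mul_le_mul_right (hstep.1.trans ?_) hβ
        have h1 := mul_le_mul_of_nonneg_right hT.ζ_le_one (mul_nonneg hBK hSg0)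
        have h2 := mul_nonneg hBK hX
        nlinarith
      · intro x hx
        refine le_of_mul_le_mul_right ((hstep.2 x hx).trans ?_) hs
        have h1 := mul_le_mul_of_nonneg_right hT.bound_sum (mul_nonneg hBK hSg0)
        have h2 := mul_le_mul_of_nonneg_right hT.bound_rest (mul_nonneg hBK hX)
        rw [pow_succ κ (j + 1)]
        linarith

end Estimates

/-! ### The sum of the corrections solves the nonlinear problem -/

section Limit

variable {q N G : ℝ → ℝ} {s β κ θ η ζ M : ℝ} {f₀ : ℝ → ℝ} {lam : ℕ → ℝ} {u : ℕ → ℝ → ℝ}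

/-- Pointwise summability of the Adomian polynomials along a dominated sequence. -/
theorem hasSum_adomian_of_dominated (hN : ContDiff ℝ ∞ N) (hG : ContDiff ℝ ∞ G)
    (hdom : ∀ (k : ℕ) (u : ℝ), |iteratedDeriv k N u| ≤ iteratedDeriv k G |u|) {w : ℕ → ℝ}
    (hw : Summable fun j => |w j|) : HasSum (adomian N w) (N (∑' j, w j)) := by
  have hpos := iteratedDeriv_nonneg_of_dominated hdom
  obtain ⟨T, hT⟩ : ∃ T, T = ∑' j, |w (j + 1)| := ⟨_, rfl⟩
  have hw1 : Summable fun j => |w (j + 1)| := (summable_nat_add_iff 1).mpr hw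
  have hT0 : 0 ≤ T := hT ▸ tsum_nonneg fun _ => abs_nonneg _
  have hle : |∑' j, w (j + 1)| ≤ T := by
    have h1 : Summable fun j => ‖w (j + 1)‖ := hw1
    have h2 := norm_tsum_le_tsum_norm h1
    rw [hT]
    simpa only [Real.norm_eq_abs] using h2
  have hM : 0 ≤ |w 0| + T := add_nonneg (abs_nonneg _) hT0
  refine (hasSum_adomian hw ?_ ?_).2
  · rw [← hT]
    refine Summable.of_nonneg_of_le (fun k => by positivity) (fun k => ?_)
      (summable_iteratedDeriv_mul_pow hG hpos (abs_nonneg (w 0)) hT0)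
    rw [abs_div, Nat.abs_cast]
    gcongr
    exact hdom k (w 0)
  -- Every point between w_0 and the full sum has modulus at most |w_0| + T, so the derivatives of G
  -- at that one point dominate those of N on the segment.
  · rw [hw.of_abs.tsum_eq_zero_add]
    refine hasSum_taylor hN hG hpos hM fun k y hy => ?_
    refine abs_iteratedDeriv_le_of_dominated hG hdom k ?_
    have h1 := abs_sub_left_of_mem_uIcc hy
    rw [add_sub_cancel_left] at h1
    have h2 := abs_add_le (w 0) (y - w 0)
    rw [add_sub_cancel] at h2
    linarith

/-- The limit of a dominated FD-sequence in integral form. -/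
theorem IsVolterraFD.exists_limit (hs : s ≠ 0) (h : IsVolterraFD q N s f₀ lam u)
    (hq : IntervalIntegrable q volume 0 1) (hN : ContDiff ℝ ∞ N) (hG : ContDiff ℝ ∞ G)
    (hdom : ∀ (k : ℕ) (u : ℝ), |iteratedDeriv k N u| ≤ iteratedDeriv k G |u|)
    {W : ℕ → ℝ} (hW : Summable W) (hW0 : ∀ j, 0 ≤ W j)
    (huW : ∀ j, ∀ x ∈ Icc (0 : ℝ) 1, |u j x| ≤ W j) (hlam : Summable fun j => |lam (j + 1)|) :
    ∃ (lamLim : ℝ) (U F : ℝ → ℝ), HasSum lam lamLim ∧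
      (∀ x ∈ Icc (0 : ℝ) 1, HasSum (fun j => u j x) (U x)) ∧
      IntervalIntegrable F volume 0 1 ∧ volterra s F 1 = 0 ∧
      (∀ x ∈ Icc (0 : ℝ) 1, F x = N (U x) + q x * U x - (lamLim - s ^ 2) * U x) ∧
      ∀ x ∈ Icc (0 : ℝ) 1, U x = f₀ x + volterra s F x := by
  have hpos := iteratedDeriv_nonneg_of_dominated hdom
  have hus : ∀ x ∈ Icc (0 : ℝ) 1, Summable fun j => |u j x| := fun x hx =>
    Summable.of_nonneg_of_le (fun _ => abs_nonneg _) (fun j => huW j x hx) hW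
  obtain ⟨U, hU⟩ : ∃ U : ℝ → ℝ, U = fun x => ∑' j, u j x := ⟨_, rfl⟩
  have hUs : ∀ x ∈ Icc (0 : ℝ) 1, HasSum (fun j => u j x) (U x) := fun x hx => by
    rw [hU]
    exact (hus x hx).of_abs.hasSum
  have hUc : ContinuousOn U (Icc 0 1) := by
    rw [hU]
    exact continuousOn_tsum h.continuousOn hW huW
  obtain ⟨l, hl⟩ : ∃ l, l = ∑' j, lam (j + 1) := ⟨_, rfl⟩
  have hlam0 : HasSum lam (s ^ 2 + l) := by
    have h1 : HasSum (fun j => lam (j + 1)) l := hl ▸ hlam.of_abs.hasSum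
    rw [← hasSum_nat_add_iff' 1]
    simpa [h.lam_zero] using h1
  obtain ⟨F, hF⟩ : ∃ F : ℝ → ℝ, F = fun x => N (U x) + q x * U x - l * U x := ⟨_, rfl⟩
  have hFi : IntervalIntegrable F volume 0 1 := by
    have hUc' : ContinuousOn U (uIcc 0 1) := by rwa [uIcc_of_le zero_le_one]
    rw [hF]
    exact ((hN.continuous.comp_continuousOn hUc').intervalIntegrable.add
      (hq.mul_continuousOn hUc')).sub (continuousOn_const.mul hUc').intervalIntegrable
  have hprod : ∀ x j, ∑ p ∈ Finset.range (j + 1), lam (j + 1 - p) * u p x =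
      ∑ p ∈ Finset.range (j + 1), u p x * lam (j - p + 1) := fun x j => by
    refine Finset.sum_congr rfl fun p hp => ?_
    have := Finset.mem_range.mp hp
    rw [show j + 1 - p = j - p + 1 by omega, mul_comm]
  -- Pointwise summation: the convolution becomes the Cauchy product of ∑ u^{(p)} and ∑ λ^{(i+1)},
  -- and the Adomian polynomials sum to N(U).
  have hpt : ∀ x ∈ Icc (0 : ℝ) 1, HasSum (fun j => fdRhs q N lam u j x) (F x) := fun x hx => by
    have h1 := hasSum_sum_range_mul_of_summable_norm (f := fun p => u p x)
      (g := fun i => lam (i + 1)) (hus x hx) hlam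
    have h2 := hasSum_adomian_of_dominated hN hG hdom (hus x hx)
    have h3 := (h1.neg.add ((hUs x hx).mul_left (q x))).add h2
    have e : F x = -((∑' j, u j x) * ∑' j, lam (j + 1)) + q x * U x + N (∑' j, u j x) := by
      rw [hF, ← hl, (hUs x hx).tsum_eq]
      ring
    rw [e]
    refine h3.congr_fun fun j => ?_
    rw [fdRhs, hprod]
  have hYs := hasSum_sum_range_mul_of_summable_norm (f := W) (g := fun i => |lam (i + 1)|)
    (by simpa only [Real.norm_of_nonneg (hW0 _)] using hW)
    (by simpa only [Real.norm_eq_abs, abs_abs] using hlam)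
  have hAs := hasSum_adomian_of_nonneg hG hpos hW0 hW
  -- The bounds sum over j to a constant plus a multiple of |q|, an integrable majorant for
  -- dominated convergence.
  have hbound : ∀ j, ∀ x ∈ Icc (0 : ℝ) 1, |fdRhs q N lam u j x| ≤
      (∑ p ∈ Finset.range (j + 1), W p * |lam (j - p + 1)|) + |q x| * W j + adomian G W j := by
    intro j x hx
    have h1 : |∑ p ∈ Finset.range (j + 1), u p x * lam (j - p + 1)| ≤
        ∑ p ∈ Finset.range (j + 1), W p * |lam (j - p + 1)| := by
      refine (Finset.abs_sum_le_sum_abs _ _).trans (Finset.sum_le_sum fun p _ => ?_)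
      rw [abs_mul]
      exact mul_le_mul_of_nonneg_right (huW p x hx) (abs_nonneg _)
    have h2 : |q x * u j x| ≤ |q x| * W j := by
      rw [abs_mul]
      exact mul_le_mul_of_nonneg_left (huW j x hx) (abs_nonneg _)
    have hdk : ∀ k, |iteratedDeriv k N (u 0 x)| ≤ iteratedDeriv k G (W 0) := fun k =>
      abs_iteratedDeriv_le_of_dominated hG hdom k (huW 0 x hx)
    have h3 : |adomian N (fun k => u k x) j| ≤ adomian G W j := by
      rcases Nat.eq_zero_or_pos j with rfl | hj
      · rw [adomian_zero, adomian_zero]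
        simpa using hdk 0
      · have := abs_adomian_le (β := 1) (κ := 1) (w := W) zero_le_one le_rfl hj hdk
          fun k _ _ => by simpa using huW k x hx
        simpa using this
    rw [fdRhs, hprod]
    refine (abs_add_le _ _).trans (add_le_add ((abs_add_le _ _).trans (add_le_add ?_ h2)) h3)
    rwa [abs_neg]
  have hv : ∀ x ∈ Icc (0 : ℝ) 1,
      HasSum (fun j => volterra s (fdRhs q N lam u j) x) (volterra s F x) := by
    intro x hx
    have hmem : ∀ t, t ∈ uIoc 0 x → t ∈ Icc (0 : ℝ) 1 := fun t ht => by
      rw [uIoc_of_le hx.1] at ht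
      exact ⟨ht.1.le, ht.2.trans hx.2⟩
    have hbs : ∀ t, HasSum (fun j => |s|⁻¹ *
        ((∑ p ∈ Finset.range (j + 1), W p * |lam (j - p + 1)|) + |q t| * W j + adomian G W j))
        (|s|⁻¹ * ((∑' j, W j) * (∑' j, |lam (j + 1)|) + |q t| * (∑' j, W j) + G (∑' j, W j))) :=
      fun t => ((hYs.add (hW.hasSum.mul_left |q t|)).add hAs).mul_left _
    refine intervalIntegral.hasSum_integral_of_dominated_convergence (fun j t => |s|⁻¹ *
        ((∑ p ∈ Finset.range (j + 1), W p * |lam (j - p + 1)|) + |q t| * W j + adomian G W j))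
      (fun j => ?_) (fun j => ?_) ?_ ?_ ?_
    · have hi := intervalIntegrable_fdRhs (lam := lam) (j := j) zero_le_one hq hN
        fun k _ => h.continuousOn k
      have hk : ContinuousOn (fun t => Real.sin (s * (x - t)) / s) (uIcc 0 x) :=
        Continuous.continuousOn (by fun_prop)
      have hki : IntervalIntegrable (fun t => Real.sin (s * (x - t)) / s * fdRhs q N lam u j t)
          volume 0 x := (intervalIntegrable_of_mem hi hx).continuousOn_mul hk
      exact hki.def'.aestronglyMeasurable
    · refine Filter.Eventually.of_forall fun t ht => ?_
      rw [Real.norm_eq_abs, abs_mul, abs_div, div_eq_inv_mul, mul_assoc]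
      refine mul_le_mul_of_nonneg_left ?_ (by positivity)
      exact (mul_le_of_le_one_left (abs_nonneg _) (Real.abs_sin_le_one _)).trans
        (hbound j t (hmem t ht))
    · exact Filter.Eventually.of_forall fun t _ => (hbs t).summable
    · simp only [(hbs _).tsum_eq]
      exact ((intervalIntegrable_const.add ((intervalIntegrable_of_mem hq hx).abs.mul_const _)).add
        intervalIntegrable_const).const_mul _
    · exact Filter.Eventually.of_forall fun t ht => (hpt t (hmem t ht)).mul_left _
  refine ⟨s ^ 2 + l, U, F, hlam0, hUs, hFi, ?_, fun x _ => ?_, fun x hx => ?_⟩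
  · have h1 := hv 1 (by norm_num)
    simp only [h.boundary] at h1
    exact (hasSum_zero.unique h1).symm
  · rw [hF]
    ring
  -- U - u^{(0)} is the sum of the Volterra integrals, hence the Volterra integral of the sum F.
  · have h1 := (hasSum_nat_add_iff' 1).mpr (hUs x hx)
    simp only [Finset.sum_range_one, h.succ_eq _ x hx, h.zero_eq x hx] at h1
    rw [← h1.unique (hv x hx)]
    ring

end Limit

/-- The trial function carries the unit slope at 0 and the unit jump of the derivative at 1/2; the
Volterra part adds homogeneous data and the inhomogeneity. The terms with s² cancel. -/
theorem IsEigensolution.of_integral_equation {q N f₁ f₂ U F : ℝ → ℝ} {s lamLim : ℝ} (hs : s ≠ 0)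
    (hf : f₁ (1 / 2) = f₂ (1 / 2))
    (htrial : SolvesTransmission (fun x => -(s ^ 2 * f₁ x)) (fun x => -(s ^ 2 * f₂ x)) 1 1 f₁ f₂)
    (hFi : IntervalIntegrable F volume 0 1) (hF1 : volterra s F 1 = 0)
    (hF : ∀ x ∈ Icc (0 : ℝ) 1, F x = N (U x) + q x * U x - (lamLim - s ^ 2) * U x)
    (hU : ∀ x ∈ Icc (0 : ℝ) 1, U x = glue f₁ f₂ x + volterra s F x) :
    IsEigensolution q N lamLim U U := by
  have hL : Icc (0 : ℝ) (1 / 2) ⊆ Icc 0 1 := Icc_subset_Icc_right (by norm_num)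
  have hR : Icc (1 / 2 : ℝ) 1 ⊆ Icc 0 1 := Icc_subset_Icc_left (by norm_num)
  have h := htrial.add (solvesTransmission_volterra hs hFi hF1)
  rw [add_zero] at h
  refine h.congr (fun x hx => ?_) (fun x hx => ?_) (fun x hx => ?_) fun x hx => ?_
  · rw [hU x (hL hx), glue_of_le hx.2]
  · rw [hU x (hR hx), glue_of_ge hf hx.1]
  · have hx' := hL (Ioo_subset_Icc_self hx)
    have h1 := hU x hx'
    rw [glue_of_le hx.2.le] at h1
    rw [hF x hx']
    linear_combination (-s ^ 2) * h1
  · have hx' := hR (Ioo_subset_Icc_self hx)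
    have h1 := hU x hx'
    rw [glue_of_gt hx.1] at h1
    rw [hF x hx']
    linear_combination (-s ^ 2) * h1

/-! ### Error estimates from the decay of the majorant -/

section ErrorEstimate

theorem enorm_sub_sum_range_le {f : ℕ → ℝ} {S : ℝ} (h : HasSum f S) (m : ℕ) :
    ‖S - ∑ j ∈ Finset.range (m + 1), f j‖ₑ ≤ ∑' j, ‖f (m + 1 + j)‖ₑ := by
  have h1 := (hasSum_nat_add_iff' (m + 1)).mpr h
  rw [← h1.tsum_eq]
  simp only [add_comm _ (m + 1)]
  by_cases hfin : ∑' j, ‖f (m + 1 + j)‖ₑ = ⊤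
  · rw [hfin]
    exact le_top
  · exact enorm_tsum_le_tsum_enorm

/-- In the tail the polynomial factor is largest at its first index, and the remaining geometric
series yields 1/(1 - r). The exponent i is m + 1 for the functions and m for the eigenvalues. -/
theorem tsum_ofReal_tail_le {B c ε r : ℝ} (hB : 0 ≤ B) (hc : 0 ≤ c) (hε : 0 ≤ ε) (hr : 0 ≤ r)
    (hr1 : r < 1) (m i : ℕ) :
    ∑' j : ℕ, ENNReal.ofReal (B * (r ^ (i + j) * (c / ((m + 1 + j : ℕ) : ℝ) ^ (1 + ε)))) ≤
      ENNReal.ofReal (B * (c / (1 - r)) / ((m : ℝ) + 1) ^ (1 + ε) * r ^ i) := by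
  have hm : (0 : ℝ) < (m : ℝ) + 1 := by positivity
  have hgeo := (hasSum_geometric_of_lt_one hr hr1).mul_left
    (B * c / ((m : ℝ) + 1) ^ (1 + ε) * r ^ i)
  have hpos : 0 < ((m : ℝ) + 1) ^ (1 + ε) := Real.rpow_pos_of_pos hm _
  calc _ ≤ ∑' j : ℕ, ENNReal.ofReal (B * c / ((m : ℝ) + 1) ^ (1 + ε) * r ^ i * r ^ j) := by
        refine ENNReal.tsum_le_tsum fun j => ENNReal.ofReal_le_ofReal ?_
        have h1 : ((m : ℝ) + 1) ^ (1 + ε) ≤ ((m + 1 + j : ℕ) : ℝ) ^ (1 + ε) := by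
          refine Real.rpow_le_rpow hm.le ?_ (by linarith)
          push_cast
          linarith [(Nat.cast_nonneg j : (0 : ℝ) ≤ j)]
        have h2 : c / ((m + 1 + j : ℕ) : ℝ) ^ (1 + ε) ≤ c / ((m : ℝ) + 1) ^ (1 + ε) :=
          div_le_div_of_nonneg_left hc hpos h1
        have h3 := mul_le_mul_of_nonneg_left h2 (mul_nonneg hB (pow_nonneg hr (i + j)))
        rw [pow_add] at h3 ⊢
        calc _ = B * (r ^ i * r ^ j) * (c / ((m + 1 + j : ℕ) : ℝ) ^ (1 + ε)) := by ring
          _ ≤ _ := h3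
          _ = _ := by ring
    _ = ENNReal.ofReal (∑' j : ℕ, B * c / ((m : ℝ) + 1) ^ (1 + ε) * r ^ i * r ^ j) :=
        (ENNReal.ofReal_tsum_of_nonneg (fun j => by positivity) hgeo.summable).symm
    _ ≤ _ := by
        rw [hgeo.tsum_eq]
        refine ENNReal.ofReal_le_ofReal (le_of_eq ?_)
        have : (1 - r) ≠ 0 := by linarith
        field_simp

theorem pairNorm_le_ofReal {f₁ f₂ : ℝ → ℝ} {B : ℝ} (h₁ : ∀ x ∈ Icc (0 : ℝ) (1 / 2), |f₁ x| ≤ B)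
    (h₂ : ∀ x ∈ Icc (1 / 2 : ℝ) 1, |f₂ x| ≤ B) : pairNorm f₁ f₂ ≤ ENNReal.ofReal B := by
  refine max_le (iSup₂_le fun x hx => ?_) (iSup₂_le fun x hx => ?_)
  · rw [Real.enorm_eq_ofReal_abs]
    exact ENNReal.ofReal_le_ofReal (h₁ x hx)
  · rw [Real.enorm_eq_ofReal_abs]
    exact ENNReal.ofReal_le_ofReal (h₂ x hx)

theorem enorm_le_pairNorm_left (f₁ f₂ : ℝ → ℝ) {x : ℝ} (hx : x ∈ Icc (0 : ℝ) (1 / 2)) :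
    ‖f₁ x‖ₑ ≤ pairNorm f₁ f₂ :=
  le_max_of_le_left (le_iSup₂ (f := fun x (_ : x ∈ Icc (0 : ℝ) (1 / 2)) => ‖f₁ x‖ₑ) x hx)

theorem enorm_le_pairNorm_right (f₁ f₂ : ℝ → ℝ) {x : ℝ} (hx : x ∈ Icc (1 / 2 : ℝ) 1) :
    ‖f₂ x‖ₑ ≤ pairNorm f₁ f₂ :=
  le_max_of_le_right (le_iSup₂ (f := fun x (_ : x ∈ Icc (1 / 2 : ℝ) 1) => ‖f₂ x‖ₑ) x hx)

theorem fdErrorEstimate_of_bounds {lam v : ℕ → ℝ} {u₁ u₂ : ℕ → ℝ → ℝ} {lamLim : ℝ}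
    {U₁ U₂ : ℝ → ℝ} {c ε β κ r S : ℝ} (hc : 0 ≤ c) (hε : 0 ≤ ε) (hβ : 0 ≤ β) (hr : 0 ≤ r)
    (hr1 : r < 1) (hS : 0 ≤ S) (hlim : HasSum lam lamLim)
    (hU₁ : ∀ x ∈ Icc (0 : ℝ) (1 / 2), HasSum (fun j => u₁ j x) (U₁ x))
    (hU₂ : ∀ x ∈ Icc (1 / 2 : ℝ) 1, HasSum (fun j => u₂ j x) (U₂ x))
    (hlam : ∀ j, |lam (j + 1)| ≤ κ ^ j * v (j + 1))
    (hu₁ : ∀ j, ∀ x ∈ Icc (0 : ℝ) (1 / 2), |u₁ (j + 1) x| ≤ β * (κ ^ (j + 1) * v (j + 1)))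
    (hu₂ : ∀ j, ∀ x ∈ Icc (1 / 2 : ℝ) 1, |u₂ (j + 1) x| ≤ β * (κ ^ (j + 1) * v (j + 1)))
    (hdec : ∀ j : ℕ, κ ^ (j + 1) * v (j + 1) ≤ r ^ (j + 1) * (c / ((j + 1 : ℕ) : ℝ) ^ (1 + ε)))
    (hdecl : ∀ j : ℕ, κ ^ j * v (j + 1) ≤ S * (r ^ j * (c / ((j + 1 : ℕ) : ℝ) ^ (1 + ε)))) :
    FDErrorEstimate (c / (1 - r)) ε β r S lam u₁ u₂ lamLim U₁ U₂ := by
  refine ⟨hlim, hU₁, hU₂, fun m => ⟨?_, ?_, enorm_sub_sum_range_le hlim m, ?_⟩⟩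
  · refine max_le (iSup₂_le fun x hx => ?_) (iSup₂_le fun x hx => ?_)
    · refine (enorm_sub_sum_range_le (hU₁ x hx) m).trans (ENNReal.tsum_le_tsum fun j => ?_)
      exact enorm_le_pairNorm_left (u₁ (m + 1 + j)) (u₂ (m + 1 + j)) hx
    · refine (enorm_sub_sum_range_le (hU₂ x hx) m).trans (ENNReal.tsum_le_tsum fun j => ?_)
      exact enorm_le_pairNorm_right (u₁ (m + 1 + j)) (u₂ (m + 1 + j)) hx
  · refine le_trans (ENNReal.tsum_le_tsum fun j => ?_)
      (tsum_ofReal_tail_le hβ hc hε hr hr1 m (m + 1))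
    have e : m + 1 + j = m + j + 1 := by omega
    rw [e]
    have hb := mul_le_mul_of_nonneg_left (hdec (m + j)) hβ
    exact pairNorm_le_ofReal (fun x hx => (hu₁ (m + j) x hx).trans hb)
      fun x hx => (hu₂ (m + j) x hx).trans hb
  · rw [mul_comm (c / (1 - r)) S]
    refine le_trans (ENNReal.tsum_le_tsum fun j => ?_)
      (tsum_ofReal_tail_le hS hc hε hr hr1 m m)
    have e : m + 1 + j = m + j + 1 := by omega
    rw [e, Real.enorm_eq_ofReal_abs]
    exact ENNReal.ofReal_le_ofReal ((hlam (m + j)).trans (hdecl (m + j)))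

/-- For finite R, κ^j is written as (κ/R)^j R^j; the eigenvalue bound has one power of κ less and
keeps a factor 1/R. For R = ∞ the hypothesis forces v_{j+1} = 0. -/
theorem decay_of_radius_bound {R : ℝ≥0∞} (hR : 0 < R) {v : ℕ → ℝ} (hv : ∀ j, 0 ≤ v j)
    {c ε κ : ℝ} (hc : 0 ≤ c) (hκ : 0 ≤ κ)
    (h : ∀ j : ℕ, 1 ≤ j → R ^ j * ENNReal.ofReal (v j) ≤ ENNReal.ofReal (c / (j : ℝ) ^ (1 + ε)))
    (j : ℕ) :
    κ ^ (j + 1) * v (j + 1) ≤ (ENNReal.ofReal κ / R).toReal ^ (j + 1) *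
        (c / ((j + 1 : ℕ) : ℝ) ^ (1 + ε)) ∧
      κ ^ j * v (j + 1) ≤ R⁻¹.toReal * ((ENNReal.ofReal κ / R).toReal ^ j *
        (c / ((j + 1 : ℕ) : ℝ) ^ (1 + ε))) := by
  have hj := h (j + 1) (by omega)
  have hcj : 0 ≤ c / ((j + 1 : ℕ) : ℝ) ^ (1 + ε) :=
    div_nonneg hc (Real.rpow_nonneg (Nat.cast_nonneg _) _)
  by_cases htop : R = ⊤
  · have hv0 : v (j + 1) = 0 := by
      by_contra hne
      have hpos : ENNReal.ofReal (v (j + 1)) ≠ 0 := by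
        rw [Ne, ENNReal.ofReal_eq_zero, not_le]
        exact lt_of_le_of_ne (hv _) (Ne.symm hne)
      rw [htop, ENNReal.top_pow (by omega), ENNReal.top_mul hpos, top_le_iff] at hj
      exact ENNReal.ofReal_ne_top hj
    rw [hv0, mul_zero, mul_zero]
    constructor <;> positivity
  · obtain ⟨ρ, hρ⟩ : ∃ ρ, ρ = R.toReal := ⟨_, rfl⟩
    have hρ0 : 0 < ρ := hρ ▸ ENNReal.toReal_pos hR.ne' htop
    have hRρ : R = ENNReal.ofReal ρ := by rw [hρ, ENNReal.ofReal_toReal htop]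
    rw [hRρ, ← ENNReal.ofReal_pow hρ0.le, ← ENNReal.ofReal_mul (pow_nonneg hρ0.le _),
      ENNReal.ofReal_le_ofReal_iff hcj] at hj
    have e1 : (ENNReal.ofReal κ / R).toReal = κ / ρ := by
      rw [hRρ, ENNReal.toReal_div, ENNReal.toReal_ofReal hκ, ENNReal.toReal_ofReal hρ0.le]
    have e2 : R⁻¹.toReal = ρ⁻¹ := by rw [ENNReal.toReal_inv, hρ]
    rw [e1, e2]
    have hr : 0 ≤ κ / ρ := div_nonneg hκ hρ0.le
    constructor
    · calc _ = (κ / ρ) ^ (j + 1) * (ρ ^ (j + 1) * v (j + 1)) := by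
            rw [div_pow]; field_simp
        _ ≤ _ := mul_le_mul_of_nonneg_left hj (pow_nonneg hr _)
    · calc _ = ρ⁻¹ * ((κ / ρ) ^ j * (ρ ^ (j + 1) * v (j + 1))) := by
            rw [div_pow, pow_succ ρ]; field_simp
        _ ≤ _ := mul_le_mul_of_nonneg_left (mul_le_mul_of_nonneg_left hj (pow_nonneg hr _))
            (inv_nonneg.mpr hρ0.le)

end ErrorEstimate

/-! ### Convergence for a trial pair with given bounds -/

section Convergence

variable {q N G : ℝ → ℝ}

theorem integral_Ioo_eq_intervalIntegral (f : ℝ → ℝ) :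
    ∫ x in Ioo (0 : ℝ) 1, f x = ∫ x in (0 : ℝ)..1, f x := by
  rw [intervalIntegral.integral_of_le zero_le_one, integral_Ioc_eq_integral_Ioo]

/-- The solvability condition of the FD-method. -/
theorem IsFDSequence.lam_succ {lam : ℕ → ℝ} {s γ σ : ℝ} (hs : s ≠ 0)
    (hq : IntervalIntegrable q volume 0 1) (hN : ContDiff ℝ ∞ N) {f₁ f₂ ψ : ℝ → ℝ}
    {u₁ u₂ : ℕ → ℝ → ℝ} (h : IsFDSequence q N (s ^ 2) f₁ f₂ lam u₁ u₂) (hf₁ : Continuous f₁)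
    (hf₂ : Continuous f₂) (hf : f₁ (1 / 2) = f₂ (1 / 2))
    (hψ : ∀ t, ψ t = σ * Real.sin (s * (1 - t)))
    (hγ : γ * (σ * (s * volterra s (glue f₁ f₂) 1)) = 1) (j : ℕ) :
    lam (j + 1) = γ * ((∫ x in (0 : ℝ)..(1 / 2), fdSource q N lam u₁ j x * ψ x) +
      ∫ x in (1 / 2 : ℝ)..1, fdSource q N lam u₂ j x * ψ x) := by
  have hV := h.isVolterraFD hs hq hN hf₁ hf₂ hf
  have hc := h.continuousOn hf₁ hf₂ hf
  have hψc : Continuous ψ := by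
    rw [funext hψ]
    fun_prop
  have h1 := hV.boundary j
  rw [volterra_one_fdRhs hq hN fun k _ => hV.continuousOn k, sub_eq_zero,
    volterra_congr hV.zero_eq (by norm_num)] at h1
  have i₁ : IntervalIntegrable (fun x => fdSource q N lam u₁ j x * ψ x) volume 0 (1 / 2) :=
    (intervalIntegrable_fdSource (by norm_num) (intervalIntegrable_left hq) hN
      fun k _ => (hc k).1).mul_continuousOn hψc.continuousOn
  have i₂ : IntervalIntegrable (fun x => fdSource q N lam u₂ j x * ψ x) volume (1 / 2) 1 :=
    (intervalIntegrable_fdSource (by norm_num) (intervalIntegrable_right hq) hN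
      fun k _ => (hc k).2.1).mul_continuousOn hψc.continuousOn
  rw [← (integral_glue i₁ i₂).2]
  -- Up to the constant σ s, ψ is the Volterra kernel at x = 1, so the boundary condition becomes an
  -- integral against ψ.
  have h2 : ∫ x in (0 : ℝ)..1, glue (fun x => fdSource q N lam u₁ j x * ψ x)
      (fun x => fdSource q N lam u₂ j x * ψ x) x =
      σ * s * volterra s (fdSource q N lam (fun k => glue (u₁ k) (u₂ k)) j) 1 := by
    unfold volterra
    rw [← intervalIntegral.integral_const_mul]
    refine intervalIntegral.integral_congr fun x _ => ?_
    rw [fdSource_glue]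
    unfold glue
    split_ifs <;> simp only [hψ] <;> field_simp
  rw [h2, h1]
  linear_combination (-lam (j + 1)) * hγ

/-- Common to both cases. The hypothesis on γ says that 1/γ is the integral of the glued trial
function against ψ. -/
theorem fdConverges_of_trialBounds {s γ σ β κ θ η ζ M c ε : ℝ} {f₁ f₂ ψ : ℝ → ℝ}
    (hT : TrialBounds s β κ θ η ζ M (glue f₁ f₂)) (hf₁ : Continuous f₁) (hf₂ : Continuous f₂)
    (hf : f₁ (1 / 2) = f₂ (1 / 2)) (hψ : ∀ t, ψ t = σ * Real.sin (s * (1 - t)))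
    (hγ : γ * (σ * (s * volterra s (glue f₁ f₂) 1)) = 1)
    (htrial : SolvesTransmission (fun x => -(s ^ 2 * f₁ x)) (fun x => -(s ^ 2 * f₂ x)) 1 1 f₁ f₂)
    (hq : IntegrableOn q (Ioo 0 1)) (hN : ContDiff ℝ ∞ N) (hN0 : N 0 = 0) (hG : ContDiff ℝ ∞ G)
    (hdom : ∀ (k : ℕ) (u : ℝ), |iteratedDeriv k N u| ≤ iteratedDeriv k G |u|)
    (hc : 0 < c) (hε : 0 < ε)
    (hv : ∀ j : ℕ, 1 ≤ j → majorantRadius (∫ x in Ioo (0 : ℝ) 1, |q x|) G ^ j *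
      ENNReal.ofReal (majorantSeq (∫ x in Ioo (0 : ℝ) 1, |q x|) G j) ≤
        ENNReal.ofReal (c / (j : ℝ) ^ (1 + ε))) :
    FDConverges q N G (s ^ 2) f₁ f₂ γ ψ κ β c ε := by
  have hs : s ≠ 0 := hT.s_pos.ne'
  have hqi : IntervalIntegrable q volume 0 1 := by
    rwa [intervalIntegrable_iff_integrableOn_Ioo_of_le zero_le_one]
  have hpos := iteratedDeriv_nonneg_of_dominated hdom
  have hQ : 0 ≤ ∫ x in Ioo (0 : ℝ) 1, |q x| := integral_nonneg fun _ => abs_nonneg _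
  have hB : volterra s (glue f₁ f₂) 1 ≠ 0 := fun h0 => by
    have := hT.abs_volterra
    rw [h0, abs_zero] at this
    exact (div_pos hT.β_pos hT.s_pos).ne this
  unfold FDConverges
  simp only
  refine ⟨?_, fun lam u₁ u₂ h => ⟨h.lam_succ hs hqi hN hf₁ hf₂ hf hψ hγ, fun hr => ?_⟩⟩
  · obtain ⟨lam, u, h⟩ := exists_isVolterraFD hs hqi hN hT.continuousOn hB
    exact ⟨lam, u, u, h.isFDSequence hs hqi hN hf⟩
  · have hV := h.isVolterraFD hs hqi hN hf₁ hf₂ hf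
    have hcont := h.continuousOn hf₁ hf₂ hf
    obtain ⟨v, hvdef⟩ : ∃ v, v = majorantSeq (∫ x in Ioo (0 : ℝ) 1, |q x|) G := ⟨_, rfl⟩
    obtain ⟨r, hrdef⟩ : ∃ r, r = (fdRatio (∫ x in Ioo (0 : ℝ) 1, |q x|) G κ).toReal := ⟨_, rfl⟩
    obtain ⟨S, hSdef⟩ : ∃ S, S = (majorantRadius (∫ x in Ioo (0 : ℝ) 1, |q x|) G)⁻¹.toReal :=
      ⟨_, rfl⟩
    have hr0 : 0 ≤ r := hrdef ▸ ENNReal.toReal_nonneg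
    have hS0 : 0 ≤ S := hSdef ▸ ENNReal.toReal_nonneg
    have hr1 : r < 1 := by
      rw [hrdef, ← ENNReal.toReal_one]
      exact (ENNReal.toReal_lt_toReal hr.ne_top ENNReal.one_ne_top).mpr hr
    have hv0 : ∀ j, 0 ≤ v j := fun j => hvdef ▸ majorantSeq_nonneg hQ hpos j
    have hdec := decay_of_radius_bound (κ := κ) (majorantRadius_pos hQ hG hpos)
      (majorantSeq_nonneg hQ hpos) hc.le hT.κ_nonneg hv
    rw [← hvdef, ← fdRatio, ← hrdef, ← hSdef] at hdec
    rw [← hrdef, ← hSdef]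
    have hb := hV.corrections_le hT hqi hN hN0 hG hdom (v := v)
      (by rw [hvdef, integral_Ioo_eq_intervalIntegral])
    have hκv : ∀ j, 0 ≤ κ ^ j * v (j + 1) := fun j => mul_nonneg (pow_nonneg hT.κ_nonneg _) (hv0 _)
    have hgeo : Summable fun j => r ^ j * c := (summable_geometric_of_lt_one hr0 hr1).mul_right c
    have hrpow : ∀ j : ℕ, c / ((j + 1 : ℕ) : ℝ) ^ (1 + ε) ≤ c := fun j => by
      refine div_le_self hc.le (Real.one_le_rpow ?_ (by linarith))
      exact_mod_cast Nat.le_add_left 1 j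
    have hsum : Summable fun j => κ ^ j * v (j + 1) := by
      refine Summable.of_nonneg_of_le hκv (fun j => (hdec j).2.trans ?_) (hgeo.mul_left S)
      exact mul_le_mul_of_nonneg_left
        (mul_le_mul_of_nonneg_left (hrpow j) (pow_nonneg hr0 _)) hS0
    have hlam : Summable fun j => |lam (j + 1)| :=
      Summable.of_nonneg_of_le (fun _ => abs_nonneg _) (fun j => (hb j).1) hsum
    -- The summable dominating sequence: M for the trial function, then the bounds of the
    -- corrections.
    obtain ⟨W, hW⟩ : ∃ W : ℕ → ℝ, W = fun j => Nat.casesOn (motive := fun _ => ℝ) j M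
        fun i => β * (κ ^ (i + 1) * v (i + 1)) := ⟨_, rfl⟩
    have hW0 : W 0 = M := congrFun hW 0
    have hW1 : ∀ j, W (j + 1) = β * (κ ^ (j + 1) * v (j + 1)) := fun j => congrFun hW (j + 1)
    have hWs : Summable W := by
      rw [← summable_nat_add_iff 1]
      refine (hsum.mul_left (β * κ)).congr fun j => ?_
      rw [hW1, pow_succ]
      ring
    have hWpos : ∀ j, 0 ≤ W j
      | 0 => hW0 ▸ hT.M_nonneg
      | j + 1 => by
        rw [hW1]
        exact mul_nonneg hT.β_pos.le (mul_nonneg (pow_nonneg hT.κ_nonneg _) (hv0 _))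
    have huW : ∀ j, ∀ x ∈ Icc (0 : ℝ) 1, |glue (u₁ j) (u₂ j) x| ≤ W j
      | 0, x, hx => by
        have h1 := hV.zero_eq x hx
        rw [h1, hW0]
        exact hT.abs_le x hx
      | j + 1, x, hx => by
        rw [hW1]
        exact (hb j).2 x hx
    obtain ⟨lamLim, U, F, hlim, hU, hFi, hF1, hF, hUF⟩ :=
      hV.exists_limit hs hqi hN hG hdom hWs hWpos huW hlam
    have hl : ∀ x ∈ Icc (0 : ℝ) (1 / 2), x ∈ Icc (0 : ℝ) 1 ∧ ∀ j, glue (u₁ j) (u₂ j) x = u₁ j x :=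
      fun x hx => ⟨⟨hx.1, hx.2.trans (by norm_num)⟩, fun j => glue_of_le hx.2⟩
    have hr' : ∀ x ∈ Icc (1 / 2 : ℝ) 1, x ∈ Icc (0 : ℝ) 1 ∧
        ∀ j, glue (u₁ j) (u₂ j) x = u₂ j x :=
      fun x hx => ⟨⟨le_trans (by norm_num) hx.1, hx.2⟩, fun j => glue_of_ge (hcont j).2.2 hx.1⟩
    refine ⟨lamLim, U, U, IsEigensolution.of_integral_equation hs hf htrial hFi hF1 hF hUF,
      fdErrorEstimate_of_bounds (v := v) (κ := κ) hc.le hε.le hT.β_pos.le hr0 hr1 hS0 hlim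
        (fun x hx => ?_) (fun x hx => ?_) (fun j => (hb j).1) (fun j x hx => ?_)
        (fun j x hx => ?_) (fun j => (hdec j).1) fun j => (hdec j).2⟩
    · simpa only [(hl x hx).2] using hU x (hl x hx).1
    · simpa only [(hr' x hx).2] using hU x (hr' x hx).1
    · simpa only [(hl x hx).2] using (hb j).2 x (hl x hx).1
    · simpa only [(hr' x hx).2] using (hb j).2 x (hr' x hx).1

end Convergence

/-! ### Constants of the two families of trial functions -/

section SineIntegrals

variable {s : ℝ}

theorem integral_sin_mul_add_sq (hs : s ≠ 0) (d a b : ℝ) :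
    ∫ t in a..b, Real.sin (s * t + d) ^ 2 =
      (b - a) / 2 - (Real.sin (2 * (s * b + d)) - Real.sin (2 * (s * a + d))) / (4 * s) := by
  have hderiv : ∀ t ∈ uIcc a b, HasDerivAt (fun t => t / 2 - Real.sin (2 * (s * t + d)) / (4 * s))
      (Real.sin (s * t + d) ^ 2) t := fun t _ => by
    have h1 : HasDerivAt (fun t => 2 * (s * t + d)) (2 * (s * 1)) t :=
      (((hasDerivAt_id t).const_mul s).add_const d).const_mul 2
    have h2 := ((hasDerivAt_id t).div_const 2).sub (h1.sin.div_const (4 * s))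
    refine h2.congr_deriv ?_
    rw [Real.cos_two_mul, Real.sin_sq]
    field_simp
    ring
  rw [intervalIntegral.integral_eq_sub_of_hasDerivAt hderiv
    (Continuous.intervalIntegrable (by fun_prop) _ _)]
  ring

theorem integral_sin_mul_sub_sq (hs : s ≠ 0) (x a b : ℝ) :
    ∫ t in a..b, Real.sin (s * (x - t)) ^ 2 =
      (b - a) / 2 - (Real.sin (2 * (s * (x - a))) - Real.sin (2 * (s * (x - b)))) / (4 * s) := by
  have h : ∀ t, Real.sin (s * (x - t)) ^ 2 = Real.sin (s * t + -(s * x)) ^ 2 := fun t => by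
    rw [show s * (x - t) = -(s * t + -(s * x)) by ring, Real.sin_neg, neg_sq]
  simp only [h]
  rw [integral_sin_mul_add_sq hs, show 2 * (s * (x - a)) = -(2 * (s * a + -(s * x))) by ring,
    show 2 * (s * (x - b)) = -(2 * (s * b + -(s * x))) by ring, Real.sin_neg, Real.sin_neg]
  ring

/-- The pointwise inequality 2|fg| ≤ f² + g² takes the place of Cauchy–Schwarz, so only integrals of
squared sines have to be computed. -/
theorem integral_abs_mul_le {f g : ℝ → ℝ} {a b : ℝ} (hab : a ≤ b) (hf : ContinuousOn f (Icc a b))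
    (hg : ContinuousOn g (Icc a b)) :
    ∫ t in a..b, |f t| * |g t| ≤
      ((∫ t in a..b, f t ^ 2) + ∫ t in a..b, g t ^ 2) / 2 := by
  rw [← uIcc_of_le hab] at hf hg
  have i₁ : IntervalIntegrable (fun t => f t ^ 2) volume a b := (hf.pow 2).intervalIntegrable
  have i₂ : IntervalIntegrable (fun t => g t ^ 2) volume a b := (hg.pow 2).intervalIntegrable
  rw [← intervalIntegral.integral_add i₁ i₂, ← intervalIntegral.integral_div]
  refine intervalIntegral.integral_mono_on hab (hf.abs.mul hg.abs).intervalIntegrable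
    ((i₁.add i₂).div_const 2) fun t _ => ?_
  nlinarith [sq_nonneg (|f t| - |g t|), sq_abs (f t), sq_abs (g t)]

/-- The amplitude times a sine function as a solution of the oscillator equation. -/
theorem secondDerivEq_sin (s A d a b : ℝ) :
    SecondDerivEq a b (fun x => A * Real.sin (s * x + d)) (fun x => A * (s * Real.cos (s * x + d)))
      (fun x => -(s ^ 2 * (A * Real.sin (s * x + d)))) := by
  have h : ∀ x : ℝ, HasDerivAt (fun x => s * x + d) s x := fun x => by
    simpa using ((hasDerivAt_id x).const_mul s).add_const d
  refine ⟨fun x _ => ?_, ?_, Filter.Eventually.of_forall fun x => ?_⟩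
  · refine (((h x).sin.const_mul A).congr_deriv ?_).hasDerivWithinAt
    ring
  · exact ContDiffOn.absolutelyContinuousOnInterval (ContDiff.contDiffOn (by fun_prop))
  · refine (((h x).cos.const_mul s).const_mul A).congr_deriv ?_
    ring

end SineIntegrals

theorem integral_mul_abs_glue_le {f₁ f₂ k : ℝ → ℝ} (hf₁ : Continuous f₁) (hf₂ : Continuous f₂)
    (hk : Continuous k) {x : ℝ} (hx : x ∈ Icc (0 : ℝ) 1) :
    ∫ t in (0 : ℝ)..x, |k t| * |glue f₁ f₂ t| ≤
      (∫ t in (0 : ℝ)..(1 / 2), |k t| * |f₁ t|) + ∫ t in (1 / 2 : ℝ)..1, |k t| * |f₂ t| := by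
  have i₁ : IntervalIntegrable (fun t => |k t| * |f₁ t|) volume 0 (1 / 2) :=
    (hk.abs.mul hf₁.abs).intervalIntegrable _ _
  have i₂ : IntervalIntegrable (fun t => |k t| * |f₂ t|) volume (1 / 2) 1 :=
    (hk.abs.mul hf₂.abs).intervalIntegrable _ _
  have e : (fun t => |k t| * |glue f₁ f₂ t|) =
      glue (fun t => |k t| * |f₁ t|) (fun t => |k t| * |f₂ t|) := by
    funext t
    unfold glue
    split_ifs <;> rfl
  obtain ⟨hi, hI⟩ := integral_glue i₁ i₂
  rw [← hI, ← e]
  exact intervalIntegral.integral_mono_interval le_rfl hx.1 hx.2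
    (Filter.Eventually.of_forall fun _ => by positivity) (e ▸ hi)

theorem volterra_glue_one {f₁ f₂ : ℝ → ℝ} (hf₁ : Continuous f₁) (hf₂ : Continuous f₂) (s : ℝ) :
    volterra s (glue f₁ f₂) 1 = (∫ t in (0 : ℝ)..(1 / 2), Real.sin (s * (1 - t)) / s * f₁ t) +
      ∫ t in (1 / 2 : ℝ)..1, Real.sin (s * (1 - t)) / s * f₂ t := by
  rw [← (integral_glue (Continuous.intervalIntegrable (by fun_prop) _ _)
    (Continuous.intervalIntegrable (by fun_prop) _ _)).2, volterra]
  congr 1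
  funext t
  unfold glue
  split_ifs <;> rfl

section PeriodicTrial

/-- The trial functions `sin (s x) / s`, `A sin (s x) / s` for `s ∈ 2πℤ`. -/
theorem trialBounds_periodic {s A : ℝ} {n : ℕ} (hn : 1 ≤ n) (hs : s = 2 * Real.pi * n)
    (hA0 : 0 ≤ A) (hA2 : A ≤ 2) :
    TrialBounds s ((1 + A) / (4 * s)) (2 / s) 1 1 1 ((1 + A) / s)
      (glue (fun x => Real.sin (s * x) / s) (fun x => A / s * Real.sin (s * x))) ∧
    volterra s (glue (fun x => Real.sin (s * x) / s) (fun x => A / s * Real.sin (s * x))) 1 =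
      -((1 + A) / (4 * s) / s) := by
  have hn' : (1 : ℝ) ≤ n := by exact_mod_cast hn
  have hs6 : 6 ≤ s := by
    rw [hs]
    nlinarith [Real.pi_gt_three]
  have hs0 : 0 < s := by linarith
  have hsne : s ≠ 0 := hs0.ne'
  have hhalf : Real.sin (s * (1 / 2)) = 0 := by
    rw [hs, show 2 * Real.pi * n * (1 / 2) = n * Real.pi by ring, Real.sin_nat_mul_pi]
  have hshift : ∀ y, Real.sin (y + s) = Real.sin y := fun y => by
    rw [hs, show 2 * Real.pi * n = n * (2 * Real.pi) by ring, Real.sin_add_nat_mul_two_pi]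
  have hsq₁ : ∫ t in (0 : ℝ)..(1 / 2), Real.sin (s * t) ^ 2 = 1 / 4 := by
    have := integral_sin_mul_add_sq hsne 0 0 (1 / 2)
    simp only [add_zero, mul_zero, Real.sin_zero] at this
    rw [this, show 2 * (s * (1 / 2)) = 0 + s by ring, hshift, Real.sin_zero]
    norm_num
  have hsq₂ : ∫ t in (1 / 2 : ℝ)..1, Real.sin (s * t) ^ 2 = 1 / 4 := by
    have := integral_sin_mul_add_sq hsne 0 (1 / 2) 1
    simp only [add_zero] at this
    rw [this, show 2 * (s * (1 / 2)) = 0 + s by ring, show 2 * (s * 1) = 0 + s + s by ring,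
      hshift, hshift, sub_self, zero_div]
    norm_num
  -- Since s is a multiple of 2π, 1/2 is a period of sin²(s ·); hence the value does not depend on
  -- x.
  have hker₁ : ∀ x, ∫ t in (0 : ℝ)..(1 / 2), Real.sin (s * (x - t)) ^ 2 = 1 / 4 := fun x => by
    rw [integral_sin_mul_sub_sq hsne,
      show 2 * (s * (x - 0)) = 2 * (s * (x - 1 / 2)) + s by ring, hshift, sub_self]
    norm_num
  have hker₂ : ∀ x, ∫ t in (1 / 2 : ℝ)..1, Real.sin (s * (x - t)) ^ 2 = 1 / 4 := fun x => by
    rw [integral_sin_mul_sub_sq hsne,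
      show 2 * (s * (x - 1 / 2)) = 2 * (s * (x - 1)) + s by ring, hshift, sub_self]
    norm_num
  have hc₁ : Continuous fun x => Real.sin (s * x) / s := by fun_prop
  have hc₂ : Continuous fun x => A / s * Real.sin (s * x) := by fun_prop
  have hmatch : (fun x => Real.sin (s * x) / s) (1 / 2) =
      (fun x => A / s * Real.sin (s * x)) (1 / 2) := by
    simp only [hhalf, zero_div, mul_zero]
  have hrefl : ∀ t, Real.sin (s * (1 - t)) = -Real.sin (s * t) := fun t => by
    rw [show s * (1 - t) = -(s * t) + s by ring, hshift, Real.sin_neg]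
  have hvol : volterra s (glue (fun x => Real.sin (s * x) / s)
      (fun x => A / s * Real.sin (s * x))) 1 = -((1 + A) / (4 * s) / s) := by
    have e₁ : ∀ t, Real.sin (s * (1 - t)) / s * (Real.sin (s * t) / s) =
        -(1 / s ^ 2) * Real.sin (s * t) ^ 2 := fun t => by
      rw [hrefl]
      field_simp
    have e₂ : ∀ t, Real.sin (s * (1 - t)) / s * (A / s * Real.sin (s * t)) =
        -(A / s ^ 2) * Real.sin (s * t) ^ 2 := fun t => by
      rw [hrefl]
      field_simp
    rw [volterra_glue_one hc₁ hc₂]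
    simp only [e₁, e₂]
    rw [intervalIntegral.integral_const_mul, intervalIntegral.integral_const_mul, hsq₁, hsq₂]
    field_simp
    ring
  have habs : ∀ x ∈ Icc (0 : ℝ) 1, ∫ t in (0 : ℝ)..x, |Real.sin (s * (x - t))| ≤ 1 := by
    intro x hx
    refine (Real.le_norm_self _).trans ((intervalIntegral.norm_integral_le_of_norm_le_const (C := 1)
      fun t _ => ?_).trans ?_)
    · rw [Real.norm_eq_abs, abs_abs]
      exact Real.abs_sin_le_one _
    · rw [sub_zero, abs_of_nonneg hx.1, one_mul]
      exact hx.2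
  have hM : (1 + A) / s ≤ 1 / 2 := by
    rw [div_le_iff₀ hs0]
    linarith
  have hMpos : 0 < (1 + A) / s := by positivity
  have hβM : (1 + A) / (4 * s) = (1 + A) / s / 4 := by field_simp
  refine ⟨⟨hs0, by positivity, by rw [hβM]; linarith, by positivity, zero_le_one, le_rfl,
    by linarith, continuousOn_glue hc₁.continuousOn hc₂.continuousOn hmatch, fun x _ => ?_, ?_,
    habs 1 (by norm_num), habs, fun x hx => ?_, ?_, ?_, ?_, ?_⟩, hvol⟩
  · have h1 := Real.abs_sin_le_one (s * x)
    unfold glue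
    split_ifs
    · rw [abs_div, abs_of_pos hs0]
      gcongr
      linarith
    · rw [abs_mul, abs_div, abs_of_pos hs0, abs_of_nonneg hA0, div_mul_eq_mul_div]
      gcongr
      nlinarith
  · rw [hvol, abs_neg, abs_of_nonneg (by positivity)]
  · refine (integral_mul_abs_glue_le hc₁ hc₂ (by fun_prop) hx).trans ?_
    have e₁ : ∀ t, |Real.sin (s * (x - t))| * |Real.sin (s * t) / s| =
        1 / s * (|Real.sin (s * (x - t))| * |Real.sin (s * t)|) := fun t => by
      rw [abs_div, abs_of_pos hs0]
      ring
    have e₂ : ∀ t, |Real.sin (s * (x - t))| * |A / s * Real.sin (s * t)| =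
        A / s * (|Real.sin (s * (x - t))| * |Real.sin (s * t)|) := fun t => by
      rw [abs_mul, abs_div, abs_of_pos hs0, abs_of_nonneg hA0]
      ring
    simp only [e₁, e₂]
    rw [intervalIntegral.integral_const_mul, intervalIntegral.integral_const_mul]
    -- Each half contributes at most (1/4 + 1/4)/2 = 1/4 times its amplitude, which gives (1 +
    -- A)/(4s) = β and thus θ = 1.
    have h₁ := integral_abs_mul_le (f := fun t => Real.sin (s * (x - t)))
      (g := fun t => Real.sin (s * t)) (show (0 : ℝ) ≤ 1 / 2 by norm_num)
      (Continuous.continuousOn (by fun_prop)) (Continuous.continuousOn (by fun_prop))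
    have h₂ := integral_abs_mul_le (f := fun t => Real.sin (s * (x - t)))
      (g := fun t => Real.sin (s * t)) (show (1 / 2 : ℝ) ≤ 1 by norm_num)
      (Continuous.continuousOn (by fun_prop)) (Continuous.continuousOn (by fun_prop))
    rw [hker₁, hsq₁] at h₁
    rw [hker₂, hsq₂] at h₂
    have h₃ := mul_le_mul_of_nonneg_left h₁ (show 0 ≤ 1 / s by positivity)
    have h₄ := mul_le_mul_of_nonneg_left h₂ (show 0 ≤ A / s by positivity)
    refine (add_le_add h₃ h₄).trans_eq ?_
    field_simp
    ring
  -- θζ + η = 1 + 1 = κs: equality, which determines κ = 2/s.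
  · rw [div_mul_cancel₀ _ hsne]
    norm_num
  · rw [div_mul_cancel₀ _ hsne]
    norm_num
  · rw [div_mul_cancel₀ _ hsne, hβM]
    linarith
  · rw [hβM]
    linarith

theorem solvesTransmission_periodic {s A : ℝ} {n : ℕ} (hn : 1 ≤ n) (hs : s = 2 * Real.pi * n)
    (hA : A = (-1) ^ n + 1) :
    SolvesTransmission (fun x => -(s ^ 2 * (Real.sin (s * x) / s)))
      (fun x => -(s ^ 2 * (A / s * Real.sin (s * x)))) 1 1
      (fun x => Real.sin (s * x) / s) (fun x => A / s * Real.sin (s * x)) := by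
  have hsne : s ≠ 0 := by
    rw [hs]
    have : (n : ℝ) ≠ 0 := by exact_mod_cast (by omega : n ≠ 0)
    positivity
  have h₁ := secondDerivEq_sin s (1 / s) 0 0 (1 / 2)
  have h₂ := secondDerivEq_sin s (A / s) 0 (1 / 2) 1
  have hcos : Real.cos (s * (1 / 2)) = (-1) ^ n := by
    rw [hs, show 2 * Real.pi * n * (1 / 2) = n * Real.pi by ring, Real.cos_nat_mul_pi]
  have hsin : Real.sin (s * (1 / 2)) = 0 := by
    rw [hs, show 2 * Real.pi * n * (1 / 2) = n * Real.pi by ring, Real.sin_nat_mul_pi]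
  have hsin1 : Real.sin (s * 1) = 0 := by
    rw [show s * 1 = 2 * (s * (1 / 2)) by ring, Real.sin_two_mul, hsin]
    ring
  have hsq : ((-1 : ℝ) ^ n) * (-1) ^ n = 1 := by
    rw [← mul_pow]
    norm_num
  simp only [add_zero] at h₁ h₂
  refine ⟨_, _, h₁.congr (fun x _ => by ring) (fun x _ => by ring), h₂, ?_, ?_, ?_, ?_, ?_⟩
  · simp
  · simp only [hsin1, mul_zero]
  · simp [hsne]
  · simp only [hsin, mul_zero, zero_div, sub_zero]
  -- The jump of the derivative is (A - 1) cos(s/2) = (-1)^n (-1)^n = 1.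
  · simp only [hcos]
    rw [hA]
    field_simp
    linear_combination hsq

end PeriodicTrial

section QuasiperiodicTrial

variable {s : ℝ}

theorem integral_sin_mul_sq_half (hs : s ≠ 0) :
    (∫ t in (0 : ℝ)..(1 / 2), Real.sin (s * t) ^ 2 = 1 / 4 - Real.sin s / (4 * s)) ∧
      ∫ t in (1 / 2 : ℝ)..1, Real.sin (s * (1 - t)) ^ 2 = 1 / 4 - Real.sin s / (4 * s) := by
  constructor
  · have := integral_sin_mul_add_sq hs 0 0 (1 / 2)
    simp only [add_zero, mul_zero, Real.sin_zero] at this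
    rw [this, show 2 * (s * (1 / 2)) = s by ring]
    ring
  · rw [integral_sin_mul_sub_sq hs, show 2 * (s * (1 - 1 / 2)) = s by ring, sub_self, mul_zero,
      mul_zero, Real.sin_zero]
    ring

theorem integral_abs_sin_mul_sub_le (hs : 4 ≤ s) {x : ℝ} (hx : x ∈ Icc (0 : ℝ) 1) :
    ∫ t in (0 : ℝ)..x, Real.sin (s * (x - t)) ^ 2 ≤ 9 / 16 ∧
      ∫ t in (0 : ℝ)..x, |Real.sin (s * (x - t))| ≤ 3 / 4 := by
  have hs0 : 0 < s := by linarith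
  have hsq : ∫ t in (0 : ℝ)..x, Real.sin (s * (x - t)) ^ 2 ≤ 9 / 16 := by
    rw [integral_sin_mul_sub_sq hs0.ne']
    simp only [sub_self, mul_zero, Real.sin_zero, sub_zero]
    have h1 : -(1 / 16) ≤ Real.sin (2 * (s * x)) / (4 * s) := by
      rw [le_div_iff₀ (by positivity)]
      linarith [Real.neg_one_le_sin (2 * (s * x))]
    linarith [hx.2]
  refine ⟨hsq, ?_⟩
  have i₁ : IntervalIntegrable (fun t => Real.sin (s * (x - t)) ^ 2) volume 0 x :=
    Continuous.intervalIntegrable (by fun_prop) _ _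
  -- The inequality |y| ≤ (2/3) y² + 3/8 is (|y| - 3/4)² ≥ 0; with ∫ sin² ≤ 1/2 + 1/16 it gives 3/8
  -- + 3/8.
  have h2 : ∫ t in (0 : ℝ)..x, |Real.sin (s * (x - t))| ≤
      ∫ t in (0 : ℝ)..x, (2 / 3 * Real.sin (s * (x - t)) ^ 2 + 3 / 8) := by
    refine intervalIntegral.integral_mono_on hx.1 (Continuous.intervalIntegrable (by fun_prop) _ _)
      (Continuous.intervalIntegrable (by fun_prop) _ _) fun t _ => ?_
    nlinarith [sq_nonneg (|Real.sin (s * (x - t))| - 3 / 4), sq_abs (Real.sin (s * (x - t)))]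
  rw [intervalIntegral.integral_add (i₁.const_mul _) intervalIntegrable_const,
    intervalIntegral.integral_const_mul, intervalIntegral.integral_const, sub_zero,
    smul_eq_mul] at h2
  linarith [hx.2]

/-- The two halves give 1/8 + sin s/(4s) and 1/4 - sin s/(4s), up to 1/s². The sine terms cancel,
which makes the constant 3/8 exact; the value 1/8 comes from cos s = -1/2. -/
theorem volterra_quasiperiodic (hs : s ≠ 0) (hcos : Real.cos (s / 2) = -(1 / 2)) :
    volterra s (glue (fun x => Real.sin (s * x) / s) (fun x => Real.sin (s * (1 - x)) / s)) 1 =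
      3 / (8 * s) / s := by
  have hcos1 : Real.cos s = -(1 / 2) := by
    rw [show s = 2 * (s / 2) by ring, Real.cos_two_mul, hcos]
    norm_num
  have hcross : ∫ t in (0 : ℝ)..(1 / 2), Real.sin (s * (1 - t)) * Real.sin (s * t) =
      Real.sin s / (4 * s) + 1 / 8 := by
    have hderiv : ∀ t ∈ uIcc (0 : ℝ) (1 / 2),
        HasDerivAt (fun t => Real.sin (s * (2 * t - 1)) / (4 * s) - t / 2 * Real.cos s)
          (Real.sin (s * (1 - t)) * Real.sin (s * t)) t := fun t _ => by
      have h1 : HasDerivAt (fun t => s * (2 * t - 1)) (s * (2 * 1)) t :=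
        (((hasDerivAt_id t).const_mul 2).sub_const 1).const_mul s
      have h2 := (h1.sin.div_const (4 * s)).sub
        (((hasDerivAt_id t).div_const 2).mul_const (Real.cos s))
      refine h2.congr_deriv ?_
      have e1 : s * (2 * t - 1) = s * t - s * (1 - t) := by ring
      have e2 : Real.cos s = Real.cos (s * t + s * (1 - t)) := by
        congr 1
        ring
      rw [e1, e2, Real.cos_sub, Real.cos_add]
      field_simp
      ring
    rw [intervalIntegral.integral_eq_sub_of_hasDerivAt hderiv
      (Continuous.intervalIntegrable (by fun_prop) _ _), hcos1,
      show s * (2 * (1 / 2) - 1) = 0 by ring, show s * (2 * 0 - 1) = -s by ring, Real.sin_neg,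
      Real.sin_zero]
    ring
  have e₁ : ∀ t, Real.sin (s * (1 - t)) / s * (Real.sin (s * t) / s) =
      1 / s ^ 2 * (Real.sin (s * (1 - t)) * Real.sin (s * t)) := fun t => by field_simp
  have e₂ : ∀ t, Real.sin (s * (1 - t)) / s * (Real.sin (s * (1 - t)) / s) =
      1 / s ^ 2 * Real.sin (s * (1 - t)) ^ 2 := fun t => by field_simp
  rw [volterra_glue_one (by fun_prop) (by fun_prop)]
  simp only [e₁, e₂]
  rw [intervalIntegral.integral_const_mul, intervalIntegral.integral_const_mul, hcross,
    (integral_sin_mul_sq_half hs).2]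
  field_simp
  ring

/-- The trial functions `sin (s x) / s`, `sin (s (1 - x)) / s` for `cos (s / 2) = -1 / 2`. -/
theorem trialBounds_quasiperiodic (hs : 4 ≤ s) (hcos : Real.cos (s / 2) = -(1 / 2)) :
    TrialBounds s (3 / (8 * s)) ((2 + √3) / (√3 * s)) (19 / 12) (3 / 4) (3 / 4) (1 / s)
      (glue (fun x => Real.sin (s * x) / s) (fun x => Real.sin (s * (1 - x)) / s)) := by
  have hs0 : 0 < s := by linarith
  have hsne : s ≠ 0 := hs0.ne'
  have hc₁ : Continuous fun x => Real.sin (s * x) / s := by fun_prop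
  have hc₂ : Continuous fun x => Real.sin (s * (1 - x)) / s := by fun_prop
  have hmatch : (fun x => Real.sin (s * x) / s) (1 / 2) =
      (fun x => Real.sin (s * (1 - x)) / s) (1 / 2) := by
    simp only [show (1 : ℝ) - 1 / 2 = 1 / 2 by norm_num]
  have h3 : 0 < √3 := Real.sqrt_pos.mpr (by norm_num)
  have h32 : √3 ≤ 2 := Real.sqrt_le_iff.mpr (by norm_num)
  -- Of κ only κs = 1 + 2/√3 ≥ 2 is needed, since θζ + η = 19/16 + 3/4 = 31/16.
  have hκ : 2 ≤ (2 + √3) / (√3 * s) * s := by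
    have : (2 + √3) / (√3 * s) * s = (2 + √3) / √3 := by field_simp
    rw [this, le_div_iff₀ h3]
    linarith
  have hM0 : 0 < 1 / s := by positivity
  have hM : 1 / s ≤ 1 / 4 := one_div_le_one_div_of_le (by norm_num) hs
  have hβM : 3 / (8 * s) = 3 / 8 * (1 / s) := by field_simp
  have hvol := volterra_quasiperiodic hsne hcos
  refine ⟨hs0, by positivity, by rw [hβM]; linarith, by positivity, by norm_num, by norm_num,
    by linarith, continuousOn_glue hc₁.continuousOn hc₂.continuousOn hmatch, fun x _ => ?_, ?_,
    (integral_abs_sin_mul_sub_le hs (by norm_num)).2,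
    fun x hx => (integral_abs_sin_mul_sub_le hs hx).2, fun x hx => ?_, ?_, ?_, ?_, ?_⟩
  · unfold glue
    split_ifs <;> rw [abs_div, abs_of_pos hs0] <;> gcongr <;> exact Real.abs_sin_le_one _
  · rw [hvol, abs_of_nonneg (by positivity)]
  · have hsub : Icc 0 x ⊆ Icc (0 : ℝ) 1 := Icc_subset_Icc_right hx.2
    have hgc := continuousOn_glue hc₁.continuousOn hc₂.continuousOn hmatch
    -- For s ≥ 4 the full integral 1/2 - sin s/(2s) is at most 5/8. Averaged with 9/16 for the
    -- kernel it gives 19/32 = θ · 3/8, whence θ = 19/12.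
    have hgs : (∫ t in (0 : ℝ)..x, (s * glue (fun x => Real.sin (s * x) / s)
        (fun x => Real.sin (s * (1 - x)) / s) t) ^ 2) ≤ 5 / 8 := by
      have e : (fun t => (s * glue (fun x => Real.sin (s * x) / s)
          (fun x => Real.sin (s * (1 - x)) / s) t) ^ 2) =
          glue (fun t => Real.sin (s * t) ^ 2) (fun t => Real.sin (s * (1 - t)) ^ 2) := by
        funext t
        unfold glue
        split_ifs <;> field_simp
      obtain ⟨hi, hI⟩ := integral_glue (f₁ := fun t => Real.sin (s * t) ^ 2)
        (f₂ := fun t => Real.sin (s * (1 - t)) ^ 2)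
        (Continuous.intervalIntegrable (by fun_prop) _ _)
        (Continuous.intervalIntegrable (by fun_prop) _ _)
      rw [(integral_sin_mul_sq_half hsne).1, (integral_sin_mul_sq_half hsne).2] at hI
      have h1 : -(1 / 16) ≤ Real.sin s / (4 * s) := by
        rw [le_div_iff₀ (by positivity)]
        linarith [Real.neg_one_le_sin s]
      refine le_trans ?_ (hI.trans_le (by linarith))
      rw [← e] at hi ⊢
      exact intervalIntegral.integral_mono_interval le_rfl hx.1 hx.2
        (Filter.Eventually.of_forall fun _ => sq_nonneg _) hi
    have h4 := integral_abs_mul_le (f := fun t => Real.sin (s * (x - t))) (g := fun t => s *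
        glue (fun x => Real.sin (s * x) / s) (fun x => Real.sin (s * (1 - x)) / s) t) hx.1
      (Continuous.continuousOn (by fun_prop)) (continuousOn_const.mul (hgc.mono hsub))
    have h5 := (integral_abs_sin_mul_sub_le hs hx).1
    have e : ∀ t, |Real.sin (s * (x - t))| * |s * glue (fun x => Real.sin (s * x) / s)
        (fun x => Real.sin (s * (1 - x)) / s) t| = s * (|Real.sin (s * (x - t))| *
          |glue (fun x => Real.sin (s * x) / s) (fun x => Real.sin (s * (1 - x)) / s) t|) :=
      fun t => by
        rw [abs_mul, abs_of_pos hs0]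
        ring
    simp only [e] at h4
    rw [intervalIntegral.integral_const_mul] at h4
    rw [show 19 / 12 * (3 / (8 * s)) = 19 / 32 / s by field_simp; norm_num, le_div_iff₀ hs0]
    linarith
  · linarith
  · linarith
  · rw [hβM]
    nlinarith
  · rw [hβM]
    linarith

theorem solvesTransmission_quasiperiodic (hs : s ≠ 0) (hcos : Real.cos (s / 2) = -(1 / 2)) :
    SolvesTransmission (fun x => -(s ^ 2 * (Real.sin (s * x) / s)))
      (fun x => -(s ^ 2 * (Real.sin (s * (1 - x)) / s))) 1 1
      (fun x => Real.sin (s * x) / s) (fun x => Real.sin (s * (1 - x)) / s) := by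
  have h₁ := secondDerivEq_sin s (1 / s) 0 0 (1 / 2)
  have h₂ := secondDerivEq_sin (-s) (1 / s) s (1 / 2) 1
  simp only [add_zero] at h₁
  have e : ∀ x, -s * x + s = s * (1 - x) := fun x => by ring
  simp only [e, neg_sq] at h₂
  refine ⟨_, _, h₁.congr (fun x _ => by ring) (fun x _ => by ring),
    h₂.congr (fun x _ => by ring) (fun x _ => by ring), by simp, by simp, ?_, ?_, ?_⟩
  · simp [hs]
  · simp only [show (1 : ℝ) - 1 / 2 = 1 / 2 by norm_num, sub_self]
  -- The second branch is the mirror image of the first, so the jump of the derivative is -2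
  -- cos(s/2) = 1.
  · simp only [show (1 : ℝ) - 1 / 2 = 1 / 2 by norm_num, show s * (1 / 2) = s / 2 by ring, hcos]
    field_simp
    norm_num

end QuasiperiodicTrial

theorem fdConverges_quasiperiodic {q N G : ℝ → ℝ} {c ε s : ℝ} (hs : 4 ≤ s)
    (hcos : Real.cos (s / 2) = -(1 / 2))
    (hq : IntegrableOn q (Ioo 0 1)) (hN : ContDiff ℝ ∞ N) (hN0 : N 0 = 0) (hG : ContDiff ℝ ∞ G)
    (hdom : ∀ (k : ℕ) (u : ℝ), |iteratedDeriv k N u| ≤ iteratedDeriv k G |u|)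
    (hc : 0 < c) (hε : 0 < ε)
    (hv : ∀ j : ℕ, 1 ≤ j → majorantRadius (∫ x in Ioo (0 : ℝ) 1, |q x|) G ^ j *
      ENNReal.ofReal (majorantSeq (∫ x in Ioo (0 : ℝ) 1, |q x|) G j) ≤
        ENNReal.ofReal (c / (j : ℝ) ^ (1 + ε))) :
    FDConverges q N G (s ^ 2) (fun x => Real.sin (s * x) / s)
      (fun x => Real.sin (s * (1 - x)) / s) (8 * s / 3) (fun x => Real.sin (s * (1 - x)))
      ((2 + √3) / (√3 * s)) (3 / (8 * s)) c ε := by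
  have hsne : s ≠ 0 := by linarith
  refine fdConverges_of_trialBounds (σ := 1) (trialBounds_quasiperiodic hs hcos) (by fun_prop)
    (by fun_prop) ?_ (fun t => (one_mul _).symm) ?_ (solvesTransmission_quasiperiodic hsne hcos)
    hq hN hN0 hG hdom hc hε hv
  · simp only [show (1 : ℝ) - 1 / 2 = 1 / 2 by norm_num]
  · rw [volterra_quasiperiodic hsne hcos]
    field_simp

theorem fdConverges_periodic {q N G : ℝ → ℝ} {c ε : ℝ} {n : ℕ} (hn : 1 ≤ n)
    (hq : IntegrableOn q (Ioo 0 1)) (hN : ContDiff ℝ ∞ N) (hN0 : N 0 = 0) (hG : ContDiff ℝ ∞ G)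
    (hdom : ∀ (k : ℕ) (u : ℝ), |iteratedDeriv k N u| ≤ iteratedDeriv k G |u|)
    (hc : 0 < c) (hε : 0 < ε)
    (hv : ∀ j : ℕ, 1 ≤ j → majorantRadius (∫ x in Ioo (0 : ℝ) 1, |q x|) G ^ j *
      ENNReal.ofReal (majorantSeq (∫ x in Ioo (0 : ℝ) 1, |q x|) G j) ≤
        ENNReal.ofReal (c / (j : ℝ) ^ (1 + ε))) :
    FDConverges q N G (4 * Real.pi ^ 2 * n ^ 2)
      (fun x => Real.sin (2 * Real.pi * n * x) / (2 * Real.pi * n))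
      (fun x => ((-1) ^ n + 1) / (2 * Real.pi * n) * Real.sin (2 * Real.pi * n * x))
      (if Even n then 8 * Real.pi * n / 3 else 8 * Real.pi * n)
      (fun x => Real.sin (2 * Real.pi * n * x))
      (1 / (Real.pi * n))
      (if Even n then 3 / (8 * Real.pi * n) else 1 / (8 * Real.pi * n)) c ε := by
  obtain ⟨s, hs⟩ : ∃ s, s = 2 * Real.pi * n := ⟨_, rfl⟩
  obtain ⟨A, hA⟩ : ∃ A : ℝ, A = (-1) ^ n + 1 := ⟨_, rfl⟩
  have hn0 : (n : ℝ) ≠ 0 := by exact_mod_cast (by omega : n ≠ 0)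
  have hs0 : 0 < s := by
    rw [hs]
    positivity
  have hA02 : (Even n ∧ A = 2) ∨ (¬Even n ∧ A = 0) := by
    rcases Nat.even_or_odd n with h | h
    · exact Or.inl ⟨h, by rw [hA, h.neg_one_pow]; norm_num⟩
    · exact Or.inr ⟨Nat.not_even_iff_odd.mpr h, by rw [hA, h.neg_one_pow]; norm_num⟩
  have hA0 : 0 ≤ A := by rcases hA02 with ⟨-, h⟩ | ⟨-, h⟩ <;> rw [h]; norm_num
  have hA2 : A ≤ 2 := by rcases hA02 with ⟨-, h⟩ | ⟨-, h⟩ <;> rw [h]; norm_num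
  have eγ : (if Even n then 8 * Real.pi * n / 3 else 8 * Real.pi * n) = 4 * s / (1 + A) := by
    rcases hA02 with ⟨h, h'⟩ | ⟨h, h'⟩
    · rw [if_pos h, h', hs]
      ring
    · rw [if_neg h, h', hs]
      ring
  have eβ : (if Even n then 3 / (8 * Real.pi * n) else 1 / (8 * Real.pi * n)) =
      (1 + A) / (4 * s) := by
    rcases hA02 with ⟨h, h'⟩ | ⟨h, h'⟩
    · rw [if_pos h, h', hs]
      ring
    · rw [if_neg h, h', hs]
      ring
  have eκ : 1 / (Real.pi * n) = 2 / s := by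
    rw [hs]
    field_simp
  have hlam : 4 * Real.pi ^ 2 * (n : ℝ) ^ 2 = s ^ 2 := by
    rw [hs]
    ring
  rw [eγ, eβ, eκ, hlam, ← hA, ← hs]
  obtain ⟨hT, hvol⟩ := trialBounds_periodic hn hs hA0 hA2
  -- σ = -1 because sin(s(1 - t)) = -sin(st) for s a multiple of 2π.
  refine fdConverges_of_trialBounds (σ := -1) hT (by fun_prop) (by fun_prop) ?_ (fun t => ?_) ?_
    (solvesTransmission_periodic hn hs hA) hq hN hN0 hG hdom hc hε hv
  · have : Real.sin (s * (1 / 2)) = 0 := by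
      rw [hs, show 2 * Real.pi * n * (1 / 2) = n * Real.pi by ring, Real.sin_nat_mul_pi]
    simp only [this, zero_div, mul_zero]
  · rw [hs, show 2 * Real.pi * n * (1 - t) = n * (2 * Real.pi) - 2 * Real.pi * n * t by ring,
      Real.sin_nat_mul_two_pi_sub]
    ring
  · have : 1 + A ≠ 0 := by linarith
    rw [hvol]
    field_simp

/-- The root is an absolute value, as the base is negative for n = 0 with the minus sign; this is
harmless because the cosine is even. The smallest root is 4π/3 > 4. -/
theorem cos_sqrt_half_of_eq {n : ℕ} {σ lam₀ : ℝ} (hσ : σ = 1 ∨ σ = -1)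
    (h : lam₀ = 4 * Real.pi ^ 2 * (σ * (2 / 3) + 2 * n) ^ 2) :
    4 ≤ √lam₀ ∧ Real.cos (√lam₀ / 2) = -(1 / 2) := by
  have e : √lam₀ = |2 * Real.pi * (σ * (2 / 3) + 2 * n)| := by
    rw [h, ← Real.sqrt_sq_eq_abs]
    congr 1
    ring
  constructor
  · have hge : 2 / 3 ≤ |σ * (2 / 3) + 2 * (n : ℝ)| := by
      have hn : (0 : ℝ) ≤ n := Nat.cast_nonneg n
      rcases hσ with rfl | rfl
      · exact le_trans (by linarith) (le_abs_self _)
      · rcases n with _ | n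
        · norm_num
        · push_cast at hn ⊢
          exact le_trans (by linarith) (le_abs_self _)
    rw [e, abs_mul, abs_of_pos (by positivity)]
    nlinarith [Real.pi_gt_three]
  · have hc : Real.cos (2 * (Real.pi / 3)) = -(1 / 2) := by
      rw [Real.cos_two_mul, Real.cos_pi_div_three]
      norm_num
    have e2 : √lam₀ / 2 = |σ * (2 * (Real.pi / 3)) + n * (2 * Real.pi)| := by
      rw [e, ← abs_of_pos (show (0 : ℝ) < 2 by norm_num), ← abs_div,
        abs_of_pos (show (0 : ℝ) < 2 by norm_num)]
      congr 1
      ring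
    rw [e2, Real.cos_abs, Real.cos_add_nat_mul_two_pi]
    rcases hσ with rfl | rfl
    · rw [one_mul, hc]
    · rw [neg_one_mul, Real.cos_neg, hc]

theorem theorem2
    (q : ℝ → ℝ) (hq : IntegrableOn q (Ioo 0 1))
    (N : ℝ → ℝ) (a : ℕ → ℝ) (hN : ∀ u : ℝ, HasSum (fun i : ℕ => a (i + 1) * u ^ (i + 1)) (N u))
    (Nbar : ℝ → ℝ) (hNbar : ContDiff ℝ ∞ Nbar)
    (hdom : ∀ (k : ℕ) (u : ℝ), |iteratedDeriv k N u| ≤ iteratedDeriv k Nbar |u|)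
    (Q : ℝ) (hQ : Q = ∫ x in Ioo (0 : ℝ) 1, |q x|)
    (v : ℕ → ℝ) (hv : v = majorantSeq Q Nbar)
    (R : ℝ≥0∞) (hR : R = majorantRadius Q Nbar) :
    -- the generating function has a positive radius of convergence and solves the equation
    0 < R ∧
    (∀ z : ℝ, 0 ≤ z → ENNReal.ofReal z < R →
      ∃ f : ℝ, HasSum (fun j : ℕ => z ^ j * v j) f ∧
        f - v 0 = (f - v 0) ^ 2 + (1 + v 0) * z *
          (Q * f + Nbar f + deriv Nbar (v 0) * v 0 - Nbar (v 0))) ∧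
    -- the constants of the estimates exist and depend only on the majorant sequence
    (∃ c > (0 : ℝ), ∃ ε > (0 : ℝ),
      ∀ j : ℕ, 1 ≤ j → R ^ j * ENNReal.ofReal (v j) ≤ ENNReal.ofReal (c / (j : ℝ) ^ (1 + ε))) ∧
    ∀ c > (0 : ℝ), ∀ ε > (0 : ℝ),
      (∀ j : ℕ, 1 ≤ j → R ^ j * ENNReal.ofReal (v j) ≤ ENNReal.ofReal (c / (j : ℝ) ^ (1 + ε))) →
      -- case (a)
      (∀ (n : ℕ) (σ : ℝ), σ = 1 ∨ σ = -1 →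
        ∀ lam₀ : ℝ, lam₀ = 4 * Real.pi ^ 2 * (σ * (2 / 3) + 2 * n) ^ 2 →
          FDConverges q N Nbar lam₀
            (fun x => Real.sin (√lam₀ * x) / √lam₀)
            (fun x => Real.sin (√lam₀ * (1 - x)) / √lam₀)
            (8 * √lam₀ / 3) (fun x => Real.sin (√lam₀ * (1 - x)))
            ((2 + √3) / (√3 * √lam₀)) (3 / (8 * √lam₀)) c ε) ∧
      -- case (b)
      (∀ n : ℕ, 1 ≤ n →
        FDConverges q N Nbar (4 * Real.pi ^ 2 * n ^ 2)
          (fun x => Real.sin (2 * Real.pi * n * x) / (2 * Real.pi * n))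
          (fun x => ((-1) ^ n + 1) / (2 * Real.pi * n) * Real.sin (2 * Real.pi * n * x))
          (if Even n then 8 * Real.pi * n / 3 else 8 * Real.pi * n)
          (fun x => Real.sin (2 * Real.pi * n * x))
          (1 / (Real.pi * n))
          (if Even n then 3 / (8 * Real.pi * n) else 1 / (8 * Real.pi * n)) c ε) := by
  -- The series of N starts at i = 1; it is padded with a zero constant term whatever a 0 is.
  have hNsum : ∀ u, HasSum (fun i => (if i = 0 then 0 else a i) * u ^ i) (N u) := fun u => by
    rw [← hasSum_nat_add_iff' 1]
    simpa using hN u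
  have hNc : ContDiff ℝ ∞ N := contDiff_of_hasSum_pow hNsum
  have hN0 : N 0 = 0 := by
    refine (hN 0).unique ?_
    simp
  have hpos := iteratedDeriv_nonneg_of_dominated hdom
  have hQ0 : 0 ≤ Q := hQ ▸ integral_nonneg fun _ => abs_nonneg _
  refine ⟨hR ▸ majorantRadius_pos hQ0 hNbar hpos, fun z hz hzR => ?_, ?_,
    fun c hc ε hε hdec => ⟨fun n σ hσ lam₀ hlam => ?_, fun n hn => ?_⟩⟩
  · rw [hR] at hzR
    have hs := summable_majorantSeq hz hzR
    rw [← hv] at hs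
    have hv0 : v 0 = 8 / 3 := by rw [hv, majorantSeq_zero]
    refine ⟨_, hs.hasSum, ?_⟩
    have h1 := hs.tsum_eq_zero_add
    rw [pow_zero, one_mul] at h1
    have h2 := majorant_equation hQ0 hNbar hpos hz (by rwa [← hv])
    rw [← hv, majorantRhs, ← hv0, ← h1] at h2
    rw [hv0] at h1 h2 ⊢
    rw [h1, add_sub_cancel_left, ← h1]
    linear_combination h2
  · rw [hR, hv]
    exact exists_majorantSeq_bound hQ0 hNbar hpos
  · obtain ⟨h4, hcos⟩ := cos_sqrt_half_of_eq hσ hlam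
    have h := fdConverges_quasiperiodic h4 hcos hq hNc hN0 hNbar hdom hc hε
      (by rw [← hQ, ← hv, ← hR]; exact hdec)
    rwa [Real.sq_sqrt (by rw [hlam]; positivity)] at h
  · exact fdConverges_periodic hn hq hNc hN0 hNbar hdom hc hε
      (by rw [← hQ, ← hv, ← hR]; exact hdec)
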